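/- Let $f=\frac1N\sum_{k=1}^N f_k:\mathbb{R}^d\to\mathbb{R}$ ($d,N\ge 1$), where each $f_k$ is differentiable and $\|\nabla f_k(x)-\nabla f_k(y)\|\le L\|x-y\|$ for all $x,y$ (smoothness), and $\langle\nabla f(x),x\rangle\ge m\|x\|^2-b$ for all $x$ (dissipativity), with $L,m>0$ and $b\ge 0$; $f$ is not assumed convex. For a probability density $p$ on $\mathbb{R}^d$ let $|p\rangle=\int\sqrt{p(x)}\,|x\rangle\,dx\in L^2(\mathbb{R}^d)$, and let $\pi\propto e^{-f}$. There are universal constants $\delta>0$, $K$ and $k,l\in\mathbb{N}$, and a constant $C$ depending only on $L,m,b$ (not on $d$, $N$ or $f$), such that for every such $f$ there are an integer $M\ge 2$ and widths $0<\sigma_1<\sigma_2<\dots<\sigma_{M-1}$ for which the states $|\mu_0\rangle,\dots,|\mu_{M-1}\rangle$ given by the densities $$\mu_0(x)\propto\exp\Big(-\frac{\|x\|^2}{2\sigma_1^2}\Big),\qquad \mu_i(x)\propto\exp\Big(-f(x)-\frac{\|x\|^2}{2\sigma_i^2}\Big)\quad(1\le i\le M-1)$$ satisfy: 1. The Gaussian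 state $|\mu_0\rangle$ can be prepared efficiently, without queries to $f$ or $\nabla f$: for every $\epsilon\in(0,1)$ there is a quantum circuit of one- and two-qubit gates, acting on $d$ registers of $q$ qubits and $a$ ancilla qubits initialized to $|0\rangle$, for which the total number of qubits and gates is at most $K\,(d(1+\log(1/\epsilon)))^k$ and whose output is within distance $\epsilon$ of $|\mu_0\rangle\otimes|0^a\rangle$; here a register basis state is identified with the normalized indicator function of the corresponding cell of a uniform cubic grid in $\mathbb{R}^d$. 2. $|\langle\mu_i|\mu_{i+1}\rangle|\ge\delta$ for all $0\le i\le M-2$. 3. $|\langle\mu_{M-1}|\pi\rangle|\ge\delta$. 4. $M=\tilde O(c_{\mathrm{LSI}}^{-1}d^{1/2})$: for every $c>0$ such that $\pi$ satisfies the log-Sobolev inequality with constant $c$, that is, $\int g\log g\,\pi\,dx\le\frac1{2c}\int\frac{\|\nabla g\|^2}{g}\,\pi\,dx$ for all smooth $g>0$ with $\int g\,\pi\,dx=1$ for which $g\log g$ and $\|\nabla g\|^2/g$ are $\pi$-integrable, one has $$M\le C\,c^{-1}\sqrt d\,\big(1+\log d+|\log c|\big)^l .$$ -/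

import Mathlib

noncomputable section

/-- The configuration space `ℝ^d` with the Euclidean norm. -/
abbrev Space (d : ℕ) : Type := EuclideanSpace ℝ (Fin d)

/-! ### The objective function and the assumptions on it -/

/-- The finite sum `f = (1/N) ∑ₖ fₖ`. -/
def finiteAverage {d N : ℕ} (fs : Fin N → Space d → ℝ) : Space d → ℝ :=
  fun x => (1 / (N : ℝ)) * ∑ k, fs k x

/-- Smoothness: every `fₖ` is differentiable with `L`-Lipschitz gradient. -/
def IsSmoothFamily {d N : ℕ} (L : ℝ) (fs : Fin N → Space d → ℝ) : Prop :=
  ∀ k, Differentiable ℝ (fs k) ∧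
    ∀ x y : Space d, ‖gradient (fs k) x - gradient (fs k) y‖ ≤ L * ‖x - y‖

/-- Dissipativeness: `⟨∇f(x), x⟩ ≥ m‖x‖² - b`. -/
def IsDissipative {d : ℕ} (m b : ℝ) (f : Space d → ℝ) : Prop :=
  ∀ x : Space d, m * ‖x‖ ^ 2 - b ≤ inner ℝ (gradient f x) x

/-! ### Gibbs densities, the log-Sobolev inequality, coherent states -/

/-- The normalized density proportional to `exp (-V)`. -/
def gibbsDensity {d : ℕ} (V : Space d → ℝ) : Space d → ℝ :=
  fun x => Real.exp (-V x) / ∫ y, Real.exp (-V y)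

/-- The probability density `ν` satisfies the log-Sobolev inequality with constant `c`:
`∫ g log g ν ≤ (1/2c) ∫ (‖∇g‖²/g) ν` for every smooth positive `g` with `∫ g ν = 1`
for which the two sides are meaningful. -/
def SatisfiesLSI {d : ℕ} (ν : Space d → ℝ) (c : ℝ) : Prop :=
  ∀ g : Space d → ℝ, ContDiff ℝ ((⊤ : ℕ∞) : WithTop ℕ∞) g → (∀ x, 0 < g x) →
    MeasureTheory.Integrable (fun x => g x * ν x) →
    (∫ x, g x * ν x) = 1 →
    MeasureTheory.Integrable (fun x => g x * Real.log (g x) * ν x) →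
    MeasureTheory.Integrable (fun x => ‖gradient g x‖ ^ 2 / g x * ν x) →
    (∫ x, g x * Real.log (g x) * ν x) ≤
      1 / (2 * c) * ∫ x, ‖gradient g x‖ ^ 2 / g x * ν x

/-- The wave function of the coherent state `|p⟩ = ∫ √(p x) |x⟩ dx` of a probability density. -/
def coherentState {d : ℕ} (p : Space d → ℝ) : Space d → ℂ :=
  fun x => ((Real.sqrt (p x) : ℝ) : ℂ)

/-- The inner product `⟨ψ|φ⟩` of `L²(ℝ^d)`. -/
def braket {d : ℕ} (ψ φ : Space d → ℂ) : ℂ :=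
  ∫ x, (starRingEnd ℂ) (ψ x) * φ x

/-- The states of the annealing schedule with widths `σ 1, σ 2, …`: `|μ₀⟩` is the coherent state of
the Gaussian density `∝ exp (-‖x‖²/2σ₁²)`, and for `i ≥ 1` the state `|μᵢ⟩` is the coherent state
of the density `∝ exp (-f(x) - ‖x‖²/2σᵢ²)`. -/
def annealingState {d : ℕ} (f : Space d → ℝ) (σ : ℕ → ℝ) (i : ℕ) : Space d → ℂ :=
  if i = 0 then coherentState (gibbsDensity fun x => ‖x‖ ^ 2 / (2 * σ 1 ^ 2))
  else coherentState (gibbsDensity fun x => f x + ‖x‖ ^ 2 / (2 * σ i ^ 2))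

/-! ### Quantum circuits and state preparation -/

/-- An elementary gate on qubits labelled by `ι`: an arbitrary unitary on two distinct qubits
(in particular, every one-qubit gate). No oracle gates are available. -/
structure QGate (ι : Type) where
  fst : ι
  snd : ι
  ne : fst ≠ snd
  mat : Matrix (Bool × Bool) (Bool × Bool) ℂ
  unitary : mat ∈ Matrix.unitaryGroup (Bool × Bool) ℂ

/-- The action of a gate on a state vector, given by its amplitudes in the computational basis. -/
def QGate.apply {ι : Type} [DecidableEq ι] (G : QGate ι) (ψ : (ι → Bool) → ℂ) :
    (ι → Bool) → ℂ :=
  fun z => ∑ s : Bool × Bool, G.mat (z G.fst, z G.snd) s *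
    ψ (Function.update (Function.update z G.fst s.1) G.snd s.2)

/-- The computational basis state `|0…0⟩`. -/
def zeroKet {ι : Type} [Fintype ι] : (ι → Bool) → ℂ :=
  fun z => if z = fun _ => false then 1 else 0

/-- The output of a circuit (a list of gates, applied from left to right) on `|0…0⟩`. -/
def circuitOutput {ι : Type} [Fintype ι] [DecidableEq ι] (gates : List (QGate ι)) :
    (ι → Bool) → ℂ :=
  gates.foldl (fun ψ G => G.apply ψ) zeroKet

/-- The integer in `[0, 2^q)` whose binary digits are stored in a `q`-qubit register. -/
def registerValue {q : ℕ} (y : Fin q → Bool) : ℕ :=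
  ∑ j, if y j then 2 ^ (j : ℕ) else 0

/-- The cube of side `h` that the basis state `|y⟩` of `d` registers of `q` qubits stands for.
The cubes tile `[-h 2^q/2, h 2^q/2)^d`. -/
def gridCell {d q : ℕ} (h : ℝ) (y : Fin d × Fin q → Bool) : Set (Space d) :=
  {x | ∀ a : Fin d,
    h * ((registerValue fun j => y (a, j) : ℝ) - 2 ^ q / 2) ≤ x a ∧
      x a < h * ((registerValue fun j => y (a, j) : ℝ) + 1 - 2 ^ q / 2)}

/-- The isometric embedding of the states of `d` registers of `q` qubits into `L²(ℝ^d)`: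
`|y⟩` is sent to the normalized indicator function of its cube. -/
def gridState {d q : ℕ} (h : ℝ) (φ : (Fin d × Fin q → Bool) → ℂ) : Space d → ℂ :=
  fun x => ∑ y, φ y * ((1 / Real.sqrt (h ^ d) : ℝ) : ℂ) *
    (gridCell h y).indicator (fun _ => (1 : ℂ)) x

/-- The state `ψ ∈ L²(ℝ^d)` can be prepared up to error `ε` at cost `s`: for some grid of width `h`
there is a quantum circuit on `d` registers of `q` qubits and `a` ancilla qubits, all initially in
`|0⟩`, the numbers of whose qubits and gates add up to at most `s`, whose output is at distance
at most `ε` from `ψ ⊗ |0^a⟩` in `L²(ℝ^d) ⊗ (ℂ²)^{⊗a}` (the sum below runs over the basis states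
`|w⟩` of the ancillas). -/
def PreparableAtCost {d : ℕ} (ψ : Space d → ℂ) (ε s : ℝ) : Prop :=
  ∃ (h : ℝ) (q a : ℕ) (gates : List (QGate ((Fin d × Fin q) ⊕ Fin a))),
    0 < h ∧
    ((d * q + a + gates.length : ℕ) : ℝ) ≤ s ∧
    (∑ w : Fin a → Bool, ∫⁻ x : Space d,
      ‖gridState h (fun y => circuitOutput gates (Sum.elim y w)) x
        - (if w = fun _ => false then ψ x else 0)‖ₑ ^ 2) ≤ ENNReal.ofReal (ε ^ 2)

end

/-! Annealing. Put β = 1/σ² and F(β) = log ∫ exp(-f - β‖x‖²/2), the function `logPartition f`. The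
overlap of the states at parameters s and t equals exp(F((s+t)/2) - (F(s)+F(t))/2), so overlap at
least δ = exp(-1) means that the midpoint gap of F is at most 1. Smoothness and dissipativity pinch
f between quadratics whose constants depend on L, m, b only (`isPinched_finiteAverage`). Hence F is
analytic and convex on β > -m/2, and is controlled by explicit Gaussian integrals.

The schedule runs from β = 4Ad, with A the upper curvature, where f is a bounded perturbation of the
Gaussian (`IsPinched.initial_overlap`), down to β of order 1/d, where dropping the Gaussian factor
costs O(1) because -F'(0) = O(d). In between, the midpoint gap on [a, b] is at most (b - a)(F'(b) -
F'(a))/4. With Ψ = βF' - F one has a(F'(b) - F'(a)) ≤ Ψ(b) - Ψ(a), so N steps of equal size in log β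
/ ℓ + Ψ / W, where ℓ and W bound the two total variations, have gap O(ℓW/N²) (`exists_subdivision`).
Since ℓ = O(1 + log d) and W = O(d(1 + log d)), N = O(√d (1 + log d)) steps suffice
(`IsPinched.exists_schedule`). No log-Sobolev inequality enters the construction: a Gaussian test
function bounds every admissible c by a dimension-free constant (`IsPinched.lsi_le`), so the factor
1/c comes for free.

Gaussian state. It is a product of d one-dimensional states, and on a window of radius 8n₀ the
amplitude is a polynomial of degree below D = 128n₀² up to an exponentially small error. Samples of
such polynomials on a binary grid form a space of dimension at most D that is preserved, up to a
translation of the argument, by fixing the last bit. The state is thus a matrix product state of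
bond dimension D and can be written bit by bit (`exists_sample_circuit`). The bond index is held in
unary by 2D ancillas, exactly one of them excited. There every real orthogonal map is a product of
at most 2D reflections, each of them a product of O(D) two-qubit gates (`isModeCircuit_isometry`).
-/

namespace GaussianPreparation

/-! ### Circuits as linear maps on amplitude vectors -/

section Circuits

variable {ι : Type} [DecidableEq ι]

/-- The linear map `U` is the action of a list of at most `n` gates. -/
def IsCircuit (n : ℕ) (U : ((ι → Bool) → ℂ) →ₗ[ℂ] ((ι → Bool) → ℂ)) : Prop :=
  ∃ gates : List (QGate ι), gates.length ≤ n ∧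
    ∀ ψ, gates.foldl (fun ψ G => G.apply ψ) ψ = U ψ

lemma IsCircuit.id : IsCircuit (ι := ι) 0 LinearMap.id :=
  ⟨[], by simp, by simp⟩

lemma IsCircuit.comp {n m : ℕ} {U V : ((ι → Bool) → ℂ) →ₗ[ℂ] ((ι → Bool) → ℂ)}
    (hU : IsCircuit n U) (hV : IsCircuit m V) : IsCircuit (n + m) (V ∘ₗ U) := by
  obtain ⟨l₁, h₁, h₁'⟩ := hU
  obtain ⟨l₂, h₂, h₂'⟩ := hV
  refine ⟨l₁ ++ l₂, by simp; omega, fun ψ => ?_⟩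
  simp [List.foldl_append, h₁', h₂']

lemma IsCircuit.mono {n m : ℕ} {U : ((ι → Bool) → ℂ) →ₗ[ℂ] ((ι → Bool) → ℂ)}
    (hU : IsCircuit n U) (h : n ≤ m) : IsCircuit m U := by
  obtain ⟨l₁, h₁, h₁'⟩ := hU
  exact ⟨l₁, h₁.trans h, h₁'⟩

/-- A gate as a linear map. -/
def gateMap (G : QGate ι) : ((ι → Bool) → ℂ) →ₗ[ℂ] ((ι → Bool) → ℂ) where
  toFun := G.apply
  map_add' ψ φ := by
    ext z; simp [QGate.apply, mul_add, Finset.sum_add_distrib]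
  map_smul' c ψ := by
    ext z; simp only [QGate.apply, Pi.smul_apply, smul_eq_mul, RingHom.id_apply, Finset.mul_sum]
    exact Finset.sum_congr rfl fun s _ => by ring

lemma isCircuit_gateMap (G : QGate ι) : IsCircuit 1 (gateMap G) :=
  ⟨[G], by simp, fun ψ => rfl⟩

variable [Fintype ι]

/-- The computational basis state `|z⟩`. -/
def ket (z : ι → Bool) : (ι → Bool) → ℂ := Pi.single z 1

/-- `QGate.apply` gathers amplitudes along a row of the matrix; this transposed form scatters a
basis state along a column. All later gate computations take place on basis states and extend by
linearity. -/
lemma gateMap_ket (G : QGate ι) (z₀ : ι → Bool) :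
    gateMap G (ket z₀) = ∑ s : Bool × Bool, G.mat s (z₀ G.fst, z₀ G.snd) •
      ket (Function.update (Function.update z₀ G.fst s.1) G.snd s.2) := by
  ext z
  have hne := G.ne
  have hL : gateMap G (ket z₀) z =
      G.mat (z G.fst, z G.snd) (z₀ G.fst, z₀ G.snd) *
        ket z₀ (Function.update (Function.update z G.fst (z₀ G.fst)) G.snd (z₀ G.snd)) := by
    change ∑ s : Bool × Bool, G.mat (z G.fst, z G.snd) s *
      ket z₀ (Function.update (Function.update z G.fst s.1) G.snd s.2) = _
    rw [Finset.sum_eq_single (z₀ G.fst, z₀ G.snd)]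
    · rintro ⟨a, b⟩ - hs
      rw [ket, Pi.single_apply, if_neg, mul_zero]
      rintro rfl
      apply hs
      simp [Function.update_of_ne hne]
    · simp
  rw [hL, Finset.sum_apply, Finset.sum_eq_single (z G.fst, z G.snd)]
  · simp only [Pi.smul_apply, smul_eq_mul, ket, Pi.single_apply]
    congr 1
    refine if_congr ⟨fun h => ?_, fun h => ?_⟩ rfl rfl
    · ext j
      have := congrFun h j
      by_cases h1 : j = G.snd
      · subst h1; simp
      · by_cases h2 : j = G.fst
        · subst h2; simp [Function.update_of_ne hne]
        · simpa [Function.update_of_ne h1, Function.update_of_ne h2] using this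
    · ext j
      have := congrFun h j
      by_cases h1 : j = G.snd
      · subst h1; simp
      · by_cases h2 : j = G.fst
        · subst h2; simp [Function.update_of_ne hne]
        · simpa [Function.update_of_ne h1, Function.update_of_ne h2] using this
  · rintro ⟨a, b⟩ - hs
    rw [Pi.smul_apply, ket, Pi.single_apply, if_neg, smul_zero]
    rintro rfl
    apply hs
    simp [Function.update_of_ne hne]
  · simp

end Circuits

/-! ### Elementary gates on one-excitation states -/

section OneHot

variable {R A : Type} [Fintype R] [DecidableEq R] [Fintype A] [DecidableEq A]

/-- The basis state with register content `y` and a single excited mode `k`. -/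
def oneHot (y : R → Bool) (k : A) : (R ⊕ A → Bool) → ℂ :=
  ket (Sum.elim y fun j => decide (j = k))

/-- The matrix of a reflection `[c s; s -c]` on the one-excitation states of two modes. -/
def modeMatrix (c s : ℝ) : Matrix (Bool × Bool) (Bool × Bool) ℂ :=
  Matrix.of fun a b => match a, b with
    | (true, false), (true, false) => (c : ℂ)
    | (true, false), (false, true) => (s : ℂ)
    | (false, true), (true, false) => (s : ℂ)
    | (false, true), (false, true) => -(c : ℂ)
    | (false, false), (false, false) => 1
    | (true, true), (true, true) => 1
    | _, _ => 0

lemma modeMatrix_mem {c s : ℝ} (h : c ^ 2 + s ^ 2 = 1) :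
    modeMatrix c s ∈ Matrix.unitaryGroup (Bool × Bool) ℂ := by
  have h' : (c : ℂ) * c + s * s = 1 := by
    have := congrArg (fun x : ℝ => (x : ℂ)) h
    push_cast at this
    linear_combination this
  rw [Matrix.mem_unitaryGroup_iff]
  ext ⟨a, b⟩ ⟨a', b'⟩
  cases a <;> cases b <;> cases a' <;> cases b' <;>
    simp [modeMatrix, Matrix.mul_apply, Fintype.sum_prod_type, Matrix.star_apply,
      Matrix.one_apply, h'] <;> first | ring1 | linear_combination h'

/-- The gate that reflects the modes `i`, `j` by `[c s; s -c]`. -/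
def modeGate (i j : A) (hij : i ≠ j) (c s : ℝ) (h : c ^ 2 + s ^ 2 = 1) : QGate (R ⊕ A) where
  fst := Sum.inr i
  snd := Sum.inr j
  ne := by simpa using hij
  mat := modeMatrix c s
  unitary := modeMatrix_mem h

/-- The controlled-NOT gate matrix (first qubit controls second). -/
def cnotMatrix : Matrix (Bool × Bool) (Bool × Bool) ℂ :=
  Matrix.of fun a b => if a = (b.1, xor b.1 b.2) then 1 else 0

lemma cnotMatrix_mem : cnotMatrix ∈ Matrix.unitaryGroup (Bool × Bool) ℂ := by
  rw [Matrix.mem_unitaryGroup_iff]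
  ext ⟨a, b⟩ ⟨a', b'⟩
  cases a <;> cases b <;> cases a' <;> cases b' <;>
    simp [cnotMatrix, Matrix.mul_apply, Fintype.sum_prod_type, Matrix.star_apply,
      Matrix.one_apply]

/-- The gate that flips the register qubit `r` if the mode `k` is excited. -/
def cnotGate (k : A) (r : R) : QGate (R ⊕ A) where
  fst := Sum.inr k
  snd := Sum.inl r
  ne := by simp
  mat := cnotMatrix
  unitary := cnotMatrix_mem

/-- The controlled-`Z` gate matrix. -/
def czMatrix : Matrix (Bool × Bool) (Bool × Bool) ℂ :=
  Matrix.diagonal fun a => if a.1 && a.2 then -1 else 1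

lemma czMatrix_mem : czMatrix ∈ Matrix.unitaryGroup (Bool × Bool) ℂ := by
  rw [Matrix.mem_unitaryGroup_iff]
  ext ⟨a, b⟩ ⟨a', b'⟩
  cases a <;> cases b <;> cases a' <;> cases b' <;>
    simp [czMatrix, Matrix.mul_apply, Fintype.sum_prod_type, Matrix.star_apply,
      Matrix.one_apply, Matrix.diagonal_apply]

/-- The controlled-`Z` gate between the mode `k` and the register qubit `r`. -/
def czGate (k : A) (r : R) : QGate (R ⊕ A) where
  fst := Sum.inr k
  snd := Sum.inl r
  ne := by simp
  mat := czMatrix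
  unitary := czMatrix_mem

/-- The `X` gate on the first of two qubits. -/
def notMatrix : Matrix (Bool × Bool) (Bool × Bool) ℂ :=
  Matrix.of fun a b => if a = (!b.1, b.2) then 1 else 0

lemma notMatrix_mem : notMatrix ∈ Matrix.unitaryGroup (Bool × Bool) ℂ := by
  rw [Matrix.mem_unitaryGroup_iff]
  ext ⟨a, b⟩ ⟨a', b'⟩
  cases a <;> cases b <;> cases a' <;> cases b' <;>
    simp [notMatrix, Matrix.mul_apply, Fintype.sum_prod_type, Matrix.star_apply,
      Matrix.one_apply]

/-- The `X` gate on the mode `i`; the mode `j` is a spectator. -/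
def notGate (i j : A) (hij : i ≠ j) : QGate (R ⊕ A) where
  fst := Sum.inr i
  snd := Sum.inr j
  ne := by simpa using hij
  mat := notMatrix
  unitary := notMatrix_mem

lemma notGate_zero (i j : A) (hij : i ≠ j) (y : R → Bool) :
    gateMap (notGate (R := R) i j hij) (ket (Sum.elim y fun _ => false)) = oneHot y i := by
  rw [gateMap_ket]
  simp only [notGate, notMatrix, Fintype.sum_prod_type, Fintype.sum_bool, Matrix.of_apply,
    Sum.elim_inr]
  simp only [Bool.not_false, Prod.mk.injEq, and_true, and_false, if_true, if_false,
    one_smul, zero_smul, add_zero, zero_add, oneHot, reduceCtorEq, Bool.true_eq_false, false_and]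
  congr 1
  ext x
  rcases x with x | x <;> simp only [Function.update_apply, Sum.elim_inl, Sum.elim_inr,
    reduceCtorEq, Sum.inr.injEq, Sum.inl.injEq, if_false] <;> grind

lemma notGate_oneHot (i j : A) (hij : i ≠ j) (y : R → Bool) :
    gateMap (notGate (R := R) i j hij) (oneHot y i) = ket (Sum.elim y fun _ => false) := by
  rw [oneHot, gateMap_ket]
  simp only [notGate, notMatrix, Fintype.sum_prod_type, Fintype.sum_bool, Matrix.of_apply,
    Sum.elim_inr]
  simp only [decide_true, hij.symm, decide_false,
    Bool.not_true, Prod.mk.injEq, and_true, and_false, if_true, if_false,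
    one_smul, zero_smul, add_zero, zero_add, reduceCtorEq, Bool.true_eq_false, false_and]
  congr 1
  ext x
  rcases x with x | x <;> simp only [Function.update_apply, Sum.elim_inl, Sum.elim_inr,
    reduceCtorEq, Sum.inr.injEq, Sum.inl.injEq, if_false] <;> grind

lemma czGate_oneHot (k : A) (r : R) (y : R → Bool) (l : A) :
    gateMap (czGate k r) (oneHot y l) =
      (if l = k ∧ y r = true then (-1 : ℂ) else 1) • oneHot y l := by
  rw [oneHot, gateMap_ket]
  have key : ∀ f : Bool × Bool → ((R ⊕ A → Bool) → ℂ), ∀ t : Bool × Bool,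
      ∑ s, czMatrix s t • f s = (if t.1 && t.2 then (-1 : ℂ) else 1) • f t := by
    intro f t
    rw [Finset.sum_eq_single t]
    · simp [czMatrix]
    · intro s _ hs
      simp [czMatrix, Matrix.diagonal_apply, hs]
    · simp
  rw [show (czGate k r).mat = czMatrix from rfl, key]
  congr 1
  · by_cases h : k = l
    · simp [czGate, h]
    · simp [czGate, h, Ne.symm h]
  · simp [czGate]

lemma cnotGate_oneHot_self (k : A) (r : R) (y : R → Bool) :
    gateMap (cnotGate k r) (oneHot y k) = oneHot (Function.update y r (!y r)) k := by
  rw [oneHot, gateMap_ket]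
  have key : ∀ f : Bool × Bool → ((R ⊕ A → Bool) → ℂ), ∀ t : Bool × Bool,
      ∑ s, cnotMatrix s t • f s = f (t.1, xor t.1 t.2) := by
    intro f t
    rw [Finset.sum_eq_single (t.1, xor t.1 t.2)]
    · simp [cnotMatrix]
    · intro s _ hs
      simp [cnotMatrix, hs]
    · simp
  rw [show (cnotGate k r).mat = cnotMatrix from rfl, key]
  simp only [cnotGate, oneHot, Sum.elim_inr, Sum.elim_inl, decide_true, Bool.true_bne]
  congr 1
  ext x
  rcases x with x | x <;> simp only [Function.update_apply, Sum.elim_inl, Sum.elim_inr,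
    reduceCtorEq, Sum.inr.injEq, Sum.inl.injEq, if_false] <;> grind

lemma cnotGate_oneHot_of_ne (k : A) (r : R) (y : R → Bool) {l : A} (hl : l ≠ k) :
    gateMap (cnotGate k r) (oneHot y l) = oneHot y l := by
  rw [oneHot, gateMap_ket]
  have key : ∀ f : Bool × Bool → ((R ⊕ A → Bool) → ℂ), ∀ t : Bool × Bool,
      ∑ s, cnotMatrix s t • f s = f (t.1, xor t.1 t.2) := by
    intro f t
    rw [Finset.sum_eq_single (t.1, xor t.1 t.2)]
    · simp [cnotMatrix]
    · intro s _ hs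
      simp [cnotMatrix, hs]
    · simp
  rw [show (cnotGate k r).mat = cnotMatrix from rfl, key]
  simp only [cnotGate, Sum.elim_inr, Sum.elim_inl, hl.symm, decide_false, Bool.false_bne]
  congr 1
  ext x
  rcases x with x | x <;> simp only [Function.update_apply, Sum.elim_inl, Sum.elim_inr,
    reduceCtorEq, Sum.inr.injEq, Sum.inl.injEq, if_false] <;> grind

lemma modeGate_oneHot_of_ne {i j : A} (hij : i ≠ j) {c s : ℝ} (h : c ^ 2 + s ^ 2 = 1)
    (y : R → Bool) {l : A} (hi : l ≠ i) (hj : l ≠ j) :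
    gateMap (modeGate (R := R) i j hij c s h) (oneHot y l) = oneHot y l := by
  rw [oneHot, gateMap_ket]
  simp only [modeGate, modeMatrix, Fintype.sum_prod_type, Fintype.sum_bool, Matrix.of_apply,
    Sum.elim_inr, hi.symm, hj.symm, decide_false]
  simp only [one_smul, zero_smul, add_zero, zero_add]
  congr 1
  ext x
  rcases x with x | x <;> simp only [Function.update_apply, Sum.elim_inl, Sum.elim_inr,
    reduceCtorEq, Sum.inr.injEq, Sum.inl.injEq, if_false] <;> grind

lemma modeGate_oneHot_left {i j : A} (hij : i ≠ j) {c s : ℝ} (h : c ^ 2 + s ^ 2 = 1)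
    (y : R → Bool) :
    gateMap (modeGate (R := R) i j hij c s h) (oneHot y i) =
      (c : ℂ) • oneHot y i + (s : ℂ) • oneHot y j := by
  rw [oneHot, gateMap_ket]
  simp only [modeGate, modeMatrix, Fintype.sum_prod_type, Fintype.sum_bool, Matrix.of_apply,
    Sum.elim_inr, hij.symm, decide_false, decide_true]
  simp only [zero_smul, add_zero, zero_add, oneHot]
  congr 2
  · congr 1
    ext x
    rcases x with x | x <;> simp only [Function.update_apply, Sum.elim_inl, Sum.elim_inr,
      reduceCtorEq, Sum.inr.injEq, Sum.inl.injEq, if_false] <;> grind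
  · congr 1
    ext x
    rcases x with x | x <;> simp only [Function.update_apply, Sum.elim_inl, Sum.elim_inr,
      reduceCtorEq, Sum.inr.injEq, Sum.inl.injEq, if_false] <;> grind

lemma modeGate_oneHot_right {i j : A} (hij : i ≠ j) {c s : ℝ} (h : c ^ 2 + s ^ 2 = 1)
    (y : R → Bool) :
    gateMap (modeGate (R := R) i j hij c s h) (oneHot y j) =
      (s : ℂ) • oneHot y i - (c : ℂ) • oneHot y j := by
  rw [oneHot, gateMap_ket]
  simp only [modeGate, modeMatrix, Fintype.sum_prod_type, Fintype.sum_bool, Matrix.of_apply,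
    Sum.elim_inr, hij, decide_false, decide_true]
  simp only [zero_smul, add_zero, zero_add, oneHot, sub_eq_add_neg, neg_smul]
  congr 2
  · congr 1
    ext x
    rcases x with x | x <;> simp only [Function.update_apply, Sum.elim_inl, Sum.elim_inr,
      reduceCtorEq, Sum.inr.injEq, Sum.inl.injEq, if_false] <;> grind
  · congr 2
    ext x
    rcases x with x | x <;> simp only [Function.update_apply, Sum.elim_inl, Sum.elim_inr,
      reduceCtorEq, Sum.inr.injEq, Sum.inl.injEq, if_false] <;> grind

end OneHot

end GaussianPreparation

/-! ### Real orthogonal maps of the mode space as circuits -/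

namespace GaussianPreparation

section ModeCircuits

variable {R A : Type} [Fintype R] [DecidableEq R] [Fintype A] [DecidableEq A]

/-- The one-excitation state with mode amplitudes `v` and register content `y`. -/
def modeState (y : R → Bool) (v : EuclideanSpace ℝ A) : (R ⊕ A → Bool) → ℂ :=
  ∑ k, ((v k : ℝ) : ℂ) • oneHot y k

lemma modeState_smul (y : R → Bool) (t : ℝ) (v : EuclideanSpace ℝ A) :
    modeState y (t • v) = (t : ℂ) • modeState y v := by
  simp [modeState, Finset.smul_sum, mul_smul]

lemma modeState_single (y : R → Bool) (k : A) :
    modeState y (EuclideanSpace.single k (1 : ℝ)) = oneHot y k := by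
  rw [modeState, Finset.sum_eq_single k]
  · simp
  · intro l _ hl; simp [hl]
  · simp

variable (R) in
/-- `φ` is carried out on the one-excitation states by at most `n` gates, for every content of the
register. -/
def IsModeCircuit (n : ℕ) (φ : EuclideanSpace ℝ A → EuclideanSpace ℝ A) : Prop :=
  ∃ U, IsCircuit (ι := R ⊕ A) n U ∧ ∀ (y : R → Bool) v, U (modeState y v) = modeState y (φ v)

lemma IsModeCircuit.comp {n m : ℕ} {φ χ : EuclideanSpace ℝ A → EuclideanSpace ℝ A}
    (h : IsModeCircuit R n φ) (h' : IsModeCircuit R m χ) : IsModeCircuit R (n + m) (χ ∘ φ) := by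
  obtain ⟨U, hU, hU'⟩ := h
  obtain ⟨V, hV, hV'⟩ := h'
  exact ⟨V ∘ₗ U, hU.comp hV, fun y v => by simp [hU', hV']⟩

lemma IsModeCircuit.mono {n m : ℕ} {φ : EuclideanSpace ℝ A → EuclideanSpace ℝ A}
    (h : IsModeCircuit R n φ) (hnm : n ≤ m) : IsModeCircuit R m φ := by
  obtain ⟨U, hU, hU'⟩ := h
  exact ⟨U, hU.mono hnm, hU'⟩

lemma isModeCircuit_id : IsModeCircuit R 0 (id : EuclideanSpace ℝ A → _) :=
  ⟨LinearMap.id, IsCircuit.id, fun _ _ => rfl⟩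

/-- The reflection `[c s; s -c]` in the plane of the coordinates `i` and `j`. -/
def planeReflection (i j : A) (c s : ℝ) (w : EuclideanSpace ℝ A) : EuclideanSpace ℝ A :=
  WithLp.toLp 2 fun l => if l = i then c * w i + s * w j else if l = j then s * w i - c * w j
    else w l

lemma sum_eq_add_add_sum_erase {M : Type*} [AddCommMonoid M] {i j : A} (hij : i ≠ j) (g : A → M) :
    ∑ k, g k = g i + (g j + ∑ k ∈ (Finset.univ.erase i).erase j, g k) := by
  rw [← Finset.add_sum_erase _ g (Finset.mem_univ i), ← Finset.add_sum_erase _ g (a := j)]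
  simp [hij.symm]

lemma isModeCircuit_planeReflection {i j : A} (hij : i ≠ j) {c s : ℝ} (h : c ^ 2 + s ^ 2 = 1) :
    IsModeCircuit R 1 (planeReflection i j c s) := by
  refine ⟨_, isCircuit_gateMap (modeGate i j hij c s h), fun y v => ?_⟩
  rw [modeState, modeState, map_sum, sum_eq_add_add_sum_erase hij, sum_eq_add_add_sum_erase hij]
  simp only [map_smul]
  rw [modeGate_oneHot_left, modeGate_oneHot_right]
  have : ∀ k ∈ (Finset.univ.erase i).erase j, ((v k : ℝ) : ℂ) •
      (gateMap (modeGate (R := R) i j hij c s h)) (oneHot y k) =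
      ((planeReflection i j c s v k : ℝ) : ℂ) • oneHot y k := by
    intro k hk
    simp only [Finset.mem_erase, Finset.mem_univ, and_true] at hk
    rw [modeGate_oneHot_of_ne hij h y hk.2 hk.1]
    simp [planeReflection, hk.1, hk.2]
  rw [Finset.sum_congr rfl this]
  simp only [planeReflection, if_true, hij.symm, if_false]
  push_cast
  module

lemma planeReflection_involutive {i j : A} (hij : i ≠ j) {c s : ℝ} (h : c ^ 2 + s ^ 2 = 1)
    (w : EuclideanSpace ℝ A) : planeReflection i j c s (planeReflection i j c s w) = w := by
  ext l
  simp only [planeReflection]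
  by_cases hi : l = i
  · subst hi
    simp only [if_true, hij.symm, if_false]
    linear_combination w l * h
  · by_cases hj : l = j
    · subst hj
      simp only [if_true, hij.symm, if_false]
      linear_combination w l * h
    · simp [hi, hj]

lemma inner_planeReflection {i j : A} (hij : i ≠ j) {c s : ℝ} (h : c ^ 2 + s ^ 2 = 1)
    (v w : EuclideanSpace ℝ A) :
    inner ℝ (planeReflection i j c s v) (planeReflection i j c s w) = inner ℝ v w := by
  rw [PiLp.inner_apply, PiLp.inner_apply, sum_eq_add_add_sum_erase hij,
    sum_eq_add_add_sum_erase hij]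
  have : ∀ k ∈ (Finset.univ.erase i).erase j, inner ℝ (planeReflection i j c s v k)
      (planeReflection i j c s w k) = inner ℝ (v k) (w k) := by
    intro k hk
    simp only [Finset.mem_erase, Finset.mem_univ, and_true] at hk
    simp [planeReflection, hk.1, hk.2]
  rw [Finset.sum_congr rfl this]
  simp only [planeReflection, if_true, hij.symm, if_false, RCLike.inner_apply, conj_trivial]
  linear_combination (v i * w i + v j * w j) * h

lemma planeReflection_sub_smul (i j : A) (c s t : ℝ) (v w : EuclideanSpace ℝ A) :
    planeReflection i j c s (w - t • v) = planeReflection i j c s w -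
      t • planeReflection i j c s v := by
  ext l
  simp only [planeReflection, PiLp.sub_apply, PiLp.smul_apply, smul_eq_mul]
  split_ifs <;> ring

/-- The reflection that reverses `v`. -/
noncomputable def vectorReflection (v w : EuclideanSpace ℝ A) : EuclideanSpace ℝ A :=
  w - (2 * inner ℝ v w / ‖v‖ ^ 2) • v

/-- A plane reflection P is an orthogonal involution, so conjugating by P the reflection along Pv
gives the reflection along v. -/
lemma vectorReflection_conj {i j : A} (hij : i ≠ j) {c s : ℝ} (h : c ^ 2 + s ^ 2 = 1)
    (v : EuclideanSpace ℝ A) :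
    vectorReflection v = planeReflection i j c s ∘
      vectorReflection (planeReflection i j c s v) ∘ planeReflection i j c s := by
  ext1 w
  have hn : ‖planeReflection i j c s v‖ ^ 2 = ‖v‖ ^ 2 := by
    rw [← real_inner_self_eq_norm_sq, inner_planeReflection hij h, real_inner_self_eq_norm_sq]
  simp only [Function.comp_apply, vectorReflection]
  rw [planeReflection_sub_smul, planeReflection_involutive hij h, planeReflection_involutive hij h,
    inner_planeReflection hij h, hn]

variable [Nontrivial A]

/-- Induction on the support of v: conjugation by one plane reflection removes a coordinate and
costs two gates, and a vector supported on one coordinate needs a single gate. -/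
lemma isModeCircuit_vectorReflection (n : ℕ) : ∀ v : EuclideanSpace ℝ A,
    (Finset.univ.filter fun k => v k ≠ 0).card ≤ n →
      IsModeCircuit R (2 * n + 1) (vectorReflection v) := by
  induction n with
  | zero =>
    intro v hv
    have hv0 : v = 0 := by
      ext k
      by_contra hk
      have : k ∈ Finset.univ.filter fun k => v k ≠ 0 := by simpa using hk
      rw [Finset.card_eq_zero.mp (Nat.le_zero.mp hv)] at this
      simp at this
    have : vectorReflection v = id := by
      ext1 w; simp [vectorReflection, hv0]
    rw [this]
    exact isModeCircuit_id.mono (by omega)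
  | succ n ih =>
    intro v hv
    by_cases hex : ∃ i j, i ≠ j ∧ v i ≠ 0 ∧ v j ≠ 0
    · obtain ⟨i, j, hij, hi, hj⟩ := hex
      have hr : 0 < v i ^ 2 + v j ^ 2 := by positivity
      -- The reflection with c = v i / r and s = v j / r sends (v i, v j) to (r, 0), so j leaves the
      -- support.
      set r := Real.sqrt (v i ^ 2 + v j ^ 2) with hrdef
      have hr2 : r ^ 2 = v i ^ 2 + v j ^ 2 := Real.sq_sqrt hr.le
      have hr0 : r ≠ 0 := (Real.sqrt_pos.mpr hr).ne'
      have h : (v i / r) ^ 2 + (v j / r) ^ 2 = 1 := by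
        rw [div_pow, div_pow, ← add_div, hr2, div_self hr.ne']
      rw [vectorReflection_conj hij h]
      refine IsModeCircuit.mono (((isModeCircuit_planeReflection hij h).comp
        (ih _ ?_)).comp (isModeCircuit_planeReflection hij h)) (by omega)
      have hlt : (Finset.univ.filter fun k =>
          planeReflection i j (v i / r) (v j / r) v k ≠ 0) ⊂
          Finset.univ.filter fun k => v k ≠ 0 := by
        rw [Finset.ssubset_iff_of_subset]
        · refine ⟨j, by simpa using hj, ?_⟩
          simp only [planeReflection, Finset.mem_filter, Finset.mem_univ, true_and, not_not,
            hij.symm, if_false, if_true]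
          ring
        · intro k hk
          simp only [Finset.mem_filter, Finset.mem_univ, true_and] at hk ⊢
          by_cases hki : k = i
          · rwa [hki]
          · by_cases hkj : k = j
            · rwa [hkj]
            · simpa [planeReflection, hki, hkj] using hk
      have := Finset.card_lt_card hlt
      omega
    · push Not at hex
      by_cases hv0 : v = 0
      · have : vectorReflection v = id := by
          ext1 w; simp [vectorReflection, hv0]
        rw [this]
        exact isModeCircuit_id.mono (by omega)
      · obtain ⟨i, hi⟩ : ∃ i, v i ≠ 0 := by
          by_contra hcon
          push Not at hcon
          exact hv0 (by ext k; simpa using hcon k)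
        obtain ⟨j, hj⟩ := exists_ne i
        have hvi : v = EuclideanSpace.single i (v i) := by
          ext k
          by_cases hk : k = i
          · subst hk; simp
          · simpa [hk] using hex i k (Ne.symm hk) hi
        -- A sign change of coordinate i alone; j is a spectator, needed because a gate acts on two
        -- distinct qubits.
        have : vectorReflection v = planeReflection i j (-1) 0 := by
          ext w k
          have h1 : inner ℝ v w = v i * w i := by
            rw [hvi, EuclideanSpace.inner_single_left]; simp
          have h2 : ‖v‖ ^ 2 = v i ^ 2 := by rw [hvi]; simp
          rw [vectorReflection, h1, h2]
          by_cases hk : k = i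
          · subst hk
            simp [planeReflection]
            field_simp
            ring
          · have hvk : v k = 0 := hex i k (Ne.symm hk) hi
            by_cases hkj : k = j
            · subst hkj; simp [planeReflection, hk, hvk]
            · simp [planeReflection, hk, hkj, hvk]
        rw [this]
        exact (isModeCircuit_planeReflection hj.symm (by norm_num)).mono (by omega)

lemma reflection_eq_vectorReflection (v : EuclideanSpace ℝ A) :
    ⇑((ℝ ∙ v)ᗮ.reflection) = vectorReflection v := by
  ext1 w
  rw [Submodule.reflection_orthogonal_apply, Submodule.reflection_singleton_apply,
    vectorReflection]
  simp only [RCLike.ofReal_real_eq_id, id_eq]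
  module

/-- Cartan–Dieudonné: an isometry is a product of at most dim-many hyperplane reflections. -/
lemma isModeCircuit_isometry (φ : EuclideanSpace ℝ A ≃ₗᵢ[ℝ] EuclideanSpace ℝ A) :
    IsModeCircuit R (Fintype.card A * (2 * Fintype.card A + 1)) φ := by
  obtain ⟨l, hl, rfl⟩ := φ.reflections_generate_dim
  rw [finrank_euclideanSpace] at hl
  refine IsModeCircuit.mono ?_ (Nat.mul_le_mul_right _ hl)
  clear hl
  induction l with
  | nil => simpa using isModeCircuit_id (R := R) (A := A)
  | cons v l ih =>
    rw [List.map_cons, List.prod_cons, LinearIsometryEquiv.coe_mul, reflection_eq_vectorReflection]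
    refine (ih.comp (isModeCircuit_vectorReflection _ v (Finset.card_le_univ _))).mono ?_
    simp [add_mul]

end ModeCircuits

/-! ### Moving the branch label from the modes into a register qubit -/

section Merge

variable {R A : Type} [Fintype R] [DecidableEq R] [Fintype A] [DecidableEq A]

/-- The CNOT records in r whether the excitation sits at k₁. A Hadamard-like reflection g of the two
modes then turns the controlled sign into a controlled swap: g · CZ · g exchanges k₀ and k₁ when r
is set and is the identity otherwise, which returns the excitation to k₀. -/
lemma exists_swap_circuit (r : R) {k₀ k₁ : A} (h01 : k₀ ≠ k₁) :
    ∃ U, IsCircuit (ι := R ⊕ A) 4 U ∧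
      (∀ (y : R → Bool) (l : A), l ≠ k₀ → l ≠ k₁ → U (oneHot y l) = oneHot y l) ∧
      (∀ y : R → Bool, y r = false → U (oneHot y k₀) = oneHot y k₀) ∧
      (∀ y : R → Bool, y r = false →
        U (oneHot y k₁) = oneHot (Function.update y r true) k₀) := by
  set c : ℝ := Real.sqrt 2 / 2
  have hc2 : c * c = 1 / 2 := by
    have : Real.sqrt 2 * Real.sqrt 2 = 2 := Real.mul_self_sqrt (by norm_num)
    simp only [c]; linear_combination this / 4
  have hcs : c ^ 2 + (-c) ^ 2 = 1 := by linear_combination 2 * hc2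
  have hcC : (c : ℂ) * c = 1 / 2 := by
    rw [← Complex.ofReal_mul, hc2]; norm_num
  set g := gateMap (modeGate (R := R) k₁ k₀ h01.symm c (-c) hcs)
  refine ⟨g ∘ₗ gateMap (czGate k₁ r) ∘ₗ g ∘ₗ gateMap (cnotGate k₁ r),
    (((isCircuit_gateMap _).comp (isCircuit_gateMap _)).comp (isCircuit_gateMap _)).comp
      (isCircuit_gateMap _), ?_, ?_, ?_⟩
  · intro y l h0 h1
    simp only [LinearMap.comp_apply, g]
    rw [cnotGate_oneHot_of_ne _ _ _ h1, modeGate_oneHot_of_ne _ _ _ h1 h0, czGate_oneHot]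
    simp [h1, modeGate_oneHot_of_ne _ _ _ h1 h0]
  · intro y hy
    simp only [LinearMap.comp_apply, g]
    rw [cnotGate_oneHot_of_ne _ _ _ h01, modeGate_oneHot_right, map_sub, map_smul, map_smul,
      czGate_oneHot, czGate_oneHot]
    simp only [hy, Bool.false_eq_true, and_false, if_false, one_smul, map_sub, map_smul]
    rw [modeGate_oneHot_left, modeGate_oneHot_right]
    push_cast
    match_scalars
    · ring
    · linear_combination 2 * hcC
  · intro y hy
    simp only [LinearMap.comp_apply, g]
    rw [cnotGate_oneHot_self, hy, Bool.not_false]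
    set y' := Function.update y r true
    have hy' : y' r = true := by simp [y']
    rw [modeGate_oneHot_left, map_add, map_smul, map_smul,
      czGate_oneHot, czGate_oneHot]
    simp only [hy', h01, true_and, false_and, if_true, if_false, one_smul, map_add, map_smul]
    rw [modeGate_oneHot_left, modeGate_oneHot_right]
    push_cast
    match_scalars
    · ring
    · linear_combination 2 * hcC

/-- One swap per index k, each acting only on the pair of modes p (false, k), p (true, k). The
clause for k ∉ S keeps the induction going: it says that excitations already merged, or not yet
treated, are left alone. -/
lemma exists_merge_circuit {K : Type} [DecidableEq K] (r : R) (p : Bool × K ↪ A)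
    (S : Finset K) :
    ∃ U, IsCircuit (ι := R ⊕ A) (4 * S.card) U ∧
      (∀ (y : R → Bool), ∀ k ∉ S, ∀ s, U (oneHot y (p (s, k))) = oneHot y (p (s, k))) ∧
      (∀ y : R → Bool, y r = false → ∀ k ∈ S, ∀ s,
        U (oneHot y (p (s, k))) = oneHot (Function.update y r s) (p (false, k))) := by
  induction S using Finset.induction_on with
  | empty => exact ⟨LinearMap.id, by simpa using IsCircuit.id, by simp, by simp⟩
  | insert a S ha ih =>
    obtain ⟨U, hU, hU1, hU2⟩ := ih
    obtain ⟨V, hV, hV1, hV2, hV3⟩ := exists_swap_circuit (R := R) r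
      (k₀ := p (false, a)) (k₁ := p (true, a)) (by simp)
    refine ⟨U ∘ₗ V, (hV.comp hU).mono (by rw [Finset.card_insert_of_notMem ha]; omega), ?_, ?_⟩
    · intro y k hk s
      simp only [Finset.mem_insert, not_or] at hk
      rw [LinearMap.comp_apply, hV1 y _ (by simp [hk.1]) (by simp [hk.1]), hU1 y k hk.2]
    · intro y hy k hk s
      rw [LinearMap.comp_apply]
      by_cases hka : k = a
      · subst hka
        cases s
        · rw [hV2 y hy, hU1 y k ha, ← hy, Function.update_eq_self]
        · rw [hV3 y hy, hU1 _ k ha]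
      · rw [hV1 y _ (by simp [hka]) (by simp [hka]),
          hU2 y hy k (Finset.mem_of_mem_insert_of_ne hk hka)]

end Merge

end GaussianPreparation

/-! ### Polynomial samples on a binary register -/

namespace GaussianPreparation

/-- β ∘ α⁻¹ is an isometry from the range of α into E, and in finite dimension it extends to all of
E. Each step below is specified only on a subspace and completed to an orthogonal map this way. -/
lemma exists_isometryEquiv_extending {V E : Type*} [NormedAddCommGroup V] [InnerProductSpace ℝ V]
    [NormedAddCommGroup E] [InnerProductSpace ℝ E] [FiniteDimensional ℝ E]
    (α β : V →ₗᵢ[ℝ] E) : ∃ φ : E ≃ₗᵢ[ℝ] E, ∀ v, φ (α v) = β v := by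
  let S := LinearMap.range α.toLinearMap
  let e : V ≃ₗᵢ[ℝ] S := α.equivRange
  let L : S →ₗᵢ[ℝ] E := β.comp e.symm.toLinearIsometry
  refine ⟨L.extend.toLinearIsometryEquiv rfl, fun v => ?_⟩
  have h := L.extend_apply (e v)
  have h2 : ((e v : S) : E) = α v := rfl
  rw [h2] at h
  simpa [L] using h

lemma exists_isometry_of_finrank_le {V : Type*} [NormedAddCommGroup V] [InnerProductSpace ℝ V]
    [FiniteDimensional ℝ V] {D : ℕ} (h : Module.finrank ℝ V ≤ D) :
    Nonempty (V →ₗᵢ[ℝ] EuclideanSpace ℝ (Fin D)) := by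
  let b := stdOrthonormalBasis ℝ V
  let e := EuclideanSpace.basisFun (Fin D) ℝ
  let f : V →ₗ[ℝ] EuclideanSpace ℝ (Fin D) :=
    b.toBasis.constr ℝ fun i => e (Fin.castLE h i)
  refine ⟨f.isometryOfOrthonormal (v := b.toBasis) (by simp) ?_⟩
  have : f ∘ b.toBasis = e ∘ Fin.castLE h := by
    ext1 i
    simp [f]
  rw [this]
  exact e.orthonormal.comp _ (Fin.castLE_injective h)

/-- The samples of the polynomials of degree less than `D` at the points of an `n`-bit register. -/
noncomputable def polySpace (D n : ℕ) : Submodule ℝ (EuclideanSpace ℝ (Fin n → Bool)) :=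
  (Polynomial.degreeLT ℝ D).map
    ({ toFun := fun P => WithLp.toLp 2 fun z => P.eval (registerValue z : ℝ)
       map_add' := fun P Q => by ext; simp
       map_smul' := fun t P => by ext; simp } :
      Polynomial ℝ →ₗ[ℝ] EuclideanSpace ℝ (Fin n → Bool))

lemma mem_polySpace {D n : ℕ} {v : EuclideanSpace ℝ (Fin n → Bool)} :
    v ∈ polySpace D n ↔ ∃ P : Polynomial ℝ, P.degree < D ∧
      ∀ z, v z = P.eval (registerValue z : ℝ) := by
  simp only [polySpace, Submodule.mem_map, Polynomial.mem_degreeLT]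
  refine exists_congr fun P => and_congr_right fun _ => ⟨?_, fun h => ?_⟩
  · rintro rfl z; rfl
  · ext z; exact (h z).symm

lemma finrank_polySpace_le (D n : ℕ) : Module.finrank ℝ (polySpace D n) ≤ D := by
  have h : Module.finrank ℝ (Polynomial.degreeLT ℝ D) = D := by
    rw [(Polynomial.degreeLTEquiv ℝ D).finrank_eq, Module.finrank_fin_fun]
  have : FiniteDimensional ℝ (Polynomial.degreeLT ℝ D) :=
    (Polynomial.degreeLTEquiv ℝ D).symm.finiteDimensional
  conv_rhs => rw [← h]
  exact Submodule.finrank_map_le _ _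

lemma registerValue_snoc {n : ℕ} (z : Fin n → Bool) (s : Bool) :
    registerValue (Fin.snoc (α := fun _ => Bool) z s) =
      registerValue z + if s then 2 ^ n else 0 := by
  simp [registerValue, Fin.sum_univ_castSucc]

/-- The part of `v` on which the last bit is `s`. -/
def lastBit {n : ℕ} (s : Bool) (v : EuclideanSpace ℝ (Fin (n + 1) → Bool)) :
    EuclideanSpace ℝ (Fin n → Bool) :=
  WithLp.toLp 2 fun z => v (Fin.snoc (α := fun _ => Bool) z s)

/-- The last bit is the most significant one, so fixing it translates the argument by 0 or 2 ^ n,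
and translation preserves the degree. This is what bounds the bond dimension by D at every bit. -/
lemma lastBit_mem {D n : ℕ} (s : Bool) {v : EuclideanSpace ℝ (Fin (n + 1) → Bool)}
    (hv : v ∈ polySpace D (n + 1)) : lastBit s v ∈ polySpace D n := by
  rw [mem_polySpace] at hv ⊢
  obtain ⟨P, hP, h⟩ := hv
  refine ⟨P.comp (Polynomial.X + Polynomial.C (if s then 2 ^ n else 0)), ?_, fun z => ?_⟩
  · rwa [← Polynomial.taylor_apply, Polynomial.degree_taylor]
  · simp only [lastBit, h, registerValue_snoc, Polynomial.eval_comp, Polynomial.eval_add,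
      Polynomial.eval_X, Polynomial.eval_C]
    push_cast
    rfl

lemma sum_snoc {n : ℕ} {α M : Type*} [Fintype α] [AddCommMonoid M]
    (g : (Fin (n + 1) → α) → M) :
    ∑ z, g z = ∑ s, ∑ z : Fin n → α, g (Fin.snoc (α := fun _ => α) z s) := by
  rw [← Fintype.sum_prod_type', ← (Fin.snocEquiv fun _ => α).sum_comp]
  rfl

/-- The splitting of the samples of a polynomial by the last bit. -/
def lastBitMap (D n : ℕ) (s : Bool) : polySpace D (n + 1) →ₗ[ℝ] polySpace D n where
  toFun v := ⟨lastBit s v, lastBit_mem s v.2⟩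
  map_add' v w := by ext; simp [lastBit]
  map_smul' t v := by ext; simp [lastBit]

lemma norm_sq_eq_lastBit {n : ℕ} (v : EuclideanSpace ℝ (Fin (n + 1) → Bool)) :
    ‖v‖ ^ 2 = ‖lastBit false v‖ ^ 2 + ‖lastBit true v‖ ^ 2 := by
  simp only [EuclideanSpace.norm_sq_eq, lastBit]
  rw [sum_snoc, Fintype.sum_bool, add_comm]

/-! ### Splitting the modes into two branches -/

section Branch

variable {A K : Type} [Fintype A] [DecidableEq A] [Fintype K] [DecidableEq K]

/-- The vector on the modes that has `u` on branch `false` and `w` on branch `true`. -/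
def branch (p : Bool × K ≃ A) : (EuclideanSpace ℝ K × EuclideanSpace ℝ K) →ₗ[ℝ]
    EuclideanSpace ℝ A where
  toFun u := WithLp.toLp 2 fun a => if (p.symm a).1 then u.2 (p.symm a).2 else u.1 (p.symm a).2
  map_add' u w := by ext a; simp only [PiLp.add_apply]; split_ifs <;> simp
  map_smul' t u := by ext a; simp only [PiLp.smul_apply]; split_ifs <;> simp

lemma norm_sq_branch (p : Bool × K ≃ A) (u w : EuclideanSpace ℝ K) :
    ‖branch p (u, w)‖ ^ 2 = ‖u‖ ^ 2 + ‖w‖ ^ 2 := by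
  simp only [EuclideanSpace.norm_sq_eq, branch]
  rw [← p.sum_comp, Fintype.sum_prod_type, Fintype.sum_bool]
  simp [add_comm]

lemma modeState_branch {R : Type} [Fintype R] [DecidableEq R] (p : Bool × K ≃ A) (y : R → Bool)
    (u w : EuclideanSpace ℝ K) :
    modeState y (branch p (u, w)) =
      ∑ k, ((u k : ℝ) : ℂ) • oneHot y (p (false, k)) +
        ∑ k, ((w k : ℝ) : ℂ) • oneHot y (p (true, k)) := by
  rw [modeState, ← p.sum_comp, Fintype.sum_prod_type, Fintype.sum_bool, add_comm]
  simp [branch]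

/-- The isometry `v ↦ (W v, 0)`. -/
noncomputable def branchFalse {V : Type*} [NormedAddCommGroup V] [InnerProductSpace ℝ V] (p : Bool × K ≃ A)
    (W : V →ₗᵢ[ℝ] EuclideanSpace ℝ K) : V →ₗᵢ[ℝ] EuclideanSpace ℝ A where
  toLinearMap := branch p ∘ₗ W.toLinearMap.prod 0
  norm_map' v := by
    have := norm_sq_branch p (W v) 0
    rw [norm_zero, W.norm_map] at this
    rw [← sq_eq_sq₀ (norm_nonneg _) (norm_nonneg _)]
    simpa using this

end Branch

lemma extend_snoc {R : Type} [DecidableEq R] {n : ℕ} (ρ : Fin (n + 1) → R)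
    (hρ : Function.Injective ρ) (z : Fin n → Bool) (s : Bool) (y : R → Bool) :
    Function.extend ρ (Fin.snoc (α := fun _ => Bool) z s) y =
      Function.extend (ρ ∘ Fin.castSucc) z (Function.update y (ρ (Fin.last n)) s) := by
  have hρ' : Function.Injective (ρ ∘ Fin.castSucc) := hρ.comp (Fin.castSucc_injective n)
  ext r
  by_cases h : ∃ j, ρ j = r
  · obtain ⟨j, rfl⟩ := h
    rw [hρ.extend_apply]
    induction j using Fin.lastCases with
    | last =>
      rw [Function.extend_apply', Fin.snoc_last, Function.update_self]
      rintro ⟨j, hj⟩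
      exact absurd (hρ hj) (Fin.castSucc_lt_last j).ne
    | cast j =>
      rw [Fin.snoc_castSucc]
      exact (hρ'.extend_apply z _ j).symm
  · rw [Function.extend_apply' _ _ _ h, Function.extend_apply', Function.update_of_ne]
    · rintro rfl; exact h ⟨_, rfl⟩
    · rintro ⟨j, hj⟩; exact h ⟨_, hj⟩

/-! ### Writing the samples of a polynomial bit by bit -/

section Samples

variable {R A : Type} [Fintype R] [DecidableEq R] [Fintype A] [DecidableEq A] [Nontrivial A]

/-- A bound for the number of gates that process one register qubit with modes `A`. -/
def stepCost (a : ℕ) : ℕ := a * (2 * a + 1) + 4 * a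

/-- W encodes the sample vector in D modes. An orthogonal map splits it into the encodings of its
two halves, the merge writes the half label into the last register qubit, and the circuit for n bits
finishes both halves at once. The quantifier over y matters: the same circuit must serve every
content of the other qubits. -/
lemma exists_sample_circuit {D : ℕ} (p : Bool × Fin D ≃ A) (a₀ : A) (n : ℕ) :
    ∀ (ρ : Fin n → R), Function.Injective ρ →
    ∀ W : polySpace D n →ₗᵢ[ℝ] EuclideanSpace ℝ (Fin D),
    ∃ U, IsCircuit (ι := R ⊕ A) ((n + 1) * stepCost (Fintype.card A)) U ∧
      ∀ (v : polySpace D n) (y : R → Bool), (∀ j, y (ρ j) = false) →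
        U (modeState y (branchFalse p W v)) =
          ∑ z, ((v.1 z : ℝ) : ℂ) • oneHot (Function.extend ρ z y) a₀ := by
  have hDA : D ≤ Fintype.card A := by
    rw [← Fintype.card_congr p]; simp; omega
  induction n with
  | zero =>
    intro ρ _ W
    let z₀ : Fin 0 → Bool := Fin.elim0
    have hz₀ : ∀ z, z ≠ z₀ → False := fun z hz => hz (Subsingleton.elim z z₀)
    let β : polySpace D 0 →ₗᵢ[ℝ] EuclideanSpace ℝ A :=
      { toFun := fun v => v.1 z₀ • EuclideanSpace.single a₀ (1 : ℝ)
        map_add' := fun v w => by simp [add_smul]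
        map_smul' := fun t v => by simp [mul_smul]
        norm_map' := fun v => by
          change ‖v.1 z₀ • EuclideanSpace.single a₀ (1 : ℝ)‖ = ‖v.1‖
          rw [norm_smul, PiLp.norm_single, norm_one, mul_one, EuclideanSpace.norm_eq,
            Fintype.sum_eq_single z₀ fun z hz => (hz₀ z hz).elim, Real.sqrt_sq (norm_nonneg _)] }
    obtain ⟨φ, hφ⟩ := exists_isometryEquiv_extending (branchFalse p W) β
    obtain ⟨U, hU, hU'⟩ := isModeCircuit_isometry (R := R) φ
    refine ⟨U, hU.mono (by simp [stepCost]), fun v y _ => ?_⟩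
    rw [hU', hφ]
    change modeState y (v.1 z₀ • EuclideanSpace.single a₀ (1 : ℝ)) = _
    have hext : Function.extend ρ z₀ y = y := by
      ext r
      rw [Function.extend_apply' _ _ _ (by rintro ⟨j, _⟩; exact j.elim0)]
    rw [modeState_smul, modeState_single,
      Fintype.sum_eq_single z₀ fun z hz => (hz₀ z hz).elim, hext]
  | succ n ih =>
    intro ρ hρ W
    obtain ⟨W'⟩ := exists_isometry_of_finrank_le (finrank_polySpace_le D n)
    have hρ' : Function.Injective (ρ ∘ Fin.castSucc) := hρ.comp (Fin.castSucc_injective n)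
    obtain ⟨V, hV, hV'⟩ := ih (ρ ∘ Fin.castSucc) hρ' W'
    -- An isometry, since the squared norms of the two halves add up to that of v.
    let β : polySpace D (n + 1) →ₗᵢ[ℝ] EuclideanSpace ℝ A :=
      { toLinearMap := branch p ∘ₗ (W'.toLinearMap ∘ₗ lastBitMap D n false).prod
          (W'.toLinearMap ∘ₗ lastBitMap D n true)
        norm_map' := fun v => by
          have h := norm_sq_branch p (W' (lastBitMap D n false v)) (W' (lastBitMap D n true v))
          rw [W'.norm_map, W'.norm_map] at h
          have h2 : ‖v‖ ^ 2 = _ := norm_sq_eq_lastBit v.1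
          rw [← sq_eq_sq₀ (norm_nonneg _) (norm_nonneg _), h2]
          exact h }
    obtain ⟨φ, hφ⟩ := exists_isometryEquiv_extending (branchFalse p W) β
    obtain ⟨U, hU, hU'⟩ := isModeCircuit_isometry (R := R) φ
    obtain ⟨M, hM, -, hM'⟩ := exists_merge_circuit (R := R) (ρ (Fin.last n)) p.toEmbedding
      Finset.univ
    refine ⟨V ∘ₗ M ∘ₗ U, ((hU.comp hM).comp hV).mono ?_, fun v y hy => ?_⟩
    · rw [add_mul (n + 1), one_mul, add_comm]
      refine Nat.add_le_add_left ?_ _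
      rw [stepCost]
      simp only [Finset.card_univ, Fintype.card_fin]
      omega
    · have hmerge : ∀ s, M (∑ k, ((W' (lastBitMap D n s v) k : ℝ) : ℂ) • oneHot y (p (s, k))) =
          modeState (Function.update y (ρ (Fin.last n)) s)
            (branchFalse p W' (lastBitMap D n s v)) := by
        intro s
        have h0 := modeState_branch p (Function.update y (ρ (Fin.last n)) s)
          (W' (lastBitMap D n s v)) 0
        have h1 : branchFalse p W' (lastBitMap D n s v) =
          branch p (W' (lastBitMap D n s v), 0) := rfl
        rw [h1, h0, map_sum]
        simp only [PiLp.zero_apply, Complex.ofReal_zero, zero_smul, Finset.sum_const_zero, add_zero]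
        refine Finset.sum_congr rfl fun k _ => ?_
        rw [map_smul]
        congr 1
        exact hM' y (hy _) k (Finset.mem_univ _) s
      have hβ : β v = branch p (W' (lastBitMap D n false v), W' (lastBitMap D n true v)) := rfl
      rw [LinearMap.comp_apply, LinearMap.comp_apply, hU', hφ, hβ, modeState_branch, map_add,
        hmerge, hmerge, map_add, sum_snoc, Fintype.sum_bool, add_comm]
      have hrest : ∀ s, ∀ j, Function.update y (ρ (Fin.last n)) s ((ρ ∘ Fin.castSucc) j) = false := by
        intro s j
        rw [Function.update_of_ne]
        · exact hy _
        · intro h; exact absurd (hρ h) (Fin.castSucc_lt_last j).ne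
      rw [hV' _ _ (hrest true), hV' _ _ (hrest false)]
      simp only [extend_snoc ρ hρ]
      rfl

/-- Preparation of one register: a unit vector of samples is written into the qubits `ρ`. -/
lemma exists_register_circuit {D q : ℕ} (p : Bool × Fin D ≃ A) (a₀ : A) (ρ : Fin q → R)
    (hρ : Function.Injective ρ) (v : polySpace D q) (hv : ‖v‖ = 1) :
    ∃ U, IsCircuit (ι := R ⊕ A) ((q + 2) * stepCost (Fintype.card A)) U ∧
      ∀ y : R → Bool, (∀ j, y (ρ j) = false) →
        U (oneHot y a₀) = ∑ z, ((v.1 z : ℝ) : ℂ) • oneHot (Function.extend ρ z y) a₀ := by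
  obtain ⟨W⟩ := exists_isometry_of_finrank_le (finrank_polySpace_le D q)
  obtain ⟨V, hV, hV'⟩ := exists_sample_circuit (R := R) p a₀ q ρ hρ W
  let α : ℝ →ₗᵢ[ℝ] EuclideanSpace ℝ A := LinearIsometry.toSpanSingleton ℝ _
    (v := EuclideanSpace.single a₀ (1 : ℝ)) (by simp)
  let β : ℝ →ₗᵢ[ℝ] EuclideanSpace ℝ A := LinearIsometry.toSpanSingleton ℝ _
    (v := branchFalse p W v) (by rw [LinearIsometry.norm_map, hv])
  obtain ⟨φ, hφ⟩ := exists_isometryEquiv_extending α β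
  obtain ⟨U, hU, hU'⟩ := isModeCircuit_isometry (R := R) φ
  refine ⟨V ∘ₗ U, (hU.comp hV).mono ?_, fun y hy => ?_⟩
  · simp only [stepCost]; ring_nf; omega
  · have h1 := hφ 1
    simp only [α, β, LinearIsometry.toSpanSingleton_apply, one_smul] at h1
    rw [LinearMap.comp_apply, ← modeState_single, hU', h1, hV' v y hy]

/-- Each register circuit starts and ends with the excitation at a₀, so the same modes serve all d
coordinates in turn. -/
lemma exists_product_circuit {d q D : ℕ} (p : Bool × Fin D ≃ A) (a₀ : A)
    (v : polySpace D q) (hv : ‖v‖ = 1) (m : ℕ) (hm : m ≤ d) :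
    ∃ U, IsCircuit (ι := (Fin d × Fin q) ⊕ A)
        (m * ((q + 2) * stepCost (Fintype.card A))) U ∧
      U (oneHot (fun _ => false) a₀) = ∑ Z : Fin m → Fin q → Bool,
        ((∏ i, v.1 (Z i) : ℝ) : ℂ) • oneHot
          (fun r => if h : r.1.1 < m then Z ⟨r.1, h⟩ r.2 else false) a₀ := by
  induction m with
  | zero =>
    refine ⟨LinearMap.id, by simpa using IsCircuit.id, ?_⟩
    rw [Fintype.sum_unique]
    simp
  | succ m ih =>
    obtain ⟨U, hU, hU'⟩ := ih (by omega)
    have hρ : Function.Injective (fun j : Fin q => ((⟨m, hm⟩ : Fin d), j)) := by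
      intro i j h; simpa using h
    obtain ⟨V, hV, hV'⟩ := exists_register_circuit (R := Fin d × Fin q) p a₀
      (fun j : Fin q => ((⟨m, hm⟩ : Fin d), j)) hρ v hv
    refine ⟨V ∘ₗ U, (hU.comp hV).mono (by rw [add_mul m 1, one_mul]), ?_⟩
    rw [LinearMap.comp_apply, hU', map_sum, sum_snoc, Finset.sum_comm]
    refine Finset.sum_congr rfl fun Z _ => ?_
    rw [map_smul, hV' _ (by simp), Finset.smul_sum]
    refine Finset.sum_congr rfl fun z _ => ?_
    rw [smul_smul, Fin.prod_univ_castSucc, ← Complex.ofReal_mul]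
    simp only [Fin.snoc_castSucc, Fin.snoc_last]
    congr 2
    ext ⟨r, j⟩
    by_cases hr : r.1 = m
    · have : (r, j) = (fun j : Fin q => ((⟨m, hm⟩ : Fin d), j)) j := by
        ext <;> simp [hr]
      rw [this, hρ.extend_apply]
      simp [Fin.snoc]
    · rw [Function.extend_apply']
      · by_cases hlt : r.1 < m
        · have h2 : r.1 < m + 1 := by omega
          simp [hlt, h2, Fin.snoc]
        · have h2 : ¬ r.1 < m + 1 := by omega
          simp [hlt, h2]
      · rintro ⟨j', hj'⟩
        apply hr
        simp only [Prod.mk.injEq] at hj'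
        rw [← hj'.1]

end Samples

/-- One X gate creates the excitation at the start and another removes it at the end, whence the
additive 2; afterwards the ancillas are exactly in the zero state. -/
lemma exists_gates_product {d q D : ℕ} (hD : 0 < D) (v : polySpace D q) (hv : ‖v‖ = 1) :
    ∃ gates : List (QGate ((Fin d × Fin q) ⊕ Fin (2 * D))),
      gates.length ≤ d * ((q + 2) * stepCost (2 * D)) + 2 ∧
      ∀ (y : Fin d × Fin q → Bool) (w : Fin (2 * D) → Bool),
        circuitOutput gates (Sum.elim y w) =
          if w = (fun _ => false) then ((∏ i, v.1 (fun j => y (i, j)) : ℝ) : ℂ) else 0 := by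
  have : Nontrivial (Fin (2 * D)) := Fin.nontrivial_iff_two_le.mpr (by omega)
  let p : Bool × Fin D ≃ Fin (2 * D) :=
    (finTwoEquiv.symm.prodCongr (Equiv.refl _)).trans finProdFinEquiv
  let a₀ : Fin (2 * D) := ⟨0, by omega⟩
  obtain ⟨a₁, ha₁⟩ := exists_ne a₀
  obtain ⟨U, hU, hU'⟩ := exists_product_circuit (d := d) p a₀ v hv d le_rfl
  obtain ⟨gates, hlen, hg⟩ := ((isCircuit_gateMap (notGate (R := Fin d × Fin q) a₀ a₁ ha₁.symm)).comp
    hU).comp (isCircuit_gateMap (notGate (R := Fin d × Fin q) a₀ a₁ ha₁.symm))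
  refine ⟨gates, hlen.trans (by rw [Fintype.card_fin]; omega), fun y w => ?_⟩
  have hzero : (zeroKet : ((Fin d × Fin q) ⊕ Fin (2 * D) → Bool) → ℂ) =
      ket (Sum.elim (fun _ => false) fun _ => false) := by
    ext z
    rw [zeroKet, ket, Pi.single_apply]
    refine if_congr ?_ rfl rfl
    rw [show (Sum.elim (fun _ => false) fun _ => false :
      (Fin d × Fin q) ⊕ Fin (2 * D) → Bool) = fun _ => false from Sum.elim_const_const false]
  rw [circuitOutput, hg, LinearMap.comp_apply, LinearMap.comp_apply, hzero, notGate_zero, hU',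
    map_sum, Finset.sum_apply]
  have hterm : ∀ Z : Fin d → Fin q → Bool, gateMap (notGate (R := Fin d × Fin q) a₀ a₁ ha₁.symm)
      (((∏ i, v.1 (Z i) : ℝ) : ℂ) • oneHot
          (fun r => if h : r.1.1 < d then Z ⟨r.1, h⟩ r.2 else false) a₀) (Sum.elim y w) =
      if Z = (fun i j => y (i, j)) then
        (if w = (fun _ => false) then ((∏ i, v.1 (fun j => y (i, j)) : ℝ) : ℂ) else 0) else 0 := by
    intro Z
    rw [map_smul, notGate_oneHot, Pi.smul_apply, ket, Pi.single_apply]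
    have hiff : (Sum.elim y w = Sum.elim
        (fun r : Fin d × Fin q => if h : r.1.1 < d then Z ⟨r.1, h⟩ r.2 else false)
          fun _ => false) ↔ Z = (fun i j => y (i, j)) ∧ w = fun _ => false := by
      rw [Sum.elim_eq_iff]
      refine and_congr_left fun _ => ⟨fun h => ?_, fun h => ?_⟩
      · ext i j; rw [h]; simp
      · ext r; rw [h]; simp
    rw [if_congr hiff rfl rfl]
    by_cases h1 : Z = (fun i j => y (i, j))
    · by_cases h2 : w = fun _ => false
      · simp [h1, h2]
      · simp [h2]
    · simp [h1]
  rw [Finset.sum_congr rfl fun Z _ => hterm Z]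
  simp

end GaussianPreparation

/-! ### Step functions on a one-dimensional grid -/

namespace GaussianPreparation

open MeasureTheory

lemma sum_registerValue {M : Type*} [AddCommMonoid M] (q : ℕ) (F : ℕ → M) :
    ∑ z : Fin q → Bool, F (registerValue z) = ∑ t ∈ Finset.range (2 ^ q), F t := by
  induction q generalizing F with
  | zero => rw [Fintype.sum_eq_single Fin.elim0 fun z hz => absurd (Subsingleton.elim _ _) hz]
            simp [registerValue]
  | succ q ih =>
    rw [sum_snoc, Fintype.sum_bool]
    simp only [registerValue_snoc]
    simp only [if_true, Bool.false_eq_true, if_false, add_zero]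
    rw [ih fun t => F (t + 2 ^ q), ih F, pow_succ, mul_two, Finset.sum_range_add, add_comm]
    simp only [add_comm]

/-- The `t`-th of the `n` cells of width `h` that tile `[-hn/2, hn/2)`. -/
def cell (h : ℝ) (n t : ℕ) : Set ℝ :=
  {x | h * ((t : ℝ) - n / 2) ≤ x ∧ x < h * ((t : ℝ) + 1 - n / 2)}

lemma cell_eq_Ico (h : ℝ) (n t : ℕ) :
    cell h n t = Set.Ico (h * ((t : ℝ) - n / 2)) (h * ((t : ℝ) + 1 - n / 2)) := rfl

/-- The function that takes the value `g t` on the `t`-th cell. -/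
noncomputable def stepFun (h : ℝ) (n : ℕ) (g : ℕ → ℝ) (x : ℝ) : ℝ :=
  ∑ t ∈ Finset.range n, (cell h n t).indicator (fun _ => g t) x

variable {h : ℝ} {n : ℕ}

lemma cell_unique (hh : 0 < h) {x : ℝ} {t t' : ℕ} (ht : x ∈ cell h n t) (ht' : x ∈ cell h n t') :
    t = t' := by
  have h1 : h * ((t : ℝ) - n / 2) < h * ((t' : ℝ) + 1 - n / 2) := ht.1.trans_lt ht'.2
  have h2 : h * ((t' : ℝ) - n / 2) < h * ((t : ℝ) + 1 - n / 2) := ht'.1.trans_lt ht.2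
  have h3 := lt_of_mul_lt_mul_left h1 hh.le
  have h4 := lt_of_mul_lt_mul_left h2 hh.le
  have h5 : (t : ℝ) < (t' + 1 : ℕ) := by push_cast; linarith
  have h6 : (t' : ℝ) < (t + 1 : ℕ) := by push_cast; linarith
  have h7 := Nat.cast_lt.mp h5
  have h8 := Nat.cast_lt.mp h6
  omega

lemma stepFun_of_mem (hh : 0 < h) (g : ℕ → ℝ) {x : ℝ} {t : ℕ} (htn : t < n)
    (ht : x ∈ cell h n t) : stepFun h n g x = g t := by
  rw [stepFun, Finset.sum_eq_single t]
  · simp [ht]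
  · intro t' _ hne
    rw [Set.indicator_of_notMem]
    intro hx
    exact hne (cell_unique hh hx ht)
  · intro hcon; simp [htn] at hcon

lemma stepFun_of_notMem (g : ℕ → ℝ) {x : ℝ} (hx : ∀ t < n, x ∉ cell h n t) :
    stepFun h n g x = 0 :=
  Finset.sum_eq_zero fun t ht => Set.indicator_of_notMem (hx t (Finset.mem_range.mp ht)) _

lemma exists_mem_cell (hh : 0 < h) {x : ℝ} (h1 : -(h * n / 2) ≤ x) (h2 : x < h * n / 2) :
    ∃ t < n, x ∈ cell h n t := by
  have hx0 : 0 ≤ x / h + n / 2 := by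
    have : -((n : ℝ) / 2) ≤ x / h := by rw [le_div_iff₀ hh]; linarith
    linarith
  refine ⟨⌊x / h + n / 2⌋₊, ?_, ?_, ?_⟩
  · rw [Nat.floor_lt hx0]
    have : x / h < n / 2 := by rw [div_lt_iff₀ hh]; linarith
    linarith
  · have := Nat.floor_le hx0
    calc h * ((⌊x / h + n / 2⌋₊ : ℝ) - n / 2) ≤ h * (x / h) := by gcongr; linarith
      _ = x := by field_simp
  · have := Nat.lt_floor_add_one (x / h + n / 2)
    calc x = h * (x / h) := by field_simp
      _ < _ := by gcongr; linarith

lemma mem_Ico_of_mem_cell (hh : 0 < h) {x : ℝ} {t : ℕ} (htn : t < n) (ht : x ∈ cell h n t) :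
    x ∈ Set.Ico (-(h * n / 2)) (h * n / 2) := by
  have htn' : (t : ℝ) + 1 ≤ n := by exact_mod_cast htn
  have ht0 : (0 : ℝ) ≤ t := t.cast_nonneg
  constructor
  · refine le_trans ?_ ht.1; nlinarith
  · refine lt_of_lt_of_le ht.2 ?_; nlinarith

lemma stepFun_mul (hh : 0 < h) (g g' : ℕ → ℝ) (x : ℝ) :
    stepFun h n g x * stepFun h n g' x = stepFun h n (fun t => g t * g' t) x := by
  by_cases hx : ∃ t < n, x ∈ cell h n t
  · obtain ⟨t, htn, ht⟩ := hx
    simp only [stepFun_of_mem hh _ htn ht]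
  · push Not at hx
    simp only [stepFun_of_notMem _ hx, mul_zero]

lemma measurable_stepFun (g : ℕ → ℝ) : Measurable (stepFun h n g) := by
  refine Finset.measurable_fun_sum _ fun t _ => ?_
  rw [cell_eq_Ico]
  exact measurable_const.indicator measurableSet_Ico

lemma integrable_stepFun (g : ℕ → ℝ) : Integrable (stepFun h n g) := by
  refine integrable_finsetSum _ fun t _ => ?_
  rw [cell_eq_Ico, integrable_indicator_iff measurableSet_Ico]
  exact integrableOn_const (by simp)

lemma integral_stepFun (hh : 0 < h) (g : ℕ → ℝ) :
    ∫ x, stepFun h n g x = h * ∑ t ∈ Finset.range n, g t := by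
  have hint : ∀ t, Integrable ((cell h n t).indicator fun _ => g t) := fun t => by
    rw [cell_eq_Ico, integrable_indicator_iff measurableSet_Ico]
    exact integrableOn_const (by simp)
  simp only [stepFun]
  rw [integral_finsetSum _ fun t _ => hint t, Finset.mul_sum]
  refine Finset.sum_congr rfl fun t _ => ?_
  rw [cell_eq_Ico, integral_indicator_const _ measurableSet_Ico, smul_eq_mul]
  congr 1
  rw [Real.volume_real_Ico_of_le (by nlinarith)]
  ring

/-! ### Approximation of the Gaussian amplitude -/

/-- The square root of the standard Gaussian density. -/
noncomputable def gaussAmp (x : ℝ) : ℝ := Real.sqrt (1 / Real.sqrt (2 * Real.pi)) * Real.exp (-x ^ 2 / 4)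

/-- Each term of index at least T is at most 2 ^ (-T) times the corresponding term of the series of
exp (2Y). -/
lemma exp_sub_sum_le (Y : ℝ) (hY : 0 ≤ Y) (T : ℕ) :
    Real.exp Y - ∑ m ∈ Finset.range T, Y ^ m / m.factorial ≤ Real.exp (2 * Y) / 2 ^ T := by
  have h1 : HasSum (fun m : ℕ => Y ^ m / m.factorial) (Real.exp Y) := by
    rw [Real.exp_eq_exp_ℝ]; exact NormedSpace.expSeries_div_hasSum_exp Y
  have h2 : HasSum (fun m : ℕ => (2 * Y) ^ m / m.factorial) (Real.exp (2 * Y)) := by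
    rw [Real.exp_eq_exp_ℝ]; exact NormedSpace.expSeries_div_hasSum_exp (2 * Y)
  have h3 := h1.summable.sum_add_tsum_nat_add T
  have h4 := h2.summable.sum_add_tsum_nat_add T
  rw [h1.tsum_eq] at h3
  rw [h2.tsum_eq] at h4
  have h5 : ∑' m, Y ^ (m + T) / ((m + T).factorial : ℝ) ≤
      (∑' m, (2 * Y) ^ (m + T) / ((m + T).factorial : ℝ)) / 2 ^ T := by
    rw [← tsum_div_const]
    refine Summable.tsum_le_tsum (fun m => ?_) ((summable_nat_add_iff T).mpr h1.summable)
      (((summable_nat_add_iff T).mpr h2.summable).div_const _)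
    rw [mul_pow, div_right_comm]
    gcongr
    rw [le_div_iff₀ (by positivity), mul_comm]
    gcongr
    · norm_num
    · omega
  have h6 : 0 ≤ ∑ m ∈ Finset.range T, (2 * Y) ^ m / (m.factorial : ℝ) :=
    Finset.sum_nonneg fun m _ => by positivity
  calc Real.exp Y - ∑ m ∈ Finset.range T, Y ^ m / (m.factorial : ℝ)
      = ∑' m, Y ^ (m + T) / ((m + T).factorial : ℝ) := by linarith
    _ ≤ _ := h5
    _ ≤ Real.exp (2 * Y) / 2 ^ T := by gcongr; linarith

lemma abs_exp_neg_sub_sum_le (Y : ℝ) (hY : 0 ≤ Y) (T : ℕ) :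
    |Real.exp (-Y) - ∑ m ∈ Finset.range T, (-Y) ^ m / m.factorial| ≤ Real.exp (2 * Y) / 2 ^ T := by
  have h := Complex.norm_exp_sub_sum_le_exp_norm_sub_sum ((-Y : ℝ) : ℂ) T
  have hn : ‖((-Y : ℝ) : ℂ)‖ = Y := by rw [Complex.norm_real, Real.norm_eq_abs, abs_neg, abs_of_nonneg hY]
  rw [hn] at h
  refine le_trans ?_ (h.trans (exp_sub_sum_le Y hY T))
  rw [← Real.norm_eq_abs, ← Complex.norm_real]
  push_cast
  exact le_rfl

lemma abs_exp_sq_sub_le (x y : ℝ) :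
    |Real.exp (-x ^ 2 / 4) - Real.exp (-y ^ 2 / 4)| ≤ |x - y| := by
  have hd : ∀ t : ℝ, HasDerivAt (fun t : ℝ => Real.exp (-t ^ 2 / 4))
      (Real.exp (-t ^ 2 / 4) * (-(2 * t) / 4)) t := by
    intro t
    have h1 : HasDerivAt (fun t : ℝ => -t ^ 2 / 4) (-(2 * t) / 4) t := by
      simpa using ((hasDerivAt_pow 2 t).neg).div_const 4
    exact h1.exp
  have hb : ∀ t : ℝ, ‖Real.exp (-t ^ 2 / 4) * (-(2 * t) / 4)‖ ≤ 1 := by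
    intro t
    rw [norm_mul, Real.norm_eq_abs, Real.norm_eq_abs, abs_of_pos (Real.exp_pos _)]
    have h1 : Real.exp (-t ^ 2 / 4) = (Real.exp (t ^ 2 / 4))⁻¹ := by
      rw [← Real.exp_neg]; congr 1; ring
    rw [h1, inv_mul_le_iff₀ (Real.exp_pos _), mul_one]
    refine le_trans ?_ (Real.add_one_le_exp _)
    rw [abs_le]; constructor <;> nlinarith [sq_nonneg (t - 1), sq_nonneg (t + 1)]
  have := (convex_univ).norm_image_sub_le_of_norm_hasDerivWithin_le
    (fun t _ => (hd t).hasDerivWithinAt) (fun t _ => hb t) (Set.mem_univ y) (Set.mem_univ x)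
  simpa using this

lemma gaussAmp_const_le : Real.sqrt (1 / Real.sqrt (2 * Real.pi)) ^ 2 ≤ 1 / 2 := by
  rw [Real.sq_sqrt (by positivity)]
  have : (2 : ℝ) ≤ Real.sqrt (2 * Real.pi) :=
    Real.le_sqrt_of_sq_le (by linarith [Real.pi_gt_three])
  exact one_div_le_one_div_of_le (by norm_num) this

lemma gaussAmp_sq (x : ℝ) :
    gaussAmp x ^ 2 = 1 / Real.sqrt (2 * Real.pi) * Real.exp (-(1 / 2) * x ^ 2) := by
  rw [gaussAmp, mul_pow, Real.sq_sqrt (by positivity), ← Real.exp_nat_mul]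
  congr 2
  push_cast; ring

lemma continuous_gaussAmp : Continuous gaussAmp := by
  unfold gaussAmp; fun_prop

lemma integrable_gaussAmp_sq : Integrable fun x => gaussAmp x ^ 2 := by
  simp only [gaussAmp_sq]
  exact (integrable_exp_neg_mul_sq (by norm_num)).const_mul _

lemma integral_gaussAmp_sq : ∫ x, gaussAmp x ^ 2 = 1 := by
  simp only [gaussAmp_sq]
  rw [integral_const_mul, integral_gaussian, show Real.pi / (1 / 2) = 2 * Real.pi by ring]
  field_simp

end GaussianPreparation

/-! ### Accuracy of the polynomial amplitudes in one dimension -/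

namespace GaussianPreparation

open MeasureTheory

lemma exp_nat_mul_le (a n : ℕ) : Real.exp (2 * a * n) ≤ 2 ^ (3 * a * n) := by
  have h1 : Real.exp 2 ≤ 2 ^ 3 := by
    have : Real.exp 2 = Real.exp 1 * Real.exp 1 := by rw [← Real.exp_add]; norm_num
    rw [this]
    nlinarith [Real.exp_one_lt_d9, Real.exp_pos 1]
  calc Real.exp (2 * a * n) = Real.exp 2 ^ (a * n) := by
        rw [← Real.exp_nat_mul]; congr 1; push_cast; ring
    _ ≤ (2 ^ 3) ^ (a * n) := by gcongr
    _ = 2 ^ (3 * a * n) := by rw [← pow_mul]; congr 1; ring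

lemma grid_width_le (n₀ : ℕ) : (16 * n₀ : ℝ) / 2 ^ (16 * n₀) ≤ Real.exp (-(6 * n₀)) := by
  rcases Nat.eq_zero_or_pos n₀ with rfl | hn
  · simp
  rw [Real.exp_neg, div_le_iff₀ (by positivity), inv_mul_eq_div, le_div_iff₀ (Real.exp_pos _)]
  have h1 : Real.exp (6 * n₀) ≤ 2 ^ (3 * 3 * n₀) := by
    refine le_trans (Real.exp_le_exp.mpr ?_) (exp_nat_mul_le 3 n₀)
    push_cast; linarith
  have h2 : (n₀ : ℝ) ≤ 2 ^ n₀ := by exact_mod_cast Nat.lt_two_pow_self.le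
  calc (16 * n₀ : ℝ) * Real.exp (6 * n₀) ≤ (16 * 2 ^ n₀) * 2 ^ (3 * 3 * n₀) := by
        gcongr
    _ = 2 ^ (4 + n₀ + 3 * 3 * n₀) := by rw [pow_add, pow_add]; norm_num
    _ ≤ 2 ^ (16 * n₀) := by gcongr <;> [norm_num; omega]

/-- P is the Taylor polynomial of exp(-x²/4), scaled and read in the cell index. On |x| ≤ 8n₀ the
exponent is at most 16n₀², and 32n₀² + 6n₀ ≤ 38n₀² together with exp 2 ≤ 2 ^ 3 asks for 57n₀² Taylor
terms; T = 64n₀² is enough. -/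
lemma exists_polynomial_approx {n₀ : ℕ} (hn : 0 < n₀) (h : ℝ) (N : ℕ)
    (hN : h * N = 16 * n₀) (hh : 0 < h) :
    ∃ P : Polynomial ℝ, P.degree < (128 * n₀ ^ 2 : ℕ) ∧ ∀ t < N,
      |P.eval (t : ℝ) - gaussAmp (h * (t - N / 2))| ≤ Real.exp (-(6 * n₀)) := by
  set T := 64 * n₀ ^ 2 with hT
  set κ := Real.sqrt (1 / Real.sqrt (2 * Real.pi)) with hκ
  have hκ1 : κ ≤ 1 := by nlinarith [gaussAmp_const_le, Real.sqrt_nonneg (1 / Real.sqrt (2 * Real.pi))]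
  have hκ0 : 0 ≤ κ := Real.sqrt_nonneg _
  let Q : Polynomial ℝ := Polynomial.C h * Polynomial.X - Polynomial.C (h * (N / 2))
  have hQ : Q.natDegree ≤ 1 := by
    rw [Polynomial.natDegree_sub_C]
    exact (Polynomial.natDegree_C_mul_le _ _).trans Polynomial.natDegree_X_le
  let P : Polynomial ℝ := Polynomial.C κ * ∑ m ∈ Finset.range T,
    Polynomial.C (((m.factorial : ℝ))⁻¹) * (Polynomial.C (-1 / 4) * Q ^ 2) ^ m
  have hP : P.natDegree ≤ 2 * (T - 1) := by
    refine (Polynomial.natDegree_C_mul_le _ _).trans ?_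
    refine Polynomial.natDegree_sum_le_of_forall_le _ _ fun m hm => ?_
    refine (Polynomial.natDegree_C_mul_le _ _).trans ?_
    refine (Polynomial.natDegree_pow_le_of_le m ((Polynomial.natDegree_C_mul_le _ _).trans
      (Polynomial.natDegree_pow_le_of_le 2 hQ))).trans ?_
    have := Finset.mem_range.mp hm
    omega
  refine ⟨P, ?_, fun t ht => ?_⟩
  · refine Polynomial.degree_le_natDegree.trans_lt ?_
    have hpos : 0 < n₀ ^ 2 := by positivity
    exact_mod_cast (show P.natDegree < 128 * n₀ ^ 2 by omega)
  · set x := h * ((t : ℝ) - N / 2) with hx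
    have hQe : Q.eval (t : ℝ) = x := by
      simp only [Q, Polynomial.eval_sub, Polynomial.eval_mul, Polynomial.eval_C, Polynomial.eval_X, hx]
      ring
    have hPe : P.eval (t : ℝ) = κ * ∑ m ∈ Finset.range T, (-(x ^ 2 / 4)) ^ m / m.factorial := by
      simp only [P, Polynomial.eval_mul, Polynomial.eval_C, Polynomial.eval_finsetSum,
        Polynomial.eval_pow, hQe]
      congr 1
      refine Finset.sum_congr rfl fun m _ => ?_
      rw [inv_mul_eq_div]; congr 2; ring
    have hxb : x ^ 2 ≤ 64 * n₀ ^ 2 := by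
      have htN : (t : ℝ) ≤ N := by exact_mod_cast ht.le
      have h1 : x ≤ 8 * n₀ := by rw [hx]; nlinarith
      have h2 : -(8 * n₀) ≤ x := by
        rw [hx]; nlinarith [mul_nonneg hh.le (Nat.cast_nonneg (α := ℝ) t)]
      nlinarith
    have h1 := abs_exp_neg_sub_sum_le (x ^ 2 / 4) (by positivity) T
    have h2 : Real.exp (2 * (x ^ 2 / 4)) / 2 ^ T ≤ Real.exp (-(6 * n₀)) := by
      rw [div_le_iff₀ (by positivity), Real.exp_neg, inv_mul_eq_div, le_div_iff₀ (Real.exp_pos _),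
        ← Real.exp_add]
      have hn1 : (1 : ℝ) ≤ n₀ := by exact_mod_cast hn
      calc Real.exp (2 * (x ^ 2 / 4) + 6 * n₀) ≤ Real.exp (2 * (19 : ℕ) * (n₀ ^ 2 : ℕ)) := by
            apply Real.exp_le_exp.mpr; push_cast; nlinarith
        _ ≤ 2 ^ (3 * 19 * n₀ ^ 2) := exp_nat_mul_le 19 (n₀ ^ 2)
        _ ≤ 2 ^ T := by gcongr <;> [norm_num; omega]
    rw [hPe, gaussAmp, ← mul_sub, abs_mul, abs_of_nonneg hκ0, abs_sub_comm, neg_div]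
    calc κ * _ ≤ 1 * Real.exp (-(6 * n₀)) := by
          gcongr; exact h1.trans h2
      _ = _ := one_mul _

lemma abs_gaussAmp_sub_le (x y : ℝ) : |gaussAmp x - gaussAmp y| ≤ |x - y| := by
  have hκ1 : Real.sqrt (1 / Real.sqrt (2 * Real.pi)) ≤ 1 := by
    nlinarith [gaussAmp_const_le, Real.sqrt_nonneg (1 / Real.sqrt (2 * Real.pi))]
  rw [gaussAmp, gaussAmp, ← mul_sub, abs_mul, abs_of_nonneg (Real.sqrt_nonneg _)]
  exact (mul_le_mul hκ1 (abs_exp_sq_sub_le x y) (abs_nonneg _) zero_le_one).trans_eq (one_mul _)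

lemma gaussAmp_sq_le_tail {R x : ℝ} (hR : R ^ 2 ≤ x ^ 2) :
    gaussAmp x ^ 2 ≤ Real.exp (-(R ^ 2 / 4)) / 2 * Real.exp (-(1 / 4) * x ^ 2) := by
  rw [gaussAmp, mul_pow, ← Real.exp_nat_mul, div_mul_eq_mul_div, ← Real.exp_add]
  refine (mul_le_mul gaussAmp_const_le (Real.exp_le_exp.mpr (?_ : _ ≤ -(R ^ 2 / 4) +
    -(1 / 4) * x ^ 2)) (Real.exp_pos _).le (by norm_num)).trans_eq (by ring)
  push_cast; linarith

/-- Inside the window the error is the polynomial error plus the cell width, because `gaussAmp` is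
1-Lipschitz; outside, only the Gaussian tail beyond R = 8n₀ remains. -/
lemma integral_stepFun_sub_gaussAmp_sq_le {n₀ : ℕ} (hn : 0 < n₀) {h : ℝ} {N : ℕ}
    (hN : h * N = 16 * n₀) (hh : 0 < h) (hw : h ≤ Real.exp (-(6 * n₀))) (a : ℕ → ℝ)
    (ha : ∀ t < N, |a t - gaussAmp (h * (t - N / 2))| ≤ Real.exp (-(6 * n₀))) :
    ∫ x, (stepFun h N a x - gaussAmp x) ^ 2 ≤ Real.exp (-(4 * n₀)) := by
  set R : ℝ := h * N / 2 with hRdef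
  have hR : R = 8 * n₀ := by rw [hRdef, hN]; ring
  set e := Real.exp (-(6 * n₀ : ℝ)) with he
  have he0 : 0 < e := Real.exp_pos _
  have hn1 : (1 : ℝ) ≤ n₀ := by exact_mod_cast hn
  let F : ℝ → ℝ := fun x => (Set.Ico (-R) R).indicator (fun _ => (2 * e) ^ 2) x +
    Real.exp (-(R ^ 2 / 4)) / 2 * Real.exp (-(1 / 4) * x ^ 2)
  have hpt : ∀ x, (stepFun h N a x - gaussAmp x) ^ 2 ≤ F x := by
    intro x
    by_cases hx : x ∈ Set.Ico (-R) R
    · obtain ⟨t, htN, ht⟩ := exists_mem_cell hh hx.1 hx.2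
      have h1 : |stepFun h N a x - gaussAmp x| ≤ 2 * e := by
        rw [stepFun_of_mem hh a htN ht]
        have h2 : |h * ((t : ℝ) - N / 2) - x| ≤ h := by
          rw [abs_le]; constructor <;> [linarith [ht.2]; linarith [ht.1]]
        calc |a t - gaussAmp x| = |(a t - gaussAmp (h * (t - N / 2))) +
              (gaussAmp (h * (t - N / 2)) - gaussAmp x)| := by ring_nf
          _ ≤ e + e := (abs_add_le _ _).trans (add_le_add (ha t htN)
              ((abs_gaussAmp_sub_le _ _).trans (h2.trans hw)))
          _ = 2 * e := by ring
      have h3 : 0 ≤ Real.exp (-(R ^ 2 / 4)) / 2 * Real.exp (-(1 / 4) * x ^ 2) := by positivity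
      simp only [F, Set.indicator_of_mem hx]
      rw [← sq_abs]
      have := pow_le_pow_left₀ (abs_nonneg _) h1 2
      linarith
    · rw [stepFun_of_notMem a fun t htN ht => hx (mem_Ico_of_mem_cell hh htN ht)]
      simp only [F, Set.indicator_of_notMem hx, zero_add, zero_sub, neg_sq]
      apply gaussAmp_sq_le_tail
      rw [sq_le_sq, abs_of_nonneg (by rw [hR]; positivity : (0 : ℝ) ≤ R)]
      rw [Set.mem_Ico, not_and_or, not_le, not_lt] at hx
      rcases hx with hx | hx
      · rw [le_abs]; right; linarith
      · exact hx.trans (le_abs_self _)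
  have hi1 : Integrable ((Set.Ico (-R) R).indicator fun _ => (2 * e) ^ 2) := by
    rw [integrable_indicator_iff measurableSet_Ico]
    exact integrableOn_const (by simp)
  have hi2 : Integrable fun x : ℝ => Real.exp (-(R ^ 2 / 4)) / 2 * Real.exp (-(1 / 4) * x ^ 2) :=
    (integrable_exp_neg_mul_sq (by norm_num)).const_mul _
  have hR0 : 0 ≤ R := by rw [hR]; positivity
  have hpi : Real.sqrt (Real.pi / (1 / 4)) ≤ 4 := by
    rw [Real.sqrt_le_left (by norm_num)]; linarith [Real.pi_le_four]
  calc ∫ x, (stepFun h N a x - gaussAmp x) ^ 2 ≤ ∫ x, F x :=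
        integral_mono_of_nonneg (Filter.Eventually.of_forall fun x => sq_nonneg _) (hi1.add hi2)
          (Filter.Eventually.of_forall hpt)
    _ = 2 * R * (2 * e) ^ 2 + Real.exp (-(R ^ 2 / 4)) / 2 * Real.sqrt (Real.pi / (1 / 4)) := by
        simp only [F]
        rw [integral_add hi1 hi2, integral_indicator_const _ measurableSet_Ico, integral_const_mul,
          integral_gaussian, Real.volume_real_Ico_of_le (by linarith), smul_eq_mul]
        ring
    _ ≤ 2 * R * (2 * e) ^ 2 + Real.exp (-(R ^ 2 / 4)) / 2 * 4 := by gcongr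
    _ ≤ Real.exp (-(4 * n₀)) / 2 + Real.exp (-(4 * n₀)) / 2 := by
        have h8 : (128 * n₀ : ℝ) ≤ Real.exp (8 * n₀) := by
          have h2 : (2 : ℝ) ≤ Real.exp 1 := Real.exp_one_gt_two.le
          have h3 : (n₀ : ℝ) ≤ 2 ^ n₀ := by exact_mod_cast Nat.lt_two_pow_self.le
          calc (128 * n₀ : ℝ) ≤ 128 * 2 ^ n₀ := by gcongr
            _ = 2 ^ (7 + n₀) := by rw [pow_add]; norm_num
            _ ≤ 2 ^ (8 * n₀) := by gcongr <;> [norm_num; omega]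
            _ ≤ Real.exp 1 ^ (8 * n₀) := by gcongr
            _ = _ := by rw [← Real.exp_nat_mul]; push_cast; ring_nf
        gcongr
        · have h9 : e ^ 2 = Real.exp (-(4 * n₀)) * Real.exp (-(8 * n₀)) := by
            rw [he, ← Real.exp_nat_mul, ← Real.exp_add]; push_cast; ring_nf
          have h10 : 128 * n₀ * Real.exp (-(8 * n₀ : ℝ)) ≤ 1 := by
            rw [Real.exp_neg, ← div_eq_mul_inv, div_le_one (Real.exp_pos _)]; exact h8
          rw [hR, mul_pow, h9]
          nlinarith [Real.exp_pos (-(4 * n₀ : ℝ))]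
        · have h11 : Real.exp (-(R ^ 2 / 4)) ≤ Real.exp (-(4 * n₀)) * Real.exp (-(12 : ℝ)) := by
            rw [← Real.exp_add, hR]
            apply Real.exp_le_exp.mpr
            nlinarith
          have h12 : Real.exp (-(12 : ℝ)) ≤ 1 / 4 := by
            rw [Real.exp_neg, inv_le_comm₀ (Real.exp_pos _) (by norm_num)]
            linarith [Real.add_one_le_exp (12 : ℝ)]
          nlinarith [Real.exp_pos (-(4 * n₀ : ℝ))]
    _ = _ := by ring

lemma exists_grid_amplitudes {n₀ : ℕ} (hn : 0 < n₀) :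
    ∃ h : ℝ, 0 < h ∧ ∃ (v : polySpace (128 * n₀ ^ 2) (16 * n₀)) (a : ℕ → ℝ), ‖v‖ = 1 ∧
      (∀ z, v.1 z = Real.sqrt h * a (registerValue z)) ∧
      ∫ x, stepFun h (2 ^ (16 * n₀)) a x ^ 2 = 1 ∧
      1 - Real.exp (-(4 * n₀)) ≤ ∫ x, stepFun h (2 ^ (16 * n₀)) a x * gaussAmp x := by
  set N := 2 ^ (16 * n₀) with hNdef
  have hNpos : (0 : ℝ) < N := by rw [hNdef]; positivity
  have hn1 : (1 : ℝ) ≤ n₀ := by exact_mod_cast hn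
  set h : ℝ := 16 * n₀ / N with hdef
  have hh : 0 < h := by rw [hdef]; positivity
  have hN : h * N = 16 * n₀ := by rw [hdef]; field_simp
  have hw : h ≤ Real.exp (-(6 * n₀)) := by
    rw [hdef, hNdef]; push_cast; exact grid_width_le n₀
  obtain ⟨P, hPdeg, hP⟩ := exists_polynomial_approx hn h N hN hh
  set η := Real.exp (-(4 * n₀ : ℝ)) with hη
  have hη4 : η ≤ 1 / 4 := by
    rw [hη, Real.exp_neg, inv_le_comm₀ (Real.exp_pos _) (by norm_num)]
    linarith [Real.add_one_le_exp (4 * n₀ : ℝ)]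
  have hη0 : 0 < η := Real.exp_pos _
  set b : ℕ → ℝ := fun t => P.eval (t : ℝ) with hb
  have herr := integral_stepFun_sub_gaussAmp_sq_le hn hN hh hw b hP
  have hsq : ∀ c : ℕ → ℝ, (fun x => stepFun h N c x ^ 2) = stepFun h N fun t => c t * c t := by
    intro c; ext x; rw [sq, stepFun_mul hh]
  have hstep2 : Integrable fun x => stepFun h N b x ^ 2 := by
    rw [hsq]; exact integrable_stepFun _
  have hcross : ∀ c : ℕ → ℝ, Integrable fun x => stepFun h N c x * gaussAmp x := by
    intro c
    refine Integrable.mono (((hsq c ▸ integrable_stepFun _ :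
      Integrable fun x => stepFun h N c x ^ 2)).add integrable_gaussAmp_sq) ?_ ?_
    · exact ((measurable_stepFun c).mul continuous_gaussAmp.measurable).aestronglyMeasurable
    · refine Filter.Eventually.of_forall fun x => ?_
      rw [Pi.add_apply, Real.norm_of_nonneg (add_nonneg (sq_nonneg _) (sq_nonneg _)),
        Real.norm_eq_abs, abs_mul, ← sq_abs (stepFun h N c x), ← sq_abs (gaussAmp x)]
      nlinarith [sq_nonneg (|stepFun h N c x| - |gaussAmp x|),
        sq_nonneg |stepFun h N c x|, sq_nonneg |gaussAmp x|]
  set s2 := ∫ x, stepFun h N b x ^ 2 with hs2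
  set J := ∫ x, stepFun h N b x * gaussAmp x with hJ
  have hexp : ∫ x, (stepFun h N b x - gaussAmp x) ^ 2 = s2 - 2 * J + 1 := by
    have : (fun x => (stepFun h N b x - gaussAmp x) ^ 2) = fun x =>
        (stepFun h N b x ^ 2 - 2 * (stepFun h N b x * gaussAmp x)) + gaussAmp x ^ 2 := by
      ext x; ring
    have hi : Integrable fun x => stepFun h N b x ^ 2 - 2 * (stepFun h N b x * gaussAmp x) :=
      hstep2.sub ((hcross b).const_mul 2)
    rw [this, integral_add hi integrable_gaussAmp_sq,
      integral_sub hstep2 ((hcross b).const_mul 2), integral_const_mul, integral_gaussAmp_sq]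
  -- From g² ≤ 2u² + 2(u - g)² and an L² error of at most 1/4.
  have hs2low : 1 / 4 ≤ s2 := by
    have h1 : (1 : ℝ) ≤ ∫ x, (2 * stepFun h N b x ^ 2 + 2 * (stepFun h N b x - gaussAmp x) ^ 2) := by
      rw [← integral_gaussAmp_sq]
      refine integral_mono integrable_gaussAmp_sq ?_ fun x => ?_
      · have : (fun x => 2 * stepFun h N b x ^ 2 + 2 * (stepFun h N b x - gaussAmp x) ^ 2) = fun x =>
          (4 * stepFun h N b x ^ 2 - 4 * (stepFun h N b x * gaussAmp x)) + 2 * gaussAmp x ^ 2 := by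
          ext x; ring
        rw [this]
        exact ((hstep2.const_mul 4).sub ((hcross b).const_mul 4)).add
          (integrable_gaussAmp_sq.const_mul 2)
      · change gaussAmp x ^ 2 ≤ 2 * stepFun h N b x ^ 2 + 2 * (stepFun h N b x - gaussAmp x) ^ 2
        nlinarith [sq_nonneg (stepFun h N b x - (gaussAmp x - stepFun h N b x))]
    have h2 : Integrable fun x => (stepFun h N b x - gaussAmp x) ^ 2 := by
      have : (fun x => (stepFun h N b x - gaussAmp x) ^ 2) = fun x =>
        (stepFun h N b x ^ 2 - 2 * (stepFun h N b x * gaussAmp x)) + gaussAmp x ^ 2 := by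
        ext x; ring
      rw [this]
      exact (hstep2.sub ((hcross b).const_mul 2)).add integrable_gaussAmp_sq
    rw [integral_add (hstep2.const_mul 2) (h2.const_mul 2), integral_const_mul,
      integral_const_mul] at h1
    linarith
  set s := Real.sqrt s2 with hs
  have hs0 : 0 < s := Real.sqrt_pos.mpr (by linarith)
  have hss : s ^ 2 = s2 := Real.sq_sqrt (by linarith)
  have hs12 : 1 / 2 ≤ s := by nlinarith
  set a : ℕ → ℝ := fun t => b t / s with hadef
  have hstep_a : ∀ x, stepFun h N a x = stepFun h N b x / s := by
    intro x
    simp only [stepFun, Finset.sum_div]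
    refine Finset.sum_congr rfl fun t _ => ?_
    by_cases hx : x ∈ cell h N t <;> simp [hx, hadef]
  have hnorm : ∫ x, stepFun h N a x ^ 2 = 1 := by
    simp only [hstep_a, div_pow]
    rw [integral_div, hss, ← hs2, div_self (by linarith)]
  have hmem : (WithLp.toLp 2 fun z => Real.sqrt h * a (registerValue z) :
      EuclideanSpace ℝ (Fin (16 * n₀) → Bool)) ∈ polySpace (128 * n₀ ^ 2) (16 * n₀) := by
    rw [mem_polySpace]
    refine ⟨Polynomial.C (Real.sqrt h / s) * P, ?_, fun z => ?_⟩
    · refine lt_of_le_of_lt ?_ hPdeg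
      rw [Polynomial.degree_C_mul]
      exact (div_pos (Real.sqrt_pos.mpr hh) hs0).ne'
    · simp only [Polynomial.eval_mul, Polynomial.eval_C, hadef, hb]
      ring
  refine ⟨h, hh, ⟨_, hmem⟩, a, ?_, fun z => rfl, hnorm, ?_⟩
  · have h1 : ‖(⟨_, hmem⟩ : polySpace (128 * n₀ ^ 2) (16 * n₀))‖ ^ 2 = 1 := by
      rw [← hnorm, hsq, integral_stepFun hh, Submodule.coe_norm, EuclideanSpace.norm_sq_eq,
        Finset.mul_sum, ← sum_registerValue _ fun t => h * (a t * a t)]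
      refine Finset.sum_congr rfl fun z _ => ?_
      rw [Real.norm_eq_abs, sq_abs, mul_pow, Real.sq_sqrt hh.le, sq]
    exact (pow_eq_one_iff_of_nonneg (norm_nonneg _) two_ne_zero).mp h1
  · have : (fun x => stepFun h N a x * gaussAmp x) = fun x =>
        (stepFun h N b x * gaussAmp x) / s := by
      ext x; rw [hstep_a]; ring
    -- The error bound gives 2J ≥ s² + 1 - η ≥ 2s - η, and s ≥ 1/2 turns this into J ≥ (1 - η)s.
    rw [this, integral_div, ← hJ, le_div_iff₀ hs0]
    rw [hexp] at herr
    nlinarith [sq_nonneg (s - 1)]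

end GaussianPreparation

/-! ### Tensor powers, dilations and the cost of the Gaussian state -/

namespace GaussianPreparation

open MeasureTheory

lemma integral_space_prod {d : ℕ} (φ : ℝ → ℝ) :
    ∫ x : Space d, ∏ a, φ (x a) = (∫ t, φ t) ^ d := by
  have h := (PiLp.volume_preserving_ofLp (Fin d)).integral_comp
    (MeasurableEquiv.toLp 2 (Fin d → ℝ)).symm.measurableEmbedding (fun x => ∏ a, φ (x a))
  rw [h, integral_fintype_prod_volume_eq_pow, Fintype.card_fin]

lemma integrable_space_prod {d : ℕ} {φ : ℝ → ℝ} (hφ : Integrable φ) :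
    Integrable fun x : Space d => ∏ a, φ (x a) := by
  have h := (PiLp.volume_preserving_ofLp (Fin d)).integrable_comp_emb
    (MeasurableEquiv.toLp 2 (Fin d → ℝ)).symm.measurableEmbedding (g := fun x => ∏ a, φ (x a))
  exact h.mpr (Integrable.fintype_prod fun _ => hφ)

/-- For unit vectors the squared distance of the tensor powers is 2 - 2⟨u, g⟩ ^ d, and Bernoulli's
inequality gives ⟨u, g⟩ ^ d ≥ 1 - dη. -/
lemma lintegral_prod_sub_prod_le {d : ℕ} {u g : ℝ → ℝ} {η : ℝ}
    (hu : Integrable fun t => u t ^ 2) (hg : Integrable fun t => g t ^ 2)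
    (hug : Integrable fun t => u t * g t) (hu1 : ∫ t, u t ^ 2 = 1) (hg1 : ∫ t, g t ^ 2 = 1)
    (hη : 1 - η ≤ ∫ t, u t * g t) (hη1 : η ≤ 1) :
    ∫⁻ x : Space d, ‖((∏ a, u (x a) : ℝ) : ℂ) - ((∏ a, g (x a) : ℝ) : ℂ)‖ₑ ^ 2 ≤
      ENNReal.ofReal (2 * d * η) := by
  have hpt : ∀ x : Space d, ‖((∏ a, u (x a) : ℝ) : ℂ) - ((∏ a, g (x a) : ℝ) : ℂ)‖ₑ ^ 2 =
      ENNReal.ofReal (∏ a, u (x a) ^ 2 - 2 * ∏ a, u (x a) * g (x a) + ∏ a, g (x a) ^ 2) := by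
    intro x
    rw [← Complex.ofReal_sub, ← ofReal_norm, Complex.norm_real,
      ← ENNReal.ofReal_pow (norm_nonneg _), Real.norm_eq_abs, sq_abs, Finset.prod_pow,
      Finset.prod_pow, Finset.prod_mul_distrib]
    congr 1; ring
  have hi1 := integrable_space_prod (d := d) hu
  have hi2 := (integrable_space_prod (d := d) hug).const_mul 2
  have hi3 := integrable_space_prod (d := d) hg
  have hi12 : Integrable fun x : Space d => ∏ a, u (x a) ^ 2 - 2 * ∏ a, u (x a) * g (x a) :=
    hi1.sub hi2
  have hint : Integrable fun x : Space d =>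
      ∏ a, u (x a) ^ 2 - 2 * ∏ a, u (x a) * g (x a) + ∏ a, g (x a) ^ 2 := hi12.add hi3
  simp only [hpt]
  rw [← ofReal_integral_eq_lintegral_ofReal hint]
  · apply ENNReal.ofReal_le_ofReal
    rw [integral_add hi12 hi3, integral_sub hi1 hi2, integral_const_mul,
      integral_space_prod fun t => u t ^ 2, integral_space_prod fun t => u t * g t,
      integral_space_prod fun t => g t ^ 2, hu1, hg1, one_pow]
    have h1 : 1 - d * η ≤ (1 - η) ^ d := by
      have := one_add_mul_le_pow (show (-2 : ℝ) ≤ -η by linarith) d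
      rw [← sub_eq_add_neg] at this
      linarith
    have h2 : (1 - η) ^ d ≤ (∫ t, u t * g t) ^ d := pow_le_pow_left₀ (by linarith) hη d
    linarith
  · refine Filter.Eventually.of_forall fun x => ?_
    simp only [Pi.zero_apply]
    rw [Finset.prod_pow, Finset.prod_pow, Finset.prod_mul_distrib]
    nlinarith [sq_nonneg (∏ a, u (x a) - ∏ a, g (x a))]

lemma stepFun_scale {h σ : ℝ} (hσ : 0 < σ) (N : ℕ) (a : ℕ → ℝ) (x : ℝ) :
    stepFun (σ * h) N (fun t => a t / Real.sqrt σ) x = stepFun h N a (x / σ) / Real.sqrt σ := by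
  simp only [stepFun, Finset.sum_div]
  refine Finset.sum_congr rfl fun t _ => ?_
  have hiff : x ∈ cell (σ * h) N t ↔ x / σ ∈ cell h N t := by
    simp only [cell, Set.mem_ofPred_eq]
    rw [le_div_iff₀ hσ, div_lt_iff₀ hσ]
    constructor
    · rintro ⟨h1, h2⟩; constructor <;> linarith
    · rintro ⟨h1, h2⟩; constructor <;> linarith
  by_cases hx : x ∈ cell (σ * h) N t
  · rw [Set.indicator_of_mem hx, Set.indicator_of_mem (hiff.mp hx)]
  · rw [Set.indicator_of_notMem hx, Set.indicator_of_notMem (fun h' => hx (hiff.mpr h')), zero_div]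

lemma gridState_prod {d q : ℕ} {h : ℝ} (hh : 0 < h) (v : (Fin q → Bool) → ℝ) (a : ℕ → ℝ)
    (hv : ∀ z, v z = Real.sqrt h * a (registerValue z)) (x : Space d) :
    gridState h (fun y : Fin d × Fin q → Bool =>
        ((∏ i, v fun j => y (i, j) : ℝ) : ℂ)) x =
      ((∏ i, stepFun h (2 ^ q) a (x i) : ℝ) : ℂ) := by
  have hs : Real.sqrt h ≠ 0 := (Real.sqrt_pos.mpr hh).ne'
  have h1 : ∀ i, stepFun h (2 ^ q) a (x i) = ∑ z : Fin q → Bool,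
      (cell h (2 ^ q) (registerValue z)).indicator (fun _ => a (registerValue z)) (x i) := by
    intro i
    rw [stepFun, ← sum_registerValue q fun t => (cell h (2 ^ q) t).indicator (fun _ => a t) (x i)]
  simp only [h1]
  rw [Finset.prod_univ_sum, Fintype.piFinset_univ, gridState, Complex.ofReal_sum,
    ← (Equiv.curry (Fin d) (Fin q) Bool).sum_comp]
  refine Finset.sum_congr rfl fun y _ => ?_
  by_cases hx : x ∈ gridCell h y
  · have hx' : ∀ i, x i ∈ cell h (2 ^ q) (registerValue fun j => y (i, j)) := by
      intro i
      have := hx i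
      simpa [cell] using this
    rw [Set.indicator_of_mem hx, mul_one, ← Complex.ofReal_mul]
    congr 1
    simp only [hv]
    rw [Finset.prod_mul_distrib, Finset.prod_const, Finset.card_univ, Fintype.card_fin,
      Real.sqrt_eq_rpow, Real.sqrt_eq_rpow, ← Real.rpow_natCast (h ^ (1 / 2 : ℝ)) d,
      ← Real.rpow_mul hh.le, ← Real.rpow_natCast h d, ← Real.rpow_mul hh.le, mul_comm (1 / 2 : ℝ)]
    rw [mul_right_comm, mul_one_div, div_self (Real.rpow_pos_of_pos hh _).ne', one_mul]
    refine Finset.prod_congr rfl fun i _ => ?_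
    rw [Set.indicator_of_mem]
    · rfl
    · exact hx' i
  · rw [Set.indicator_of_notMem hx, mul_zero]
    symm
    rw [Complex.ofReal_eq_zero]
    have : ∃ i, x i ∉ cell h (2 ^ q) (registerValue fun j => y (i, j)) := by
      by_contra hcon
      push Not at hcon
      refine hx fun i => ?_
      simpa [cell] using hcon i
    obtain ⟨i, hi⟩ := this
    refine Finset.prod_eq_zero (Finset.mem_univ i) ?_
    rw [Set.indicator_of_notMem]
    exact hi

lemma gaussAmp_nonneg (x : ℝ) : 0 ≤ gaussAmp x := by unfold gaussAmp; positivity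

lemma coherentState_gaussian {d : ℕ} {σ : ℝ} (hσ : 0 < σ) (x : Space d) :
    coherentState (gibbsDensity fun x : Space d => ‖x‖ ^ 2 / (2 * σ ^ 2)) x =
      ((∏ i, gaussAmp (x i / σ) / Real.sqrt σ : ℝ) : ℂ) := by
  have hexp : ∀ y : Space d, Real.exp (-(‖y‖ ^ 2 / (2 * σ ^ 2))) =
      ∏ i, Real.exp (-(1 / (2 * σ ^ 2)) * y i ^ 2) := by
    intro y
    rw [← Real.exp_sum, EuclideanSpace.norm_sq_eq]
    congr 1
    rw [← Finset.mul_sum, div_eq_inv_mul, ← neg_mul, one_div]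
    simp
  have hI : Real.sqrt (Real.pi / (1 / (2 * σ ^ 2))) = σ * Real.sqrt (2 * Real.pi) := by
    rw [show Real.pi / (1 / (2 * σ ^ 2)) = σ ^ 2 * (2 * Real.pi) by field_simp,
      Real.sqrt_mul (sq_nonneg σ), Real.sqrt_sq hσ.le]
  rw [coherentState]
  congr 1
  have hB : 0 ≤ ∏ i, gaussAmp (x i / σ) / Real.sqrt σ :=
    Finset.prod_nonneg fun i _ => div_nonneg (gaussAmp_nonneg _) (Real.sqrt_nonneg _)
  suffices hsuff : gibbsDensity (fun x : Space d => ‖x‖ ^ 2 / (2 * σ ^ 2)) x =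
      (∏ i, gaussAmp (x i / σ) / Real.sqrt σ) ^ 2 by
    rw [hsuff, Real.sqrt_sq hB]
  simp only [gibbsDensity, hexp]
  rw [integral_space_prod fun t => Real.exp (-(1 / (2 * σ ^ 2)) * t ^ 2), integral_gaussian, hI,
    ← Finset.prod_pow]
  have hc : (σ * Real.sqrt (2 * Real.pi)) ^ d = ∏ _i : Fin d, (σ * Real.sqrt (2 * Real.pi)) := by
    simp
  rw [hc, ← Finset.prod_div_distrib]
  refine Finset.prod_congr rfl fun i _ => ?_
  rw [div_pow, gaussAmp_sq, Real.sq_sqrt hσ.le, div_pow]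
  have : -(1 / (2 * σ ^ 2)) * x i ^ 2 = -(1 / 2) * (x i ^ 2 / σ ^ 2) := by field_simp
  rw [this]
  field_simp

lemma stepCost_le (a : ℕ) : stepCost a ≤ 7 * a ^ 2 := by
  unfold stepCost
  nlinarith [Nat.le_self_pow two_ne_zero a]

lemma preparation_cost_le {d n₀ : ℕ} (hd : d ≤ n₀) (hn : 0 < n₀) :
    d * (16 * n₀) + 2 * (128 * n₀ ^ 2) +
      (d * ((16 * n₀ + 2) * stepCost (2 * (128 * n₀ ^ 2))) + 2) ≤ 10 ^ 7 * n₀ ^ 6 := by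
  have h1 : n₀ ^ 2 ≤ n₀ ^ 6 := Nat.pow_le_pow_right hn (by norm_num)
  have h2 : 1 ≤ n₀ ^ 6 := Nat.one_le_pow _ _ hn
  have h3 : d * ((16 * n₀ + 2) * stepCost (2 * (128 * n₀ ^ 2))) ≤
      n₀ * ((18 * n₀) * (7 * (2 * (128 * n₀ ^ 2)) ^ 2)) := by
    gcongr
    · omega
    · exact stepCost_le _
  have h4 : n₀ * ((18 * n₀) * (7 * (2 * (128 * n₀ ^ 2)) ^ 2)) = 8257536 * n₀ ^ 6 := by ring
  have h5 : d * (16 * n₀) ≤ 16 * n₀ ^ 2 := by nlinarith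
  omega

/-- The width σ only rescales the grid, so the cost does not depend on it. With n₀ the ceiling of
d(1 + log(1/ε)) one has d/ε ≤ exp n₀, and the total squared error 2d exp(-4n₀) is below ε². -/
lemma preparable_gaussian {d : ℕ} (hd : 0 < d) {σ ε : ℝ} (hσ : 0 < σ) (hε : 0 < ε) (hε1 : ε < 1) :
    PreparableAtCost (coherentState (gibbsDensity fun x : Space d => ‖x‖ ^ 2 / (2 * σ ^ 2))) ε
      (10 ^ 9 * (d * (1 + Real.log (1 / ε))) ^ 6) := by
  set X : ℝ := d * (1 + Real.log (1 / ε)) with hX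
  have hd1 : (1 : ℝ) ≤ d := by exact_mod_cast hd
  have hlog : 0 ≤ Real.log (1 / ε) := Real.log_nonneg (by rw [le_div_iff₀ hε]; linarith)
  have hdX : (d : ℝ) ≤ X := by rw [hX]; nlinarith
  set n₀ := ⌈X⌉₊ with hn₀
  have hXn : X ≤ n₀ := Nat.le_ceil X
  have hnX : (n₀ : ℝ) ≤ 2 * X := by
    have := Nat.ceil_lt_add_one (show 0 ≤ X by linarith)
    linarith
  have hdn : d ≤ n₀ := by exact_mod_cast hdX.trans hXn
  have hn : 0 < n₀ := hd.trans_le hdn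
  obtain ⟨h, hh, v, a, hv, hva, hstep1, hover⟩ := exists_grid_amplitudes hn
  obtain ⟨gates, hlen, hg⟩ := exists_gates_product (d := d) (by positivity) v hv
  refine ⟨σ * h, 16 * n₀, 2 * (128 * n₀ ^ 2), gates, mul_pos hσ hh, ?_, ?_⟩
  · have h1 : d * (16 * n₀) + 2 * (128 * n₀ ^ 2) + gates.length ≤ 10 ^ 7 * n₀ ^ 6 :=
      (Nat.add_le_add_left hlen _).trans (preparation_cost_le hdn hn)
    calc ((d * (16 * n₀) + 2 * (128 * n₀ ^ 2) + gates.length : ℕ) : ℝ)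
        ≤ ((10 ^ 7 * n₀ ^ 6 : ℕ) : ℝ) := by exact_mod_cast h1
      _ = 10 ^ 7 * (n₀ : ℝ) ^ 6 := by push_cast; ring
      _ ≤ 10 ^ 7 * (2 * X) ^ 6 := by gcongr
      _ ≤ 10 ^ 9 * X ^ 6 := by
        have : 0 ≤ X ^ 6 := by positivity
        nlinarith
  · rw [Finset.sum_eq_single (fun _ => false)]
    · simp only [hg, if_true]
      set u : ℝ → ℝ := fun t => stepFun h (2 ^ (16 * n₀)) a (t / σ) / Real.sqrt σ with hu
      set g : ℝ → ℝ := fun t => gaussAmp (t / σ) / Real.sqrt σ with hgdef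
      have hgrid : ∀ x : Space d, gridState (σ * h) (fun y : Fin d × Fin (16 * n₀) → Bool =>
          ((∏ i, v.1 fun j => y (i, j) : ℝ) : ℂ)) x = ((∏ i, u (x i) : ℝ) : ℂ) := by
        intro x
        rw [gridState_prod (mul_pos hσ hh) v.1 (fun t => a t / Real.sqrt σ)]
        · simp only [stepFun_scale hσ, hu]
        · intro z
          rw [hva, Real.sqrt_mul hσ.le]
          have := (Real.sqrt_pos.mpr hσ).ne'
          field_simp
      simp only [hgrid, coherentState_gaussian hσ]
      have hss : ∀ w w' : ℝ → ℝ, (fun t => w (t / σ) / Real.sqrt σ * (w' (t / σ) / Real.sqrt σ)) =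
          fun t => (w (t / σ) * w' (t / σ)) / σ := by
        intro w w'; ext t
        rw [div_mul_div_comm, Real.mul_self_sqrt hσ.le]
      have hint : ∀ w : ℝ → ℝ, ∫ t, w (t / σ) / σ = ∫ t, w t := by
        intro w
        rw [integral_div, Measure.integral_comp_div w σ, abs_of_pos hσ, smul_eq_mul]
        field_simp
      have hintegrable : ∀ w : ℝ → ℝ, Integrable w → Integrable fun t => w (t / σ) / σ :=
        fun w hw => (hw.comp_div hσ.ne').div_const σ
      -- A non-integrable function has integral 0 by convention, so a nonzero integral yields
      -- integrability.
      have hsqI : Integrable fun x => stepFun h (2 ^ (16 * n₀)) a x ^ 2 := by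
        by_contra hcon
        rw [integral_undef hcon] at hstep1
        norm_num at hstep1
      have hη4 : Real.exp (-(4 * n₀ : ℝ)) ≤ 1 / 4 := by
        have : (1 : ℝ) ≤ n₀ := by exact_mod_cast hn
        rw [Real.exp_neg, inv_le_comm₀ (Real.exp_pos _) (by norm_num)]
        linarith [Real.add_one_le_exp (4 * n₀ : ℝ)]
      have hcI : Integrable fun x => stepFun h (2 ^ (16 * n₀)) a x * gaussAmp x := by
        by_contra hcon
        rw [integral_undef hcon] at hover
        linarith
      have hu2 : (fun t => u t ^ 2) = fun t => stepFun h (2 ^ (16 * n₀)) a (t / σ) ^ 2 / σ := by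
        ext t; rw [hu, div_pow, Real.sq_sqrt hσ.le]
      have hg2 : (fun t => g t ^ 2) = fun t => gaussAmp (t / σ) ^ 2 / σ := by
        ext t; rw [hgdef, div_pow, Real.sq_sqrt hσ.le]
      have hug : (fun t => u t * g t) = fun t =>
          (stepFun h (2 ^ (16 * n₀)) a (t / σ) * gaussAmp (t / σ)) / σ := hss _ _
      have hmain := lintegral_prod_sub_prod_le (d := d) (u := u) (g := g)
        (η := Real.exp (-(4 * n₀ : ℝ)))
        (by rw [hu2]; exact hintegrable (fun t => stepFun h (2 ^ (16 * n₀)) a t ^ 2) hsqI)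
        (by rw [hg2]; exact hintegrable (fun t => gaussAmp t ^ 2) integrable_gaussAmp_sq)
        (by rw [hug]; exact hintegrable
              (fun t => stepFun h (2 ^ (16 * n₀)) a t * gaussAmp t) hcI)
        (by rw [hu2]; exact (hint fun t => stepFun h (2 ^ (16 * n₀)) a t ^ 2).trans hstep1)
        (by rw [hg2]; exact (hint fun t => gaussAmp t ^ 2).trans integral_gaussAmp_sq)
        (by rw [hug]
            exact hover.trans_eq (hint fun t => stepFun h (2 ^ (16 * n₀)) a t * gaussAmp t).symm)
        (by linarith)
      refine hmain.trans (ENNReal.ofReal_le_ofReal ?_)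
      have hexpX : (d : ℝ) / ε ≤ Real.exp n₀ := by
        refine le_trans ?_ (Real.exp_le_exp.mpr hXn)
        rw [div_eq_mul_one_div, hX, mul_add, mul_one, Real.exp_add]
        gcongr
        · linarith [Real.add_one_le_exp (d : ℝ)]
        · calc 1 / ε = Real.exp (Real.log (1 / ε)) := (Real.exp_log (by positivity)).symm
            _ ≤ _ := Real.exp_le_exp.mpr (by nlinarith)
      rw [div_le_iff₀ hε] at hexpX
      have he : Real.exp (-(4 * n₀ : ℝ)) = (Real.exp n₀ ^ 4)⁻¹ := by
        rw [← Real.exp_nat_mul, ← Real.exp_neg]; push_cast; rfl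
      have he2 : (2 : ℝ) ≤ Real.exp n₀ := by
        have : (1 : ℝ) ≤ n₀ := by exact_mod_cast hn
        linarith [Real.add_one_le_exp (n₀ : ℝ)]
      rw [he, ← div_eq_mul_inv, div_le_iff₀ (by positivity)]
      calc 2 * (d : ℝ) ≤ 2 * d ^ 2 := by nlinarith
        _ ≤ 2 * (Real.exp n₀ * ε) ^ 2 := by gcongr
        _ = 2 * (ε ^ 2 * Real.exp n₀ ^ 2) := by ring
        _ ≤ Real.exp n₀ ^ 2 * (ε ^ 2 * Real.exp n₀ ^ 2) := by gcongr; nlinarith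
        _ = _ := by ring
    · intro w _ hw
      have h0 : ∀ x : Space d, gridState (σ * h) (fun y : Fin d × Fin (16 * n₀) → Bool =>
          circuitOutput gates (Sum.elim y w)) x = 0 := by
        intro x
        simp only [hg, if_neg hw, gridState]
        simp
      simp [h0, hw]
    · simp

end GaussianPreparation

/-! ### Quadratic pinching from smoothness and dissipativity -/

namespace AnnealingSchedule

open MeasureTheory

/-- Quadratic bounds from above and below, with constants independent of the dimension. -/
structure IsPinched {d : ℕ} (A γ C : ℝ) (f : Space d → ℝ) : Prop where
  continuous : Continuous f
  le : ∀ x, f x ≤ f 0 + 1 / 2 + A / 2 * ‖x‖ ^ 2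
  ge : ∀ x, f 0 - 1 / 2 - A / 2 * ‖x‖ ^ 2 ≤ f x
  growth : ∀ x, f 0 - C + γ / 2 * ‖x‖ ^ 2 ≤ f x

section Smooth

variable {d : ℕ}

lemma inner_gradient_eq (f : Space d → ℝ) (x v : Space d) :
    inner ℝ (gradient f x) v = fderiv ℝ f x v := by
  rw [gradient, InnerProductSpace.toDual_symm_apply]

lemma norm_gradient_sub (f g : Space d → ℝ) (x y : Space d) :
    ‖gradient f x - gradient g y‖ = ‖fderiv ℝ f x - fderiv ℝ g y‖ := by
  rw [gradient, gradient, ← map_sub, LinearIsometryEquiv.norm_map]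

lemma hasFDerivAt_finiteAverage {N : ℕ} {L : ℝ} {fs : Fin N → Space d → ℝ}
    (h : IsSmoothFamily L fs) (x : Space d) :
    HasFDerivAt (finiteAverage fs) ((1 / (N : ℝ)) • ∑ k, fderiv ℝ (fs k) x) x := by
  have h1 : HasFDerivAt (fun x => ∑ k, fs k x) (∑ k, fderiv ℝ (fs k) x) x :=
    HasFDerivAt.fun_sum fun k _ => ((h k).1 x).hasFDerivAt
  exact h1.const_mul (1 / (N : ℝ))

lemma lipschitz_fderiv_finiteAverage {N : ℕ} (hN : 0 < N) {L : ℝ} {fs : Fin N → Space d → ℝ}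
    (h : IsSmoothFamily L fs) (x y : Space d) :
    ‖fderiv ℝ (finiteAverage fs) x - fderiv ℝ (finiteAverage fs) y‖ ≤ L * ‖x - y‖ := by
  have hN' : (0 : ℝ) < N := by exact_mod_cast hN
  rw [(hasFDerivAt_finiteAverage h x).fderiv, (hasFDerivAt_finiteAverage h y).fderiv, ← smul_sub,
    ← Finset.sum_sub_distrib, norm_smul, Real.norm_of_nonneg (by positivity), one_div,
    inv_mul_le_iff₀ hN']
  refine (norm_sum_le _ _).trans ?_
  calc ∑ k, ‖fderiv ℝ (fs k) x - fderiv ℝ (fs k) y‖ ≤ ∑ _k : Fin N, L * ‖x - y‖ :=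
        Finset.sum_le_sum fun k _ => by rw [← norm_gradient_sub]; exact (h k).2 x y
    _ = N * (L * ‖x - y‖) := by simp

lemma hasDerivAt_ray {f : Space d → ℝ} (hf : Differentiable ℝ f) (x : Space d) (t : ℝ) :
    HasDerivAt (fun t : ℝ => f (t • x)) (fderiv ℝ f (t • x) x) t := by
  have h1 : HasDerivAt (fun t : ℝ => t • x) x t := by
    simpa using (hasDerivAt_id t).smul_const x
  exact (hf (t • x)).hasFDerivAt.comp_hasDerivAt t h1

lemma sub_le_of_lipschitz_fderiv {f : Space d → ℝ} {L G : ℝ} (hf : Differentiable ℝ f)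
    (hL : ∀ x y, ‖fderiv ℝ f x - fderiv ℝ f y‖ ≤ L * ‖x - y‖) (hG : ‖fderiv ℝ f 0‖ ≤ G)
    (x : Space d) : f x - f 0 ≤ G * ‖x‖ + L / 2 * ‖x‖ ^ 2 := by
  let ψ : ℝ → ℝ := fun t => f (t • x) - (G * ‖x‖ * t + L / 2 * ‖x‖ ^ 2 * t ^ 2)
  have hψ : ∀ t, HasDerivAt ψ (fderiv ℝ f (t • x) x -
      (G * ‖x‖ + L / 2 * ‖x‖ ^ 2 * (2 * t))) t := by
    intro t
    refine (hasDerivAt_ray hf x t).sub (HasDerivAt.add ?_ ?_)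
    · simpa using (hasDerivAt_id t).const_mul (G * ‖x‖)
    · simpa using (hasDerivAt_pow 2 t).const_mul (L / 2 * ‖x‖ ^ 2)
  have hanti : AntitoneOn ψ (Set.Icc 0 1) := by
    refine antitoneOn_of_deriv_nonpos (convex_Icc 0 1)
      (fun t _ => (hψ t).continuousAt.continuousWithinAt)
      (fun t _ => (hψ t).differentiableAt.differentiableWithinAt) fun t ht => ?_
    rw [interior_Icc] at ht
    rw [(hψ t).deriv]
    have h1 : ‖fderiv ℝ f (t • x)‖ ≤ G + L * (t * ‖x‖) := by
      have h2 := hL (t • x) 0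
      rw [sub_zero, norm_smul, Real.norm_of_nonneg ht.1.le] at h2
      calc ‖fderiv ℝ f (t • x)‖ = ‖fderiv ℝ f 0 + (fderiv ℝ f (t • x) - fderiv ℝ f 0)‖ := by
            congr 1; abel
        _ ≤ _ := (norm_add_le _ _).trans (add_le_add hG h2)
    have h3 : fderiv ℝ f (t • x) x ≤ (G + L * (t * ‖x‖)) * ‖x‖ :=
      (le_abs_self _).trans (((fderiv ℝ f (t • x)).le_opNorm x).trans (by gcongr))
    linarith
  have h := hanti (Set.left_mem_Icc.mpr zero_le_one) (Set.right_mem_Icc.mpr zero_le_one) zero_le_one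
  simp only [ψ, one_smul, zero_smul] at h
  linarith

/-- Dissipativity at the unit vector -u opposite to the gradient at 0 reads m - b ≤ ⟨∇f(-u), -u⟩ ≤
-‖∇f(0)‖ + L. This makes all later constants independent of f. -/
lemma norm_fderiv_zero_le {f : Space d → ℝ} {L m b : ℝ} (hm : 0 ≤ m) (hL0 : 0 ≤ L) (hb : 0 ≤ b)
    (hL : ∀ x y, ‖fderiv ℝ f x - fderiv ℝ f y‖ ≤ L * ‖x - y‖) (hdis : IsDissipative m b f) :
    ‖fderiv ℝ f 0‖ ≤ b + L := by
  have hgn : ‖gradient f 0‖ = ‖fderiv ℝ f 0‖ := by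
    rw [gradient, LinearIsometryEquiv.norm_map]
  by_cases h0 : gradient f 0 = 0
  · rw [← hgn, h0, norm_zero]; positivity
  · have hpos : 0 < ‖gradient f 0‖ := norm_pos_iff.mpr h0
    set u : Space d := (‖gradient f 0‖)⁻¹ • gradient f 0 with hu
    have hu1 : ‖u‖ = 1 := by
      rw [hu, norm_smul, norm_inv, norm_norm, inv_mul_cancel₀ hpos.ne']
    have h1 := hdis (-u)
    have h2 : inner ℝ (gradient f 0) u = ‖gradient f 0‖ := by
      rw [hu, inner_smul_right, real_inner_self_eq_norm_sq]
      field_simp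
    have h3 : ‖gradient f (-u) - gradient f 0‖ ≤ L := by
      rw [norm_gradient_sub]
      simpa [hu1] using hL (-u) 0
    have h4 : inner ℝ (gradient f (-u)) (-u) =
        -‖gradient f 0‖ + inner ℝ (gradient f (-u) - gradient f 0) (-u) := by
      rw [inner_sub_left, inner_neg_right (gradient f 0), h2]; ring
    have h5 : inner ℝ (gradient f (-u) - gradient f 0) (-u) ≤ L := by
      refine (real_inner_le_norm _ _).trans ?_
      rw [norm_neg, hu1, mul_one]; exact h3
    rw [norm_neg, hu1] at h1
    rw [← hgn]
    linarith

/-- Along the ray, dissipativity says d/dt f(tx) ≥ mt‖x‖² - b/t. Integrating from t₀ > 0 keeps the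
contribution of b/t a finite logarithm. -/
lemma growth_of_dissipative {f : Space d → ℝ} {m b : ℝ} (hf : Differentiable ℝ f)
    (hdis : IsDissipative m b f) {t₀ : ℝ} (ht₀ : 0 < t₀) (ht₁ : t₀ ≤ 1) (x : Space d) :
    f (t₀ • x) + m / 2 * (1 - t₀ ^ 2) * ‖x‖ ^ 2 + b * Real.log t₀ ≤ f x := by
  let ψ : ℝ → ℝ := fun t => f (t • x) - m / 2 * ‖x‖ ^ 2 * t ^ 2 + b * Real.log t
  have hψ : ∀ t, 0 < t → HasDerivAt ψ (fderiv ℝ f (t • x) x - m / 2 * ‖x‖ ^ 2 * (2 * t) +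
      b * t⁻¹) t := by
    intro t ht
    refine ((hasDerivAt_ray hf x t).sub ?_).add ((Real.hasDerivAt_log ht.ne').const_mul b)
    simpa using (hasDerivAt_pow 2 t).const_mul (m / 2 * ‖x‖ ^ 2)
  have hmono : MonotoneOn ψ (Set.Icc t₀ 1) := by
    refine monotoneOn_of_deriv_nonneg (convex_Icc t₀ 1)
      (fun t ht => (hψ t (ht₀.trans_le ht.1)).continuousAt.continuousWithinAt)
      (fun t ht => ?_) fun t ht => ?_
    · rw [interior_Icc] at ht
      exact (hψ t (ht₀.trans ht.1)).differentiableAt.differentiableWithinAt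
    · rw [interior_Icc] at ht
      have ht0 : 0 < t := ht₀.trans ht.1
      rw [(hψ t ht0).deriv]
      have h1 := hdis (t • x)
      rw [inner_gradient_eq, map_smul, smul_eq_mul, norm_smul, Real.norm_of_nonneg ht0.le] at h1
      have h2 : fderiv ℝ f (t • x) x - m / 2 * ‖x‖ ^ 2 * (2 * t) + b * t⁻¹ =
          (t * fderiv ℝ f (t • x) x - (m * (t * ‖x‖) ^ 2 - b)) / t := by
        field_simp; ring
      rw [h2]
      exact div_nonneg (by linarith) ht0.le
  have h := hmono (Set.left_mem_Icc.mpr ht₁) (Set.right_mem_Icc.mpr ht₁) ht₁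
  simp only [ψ, one_smul, Real.log_one] at h
  linarith

/-- The curvature constant of the quadratic bounds. -/
noncomputable def curvature (L b : ℝ) : ℝ := L + (b + L) ^ 2

/-- The offset of the quadratic lower bound. -/
noncomputable def offset (L m b : ℝ) : ℝ :=
  1 / 2 - b * Real.log (m / (2 * (m + curvature L b)))

lemma curvature_pos {L b : ℝ} (hL : 0 < L) : 0 < curvature L b := by
  unfold curvature; positivity

lemma offset_nonneg {L m b : ℝ} (hL : 0 < L) (hm : 0 < m) (hb : 0 ≤ b) : 0 ≤ offset L m b := by
  have hA := curvature_pos (b := b) hL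
  have : Real.log (m / (2 * (m + curvature L b))) ≤ 0 := by
    apply Real.log_nonpos (by positivity)
    rw [div_le_one (by positivity)]; linarith
  unfold offset
  nlinarith

/-- The linear term (b + L)‖x‖ of the descent estimate is absorbed by the arithmetic–geometric mean
inequality, which produces the 1/2 and the summand (b + L)² of `curvature`. -/
lemma isPinched_finiteAverage {N : ℕ} (hN : 0 < N) {L m b : ℝ} (hL : 0 < L) (hm : 0 < m)
    (hb : 0 ≤ b) {fs : Fin N → Space d → ℝ} (hs : IsSmoothFamily L fs)
    (hdis : IsDissipative m b (finiteAverage fs)) :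
    IsPinched (curvature L b) (m / 2) (offset L m b) (finiteAverage fs) := by
  set f := finiteAverage fs with hf
  have hdiff : Differentiable ℝ f := fun x => (hasFDerivAt_finiteAverage hs x).differentiableAt
  have hLip : ∀ x y, ‖fderiv ℝ f x - fderiv ℝ f y‖ ≤ L * ‖x - y‖ :=
    lipschitz_fderiv_finiteAverage hN hs
  have hG := norm_fderiv_zero_le hm.le hL.le hb hLip hdis
  have hquad : ∀ r : ℝ, (b + L) * r + L / 2 * r ^ 2 ≤ 1 / 2 + curvature L b / 2 * r ^ 2 := by
    intro r
    unfold curvature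
    nlinarith [sq_nonneg ((b + L) * r - 1)]
  have hge : ∀ x, f 0 - 1 / 2 - curvature L b / 2 * ‖x‖ ^ 2 ≤ f x := by
    intro x
    have h := sub_le_of_lipschitz_fderiv (f := fun x => -f x) (L := L) (G := b + L) hdiff.neg
      (fun x y => by
        simp only [fderiv_fun_neg]
        rw [← neg_sub', norm_neg]; exact hLip x y)
      (by simp only [fderiv_fun_neg, norm_neg]; exact hG) x
    have := hquad ‖x‖
    linarith
  have hA := curvature_pos (b := b) hL
  refine ⟨hdiff.continuous, fun x => ?_, hge, fun x => ?_⟩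
  · have h := sub_le_of_lipschitz_fderiv hdiff hLip hG x
    have := hquad ‖x‖
    linarith
  · set A := curvature L b
    -- Chosen so that A t₀² ≤ m/4: the lower bound at t₀x loses m/8 ‖x‖², the growth along the ray
    -- gains 3m/8 ‖x‖², and m/4 ‖x‖² = γ/2 ‖x‖² remains.
    set t₀ := m / (2 * (m + A)) with ht₀
    have ht0 : 0 < t₀ := by positivity
    have hthalf : t₀ ≤ 1 / 2 := by
      rw [ht₀, div_le_iff₀ (by positivity)]; linarith
    have htA : A * t₀ ≤ m / 2 := by
      rw [ht₀, mul_div_assoc', div_le_iff₀ (by positivity)]; nlinarith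
    have h1 := growth_of_dissipative hdiff hdis ht0 (by linarith) x
    have h2 := hge (t₀ • x)
    rw [norm_smul, Real.norm_of_nonneg ht0.le] at h2
    have h3 : A * t₀ ^ 2 ≤ m / 4 := by nlinarith
    have h4 : t₀ ^ 2 ≤ 1 / 4 := by nlinarith
    have h5 : A / 2 * (t₀ * ‖x‖) ^ 2 ≤ m / 8 * ‖x‖ ^ 2 := by
      have := mul_le_mul_of_nonneg_right h3 (sq_nonneg ‖x‖)
      rw [mul_pow]; linarith
    have h6 : 3 / 8 * m * ‖x‖ ^ 2 ≤ m / 2 * (1 - t₀ ^ 2) * ‖x‖ ^ 2 := by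
      apply mul_le_mul_of_nonneg_right _ (sq_nonneg _)
      nlinarith
    have h7 : offset L m b = 1 / 2 - b * Real.log t₀ := rfl
    rw [h7]
    linarith

end Smooth

end AnnealingSchedule

/-! ### The log-partition function -/

namespace AnnealingSchedule

open MeasureTheory ProbabilityTheory

variable {d : ℕ}

/-- The integral of `exp (-f - β‖x‖²/2)`. -/
noncomputable def partitionFun (f : Space d → ℝ) (β : ℝ) : ℝ :=
  ∫ x, Real.exp (-(f x + β * (‖x‖ ^ 2 / 2)))

/-- The logarithm of the partition function. -/
noncomputable def logPartition (f : Space d → ℝ) (β : ℝ) : ℝ := Real.log (partitionFun f β)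

/-- The measure with density `exp (-f)`. -/
noncomputable def boltzmannMeasure (f : Space d → ℝ) : Measure (Space d) :=
  volume.withDensity fun x => ENNReal.ofReal (Real.exp (-f x))

lemma integral_boltzmannMeasure {f : Space d → ℝ} (hf : Continuous f) (g : Space d → ℝ) :
    ∫ x, g x ∂(boltzmannMeasure f) = ∫ x, Real.exp (-f x) * g x := by
  rw [boltzmannMeasure, integral_withDensity_eq_integral_toReal_smul (by fun_prop)
    (Filter.Eventually.of_forall fun x => ENNReal.ofReal_lt_top)]
  refine integral_congr_ae (Filter.Eventually.of_forall fun x => ?_)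
  simp [ENNReal.toReal_ofReal (Real.exp_pos _).le]

lemma integrable_boltzmannMeasure {f : Space d → ℝ} (hf : Continuous f) (g : Space d → ℝ) :
    Integrable g (boltzmannMeasure f) ↔ Integrable fun x => Real.exp (-f x) * g x := by
  rw [boltzmannMeasure, integrable_withDensity_iff_integrable_smul' (by fun_prop)
    (Filter.Eventually.of_forall fun x => ENNReal.ofReal_lt_top)]
  refine integrable_congr (Filter.Eventually.of_forall fun x => ?_)
  simp [ENNReal.toReal_ofReal (Real.exp_pos _).le]

lemma exp_neg_mul_exp (f : Space d → ℝ) (β : ℝ) (x : Space d) :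
    Real.exp (-f x) * Real.exp (β * (-(‖x‖ ^ 2 / 2))) =
      Real.exp (-(f x + β * (‖x‖ ^ 2 / 2))) := by
  rw [← Real.exp_add]; congr 1; ring

lemma mgf_boltzmannMeasure {f : Space d → ℝ} (hf : Continuous f) (β : ℝ) :
    mgf (fun x => -(‖x‖ ^ 2 / 2)) (boltzmannMeasure f) β = partitionFun f β := by
  rw [mgf, integral_boltzmannMeasure hf]
  simp only [exp_neg_mul_exp, partitionFun]

/-- This identification supplies analyticity, the formula for the derivative, and convexity (the
second derivative is a variance) from the theory of cumulant generating functions. -/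
lemma cgf_boltzmannMeasure {f : Space d → ℝ} (hf : Continuous f) :
    cgf (fun x => -(‖x‖ ^ 2 / 2)) (boltzmannMeasure f) = logPartition f := by
  ext β
  rw [cgf, mgf_boltzmannMeasure hf, logPartition]

/-! ### Gaussian bounds -/

lemma integral_gaussian_space {β : ℝ} (hβ : 0 < β) :
    ∫ x : Space d, Real.exp (-(β * (‖x‖ ^ 2 / 2))) = (2 * Real.pi / β) ^ (d / 2 : ℝ) := by
  have h := GaussianFourier.integral_rexp_neg_mul_sq_norm (V := Space d) (half_pos hβ)
  rw [finrank_euclideanSpace, Fintype.card_fin] at h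
  rw [show 2 * Real.pi / β = Real.pi / (β / 2) by field_simp, ← h]
  congr 1; ext x; congr 1; ring

lemma integrable_gaussian_space {β : ℝ} (hβ : 0 < β) :
    Integrable fun x : Space d => Real.exp (-(β * (‖x‖ ^ 2 / 2))) := by
  by_contra hcon
  have h := integral_gaussian_space (d := d) hβ
  rw [integral_undef hcon] at h
  have : 0 < (2 * Real.pi / β) ^ (d / 2 : ℝ) := by positivity
  linarith

lemma integral_const_gaussian {β : ℝ} (hβ : 0 < β) (c : ℝ) :
    ∫ x : Space d, Real.exp (c - β * (‖x‖ ^ 2 / 2)) =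
      Real.exp c * (2 * Real.pi / β) ^ (d / 2 : ℝ) := by
  rw [← integral_gaussian_space hβ, ← integral_const_mul]
  congr 1; ext x; rw [← Real.exp_add]; congr 1

lemma integrable_const_gaussian {β : ℝ} (hβ : 0 < β) (c : ℝ) :
    Integrable fun x : Space d => Real.exp (c - β * (‖x‖ ^ 2 / 2)) := by
  refine ((integrable_gaussian_space hβ).const_mul (Real.exp c)).congr
    (Filter.Eventually.of_forall fun x => ?_)
  simp only
  rw [← Real.exp_add]; congr 1

lemma log_const_gaussian {β : ℝ} (hβ : 0 < β) (c : ℝ) :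
    Real.log (Real.exp c * (2 * Real.pi / β) ^ (d / 2 : ℝ)) =
      c + d / 2 * Real.log (2 * Real.pi / β) := by
  rw [Real.log_mul (Real.exp_pos _).ne' (by positivity), Real.log_exp, Real.log_rpow (by positivity)]

section Pinched

variable {A γ C : ℝ} {f : Space d → ℝ}

lemma IsPinched.integrable (hf : IsPinched A γ C f) {β : ℝ} (hβ : -γ < β) :
    Integrable fun x => Real.exp (-(f x + β * (‖x‖ ^ 2 / 2))) := by
  have hc := hf.continuous
  refine (integrable_const_gaussian (d := d) (show 0 < β + γ by linarith) (C - f 0)).mono'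
    (by fun_prop) (Filter.Eventually.of_forall fun x => ?_)
  rw [Real.norm_of_nonneg (Real.exp_pos _).le]
  apply Real.exp_le_exp.mpr
  have := hf.growth x
  nlinarith

lemma IsPinched.partitionFun_pos (hf : IsPinched A γ C f) {β : ℝ} (hβ : -γ < β) :
    0 < partitionFun f β :=
  integral_exp_pos (hf.integrable hβ)

lemma IsPinched.logPartition_le_growth (hf : IsPinched A γ C f) {β : ℝ} (hβ : -γ < β) :
    logPartition f β ≤ C - f 0 + d / 2 * Real.log (2 * Real.pi / (β + γ)) := by
  have hpos : 0 < β + γ := by linarith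
  rw [← log_const_gaussian hpos, ← integral_const_gaussian hpos]
  refine Real.log_le_log (hf.partitionFun_pos hβ) (integral_mono (hf.integrable hβ)
    (integrable_const_gaussian hpos _) fun x => Real.exp_le_exp.mpr ?_)
  have := hf.growth x
  nlinarith

lemma IsPinched.logPartition_le (hf : IsPinched A γ C f) {β : ℝ} (hβ : -γ < β) (hA : A < β) :
    logPartition f β ≤ 1 / 2 - f 0 + d / 2 * Real.log (2 * Real.pi / (β - A)) := by
  have hpos : 0 < β - A := by linarith
  rw [← log_const_gaussian hpos, ← integral_const_gaussian hpos]
  refine Real.log_le_log (hf.partitionFun_pos hβ) (integral_mono (hf.integrable hβ)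
    (integrable_const_gaussian hpos _) fun x => Real.exp_le_exp.mpr ?_)
  have := hf.ge x
  nlinarith

lemma IsPinched.le_logPartition (hf : IsPinched A γ C f) {β : ℝ} (hβ : -γ < β) (hA : 0 < β + A) :
    -1 / 2 - f 0 + d / 2 * Real.log (2 * Real.pi / (β + A)) ≤ logPartition f β := by
  rw [← log_const_gaussian hA, ← integral_const_gaussian hA]
  refine Real.log_le_log ?_ (integral_mono (integrable_const_gaussian hA _) (hf.integrable hβ)
    fun x => Real.exp_le_exp.mpr ?_)
  · rw [integral_const_gaussian hA]; positivity
  · have := hf.le x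
    nlinarith

lemma IsPinched.mem_interior (hf : IsPinched A γ C f) {β : ℝ} (hβ : -γ < β) :
    β ∈ interior (integrableExpSet (fun x => -(‖x‖ ^ 2 / 2)) (boltzmannMeasure f)) := by
  refine interior_maximal (s := integrableExpSet (fun x => -(‖x‖ ^ 2 / 2)) (boltzmannMeasure f))
    (t := Set.Ioi (-γ)) (fun s hs => ?_) isOpen_Ioi hβ
  change Integrable _ _
  rw [integrable_boltzmannMeasure hf.continuous]
  simp only [exp_neg_mul_exp]
  exact hf.integrable hs

lemma IsPinched.analyticOnNhd (hf : IsPinched A γ C f) :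
    AnalyticOnNhd ℝ (logPartition f) (Set.Ioi (-γ)) := by
  rw [← cgf_boltzmannMeasure hf.continuous]
  exact fun β hβ => analyticAt_cgf (hf.mem_interior hβ)

lemma IsPinched.hasDerivAt (hf : IsPinched A γ C f) {β : ℝ} (hβ : -γ < β) :
    HasDerivAt (logPartition f) (deriv (logPartition f) β) β :=
  (hf.analyticOnNhd β hβ).differentiableAt.hasDerivAt

lemma IsPinched.continuousOn_deriv (hf : IsPinched A γ C f) :
    ContinuousOn (deriv (logPartition f)) (Set.Ioi (-γ)) :=
  hf.analyticOnNhd.deriv.continuousOn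

lemma IsPinched.convexOn (hf : IsPinched A γ C f) :
    ConvexOn ℝ (Set.Ioi (-γ)) (logPartition f) := by
  refine convexOn_of_deriv2_nonneg' (convex_Ioi _)
    hf.analyticOnNhd.differentiableOn hf.analyticOnNhd.deriv.differentiableOn fun β hβ => ?_
  rw [← iteratedDeriv_eq_iterate, ← cgf_boltzmannMeasure hf.continuous,
    iteratedDeriv_two_cgf_eq_integral (hf.mem_interior hβ)]
  exact div_nonneg (integral_nonneg fun x => by positivity) mgf_nonneg

lemma IsPinched.deriv_eq (hf : IsPinched A γ C f) {β : ℝ} (hβ : -γ < β) :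
    deriv (logPartition f) β =
      -(∫ x, ‖x‖ ^ 2 / 2 * Real.exp (-(f x + β * (‖x‖ ^ 2 / 2)))) / partitionFun f β := by
  rw [← cgf_boltzmannMeasure hf.continuous, deriv_cgf (hf.mem_interior hβ),
    mgf_boltzmannMeasure hf.continuous, integral_boltzmannMeasure hf.continuous, ← integral_neg]
  congr 2
  ext x
  rw [← exp_neg_mul_exp]; ring

lemma IsPinched.integrable_sq (hf : IsPinched A γ C f) {β : ℝ} (hβ : -γ < β) :
    Integrable fun x => ‖x‖ ^ 2 / 2 * Real.exp (-(f x + β * (‖x‖ ^ 2 / 2))) := by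
  have h := integrable_pow_mul_exp_of_mem_interior_integrableExpSet (hf.mem_interior hβ) 1
  rw [integrable_boltzmannMeasure hf.continuous] at h
  refine h.neg.congr (Filter.Eventually.of_forall fun x => ?_)
  simp only [Pi.neg_apply]
  rw [← exp_neg_mul_exp]; ring

lemma IsPinched.deriv_nonpos (hf : IsPinched A γ C f) {β : ℝ} (hβ : -γ < β) :
    deriv (logPartition f) β ≤ 0 := by
  rw [hf.deriv_eq hβ, neg_div, neg_nonpos]
  exact div_nonneg (integral_nonneg fun x => by positivity) (hf.partitionFun_pos hβ).le

/-- The graph lies above its tangents. -/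
lemma IsPinched.tangent_le (hf : IsPinched A γ C f) {β s : ℝ} (hβ : -γ < β) (hs : -γ < s) :
    logPartition f β + deriv (logPartition f) β * (s - β) ≤ logPartition f s := by
  rcases lt_trichotomy β s with h | rfl | h
  · have := hf.convexOn.le_slope_of_hasDerivAt hβ hs h (hf.hasDerivAt hβ)
    rw [slope_def_field, le_div_iff₀ (by linarith)] at this
    linarith
  · simp
  · have := hf.convexOn.slope_le_of_hasDerivAt hs hβ h (hf.hasDerivAt hβ)
    rw [slope_def_field, div_le_iff₀ (by linarith)] at this
    linarith

end Pinched

end AnnealingSchedule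

/-! ### Subdividing a convex function into steps of bounded midpoint gap -/

namespace AnnealingSchedule

open MeasureTheory

/-- Average the tangent inequalities at a and at b, both evaluated at the midpoint. -/
lemma midpoint_gap_le {F F' : ℝ → ℝ} {a b : ℝ} {S : Set ℝ} (hS : Convex ℝ S)
    (htan : ∀ x ∈ S, ∀ y ∈ S, F x + F' x * (y - x) ≤ F y) (ha : a ∈ S) (hb : b ∈ S) :
    (F a + F b) / 2 - F ((a + b) / 2) ≤ (b - a) / 4 * (F' b - F' a) := by
  have hm : (a + b) / 2 ∈ S := by
    have := hS ha hb (a := 1 / 2) (b := 1 / 2) (by norm_num) (by norm_num) (by norm_num)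
    simp only [smul_eq_mul] at this
    convert this using 1; ring
  have h1 := htan a ha _ hm
  have h2 := htan b hb _ hm
  linarith

/-- A convex function on `[s₀, s₁]` has a subdivision whose number of steps is governed by
`log (s₁ / s₀)` and the variation of `β ↦ β F'(β) - F(β)`, and all of whose midpoint gaps are at
most `1`. -/
lemma exists_subdivision {F F' : ℝ → ℝ} {s₀ s₁ W : ℝ} (h0 : 0 < s₀) (h01 : s₀ < s₁)
    (htan : ∀ x ∈ Set.Icc s₀ s₁, ∀ y ∈ Set.Icc s₀ s₁, F x + F' x * (y - x) ≤ F y)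
    (hFc : ContinuousOn F (Set.Icc s₀ s₁)) (hF'c : ContinuousOn F' (Set.Icc s₀ s₁)) (hW : 0 < W)
    (hΨ : (s₁ * F' s₁ - F s₁) - (s₀ * F' s₀ - F s₀) ≤ W) (N : ℕ)
    (hN1 : 2 * Real.log (s₁ / s₀) ≤ N) (hN2 : 2 * Real.log (s₁ / s₀) * W ≤ N ^ 2) :
    ∃ β : ℕ → ℝ, β 0 = s₁ ∧ β N = s₀ ∧ (∀ i ≤ N, β i ∈ Set.Icc s₀ s₁) ∧
      (∀ i < N, β (i + 1) < β i) ∧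
      ∀ i < N, (F (β (i + 1)) + F (β i)) / 2 - F ((β (i + 1) + β i) / 2) ≤ 1 := by
  set ℓ := Real.log (s₁ / s₀) with hℓ
  have hℓ0 : 0 < ℓ := Real.log_pos (by rw [lt_div_iff₀ h0]; linarith)
  have hN : (0 : ℝ) < N := by linarith
  let Ψ : ℝ → ℝ := fun x => x * F' x - F x
  -- The difference of the two sides is F a - F b - F' b (a - b), the height of F at a above the
  -- tangent at b.
  have hΨstep : ∀ a ∈ Set.Icc s₀ s₁, ∀ b ∈ Set.Icc s₀ s₁, a * (F' b - F' a) ≤ Ψ b - Ψ a := by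
    intro a ha b hb
    have := htan b hb a ha
    simp only [Ψ]; linarith
  have hF'mono : ∀ a ∈ Set.Icc s₀ s₁, ∀ b ∈ Set.Icc s₀ s₁, a < b → F' a ≤ F' b := by
    intro a ha b hb hab
    have h1 := htan b hb a ha
    have h2 := htan a ha b hb
    have : 0 ≤ (F' b - F' a) * (b - a) := by linarith
    nlinarith
  have hΨmono : ∀ a ∈ Set.Icc s₀ s₁, ∀ b ∈ Set.Icc s₀ s₁, a < b → Ψ a ≤ Ψ b := by
    intro a ha b hb hab
    have h1 := hΨstep a ha b hb
    have h2 := mul_nonneg (h0.le.trans ha.1) (sub_nonneg.mpr (hF'mono a ha b hb hab))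
    linarith
  -- Both summands increase and vary by at most 1 in total, so cutting the range of Φ evenly bounds
  -- the relative step and the increment of Ψ at the same time.
  let Φ : ℝ → ℝ := fun x => Real.log x / ℓ + Ψ x / W
  have hΦmono : StrictMonoOn Φ (Set.Icc s₀ s₁) := by
    intro a ha b hb hab
    have h1 : Real.log a < Real.log b := Real.log_lt_log (h0.trans_le ha.1) hab
    have h2 := hΨmono a ha b hb hab
    have h3 := div_lt_div_of_pos_right h1 hℓ0
    have h4 := div_le_div_of_nonneg_right h2 hW.le
    simp only [Φ]; linarith
  have hΦc : ContinuousOn Φ (Set.Icc s₀ s₁) := by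
    refine ContinuousOn.add ((Real.continuousOn_log.mono fun x hx => ?_).div_const _)
      (((continuousOn_id.mul hF'c).sub hFc).div_const _)
    exact (h0.trans_le hx.1).ne'
  have hleft : s₀ ∈ Set.Icc s₀ s₁ := Set.left_mem_Icc.mpr h01.le
  have hright : s₁ ∈ Set.Icc s₀ s₁ := Set.right_mem_Icc.mpr h01.le
  set τ := Φ s₁ - Φ s₀ with hτ
  have hτ0 : 0 < τ := sub_pos.mpr (hΦmono hleft hright h01)
  have hτ2 : τ ≤ 2 := by
    have h1 : (Real.log s₁ - Real.log s₀) / ℓ = 1 := by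
      rw [← Real.log_div (h0.trans h01).ne' h0.ne', div_self hℓ0.ne']
    have h2 : (Ψ s₁ - Ψ s₀) / W ≤ 1 := by rw [div_le_one hW]; exact hΨ
    have h3 : τ = (Real.log s₁ - Real.log s₀) / ℓ + (Ψ s₁ - Ψ s₀) / W := by
      simp only [hτ, Φ]; ring
    linarith
  have hex : ∀ i : ℕ, ∃ x, i ≤ N → x ∈ Set.Icc s₀ s₁ ∧ Φ x = Φ s₁ - τ * i / N := by
    intro i
    by_cases hi : i ≤ N
    · have hi' : (i : ℝ) ≤ N := by exact_mod_cast hi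
      have h1 : τ * i / N ≤ τ := by rw [div_le_iff₀ hN]; nlinarith
      have h2 : 0 ≤ τ * i / N := by positivity
      obtain ⟨x, hx, hx'⟩ := intermediate_value_Icc h01.le hΦc
        (show Φ s₁ - τ * i / N ∈ Set.Icc (Φ s₀) (Φ s₁) by constructor <;> linarith)
      exact ⟨x, fun _ => ⟨hx, hx'⟩⟩
    · exact ⟨0, fun h => absurd h hi⟩
  choose β hβ using hex
  have hanti : ∀ i < N, β (i + 1) < β i := by
    intro i hi
    obtain ⟨h1, h2⟩ := hβ i hi.le
    obtain ⟨h3, h4⟩ := hβ (i + 1) hi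
    rw [← hΦmono.lt_iff_lt h3 h1, h2, h4]
    have : τ * i / N < τ * (i + 1 : ℕ) / N := by
      gcongr; linarith
    linarith
  refine ⟨β, ?_, ?_, fun i hi => (hβ i hi).1, hanti, fun i hi => ?_⟩
  · obtain ⟨h1, h2⟩ := hβ 0 (Nat.zero_le _)
    exact hΦmono.injOn h1 hright (by rw [h2]; simp)
  · obtain ⟨h1, h2⟩ := hβ N le_rfl
    refine hΦmono.injOn h1 hleft ?_
    rw [h2, mul_div_assoc, div_self hN.ne', hτ]; ring
  · obtain ⟨h1, h2⟩ := hβ i hi.le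
    obtain ⟨h3, h4⟩ := hβ (i + 1) hi
    have hlt := hanti i hi
    set a := β (i + 1)
    set b := β i
    have ha0 : 0 < a := h0.trans_le h3.1
    have hΔ : Φ b - Φ a = τ / N := by rw [h2, h4]; push_cast; field_simp; ring
    have hΔ2 : Φ b - Φ a ≤ 2 / N := by rw [hΔ]; gcongr
    have hlog0 : 0 < Real.log b - Real.log a := sub_pos.mpr (Real.log_lt_log ha0 hlt)
    have hψ0 : 0 ≤ Ψ b - Ψ a := sub_nonneg.mpr (hΨmono a h3 b h1 hlt)
    have hsplit : Φ b - Φ a = (Real.log b - Real.log a) / ℓ + (Ψ b - Ψ a) / W := by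
      simp only [Φ]; ring
    have hlogle : Real.log b - Real.log a ≤ 2 * ℓ / N := by
      have : (Real.log b - Real.log a) / ℓ ≤ 2 / N := by
        have := div_nonneg hψ0 hW.le; linarith
      rw [div_le_iff₀ hℓ0] at this
      linarith [this, show 2 / (N : ℝ) * ℓ = 2 * ℓ / N by ring]
    have hψle : Ψ b - Ψ a ≤ 2 * W / N := by
      have : (Ψ b - Ψ a) / W ≤ 2 / N := by
        have := div_nonneg hlog0.le hℓ0.le; linarith
      rw [div_le_iff₀ hW] at this
      linarith [this, show 2 / (N : ℝ) * W = 2 * W / N by ring]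
    have hlog1 : Real.log b - Real.log a ≤ 1 :=
      hlogle.trans (by rw [div_le_one hN]; exact hN1)
    -- The logarithmic step is at most 1, so exp(t) - 1 ≤ 2t turns it into a relative step.
    have hba : b - a ≤ a * (2 * (2 * ℓ / N)) := by
      have h5 : Real.exp (Real.log b - Real.log a) = b / a := by
        rw [Real.exp_sub, Real.exp_log (ha0.trans hlt), Real.exp_log ha0]
      have h6 := Real.abs_exp_sub_one_le (x := Real.log b - Real.log a)
        (by rw [abs_of_pos hlog0]; exact hlog1)
      rw [h5, abs_of_pos hlog0] at h6
      have h7 := (le_abs_self _).trans h6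
      have h8 : b / a - 1 = (b - a) / a := by field_simp
      rw [h8, div_le_iff₀ ha0] at h7
      nlinarith
    have hF' : 0 ≤ F' b - F' a := sub_nonneg.mpr (hF'mono a h3 b h1 hlt)
    calc (F a + F b) / 2 - F ((a + b) / 2) ≤ (b - a) / 4 * (F' b - F' a) :=
          midpoint_gap_le (convex_Icc s₀ s₁) htan h3 h1
      _ ≤ a * (2 * (2 * ℓ / N)) / 4 * (F' b - F' a) := by gcongr
      _ = ℓ / N * (a * (F' b - F' a)) := by ring
      _ ≤ ℓ / N * (2 * W / N) := by
          gcongr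
          exact (hΨstep a h3 b h1).trans hψle
      _ = 2 * ℓ * W / N ^ 2 := by field_simp
      _ ≤ 1 := by rw [div_le_one (by positivity)]; exact hN2

variable {d : ℕ} {A γ C : ℝ} {f : Space d → ℝ}

/-! ### Overlaps -/

lemma braket_coherentState_gibbsDensity (V V' : Space d → ℝ) (hV : 0 < ∫ y, Real.exp (-V y))
    (hV' : 0 < ∫ y, Real.exp (-V' y)) :
    ‖braket (coherentState (gibbsDensity V)) (coherentState (gibbsDensity V'))‖ =
      (∫ x, Real.exp (-((V x + V' x) / 2))) /
        (Real.sqrt (∫ y, Real.exp (-V y)) * Real.sqrt (∫ y, Real.exp (-V' y))) := by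
  have hpt : ∀ x, (starRingEnd ℂ) (coherentState (gibbsDensity V) x) *
      coherentState (gibbsDensity V') x = ((Real.exp (-((V x + V' x) / 2)) /
        (Real.sqrt (∫ y, Real.exp (-V y)) * Real.sqrt (∫ y, Real.exp (-V' y))) : ℝ) : ℂ) := by
    intro x
    rw [coherentState, coherentState, Complex.conj_ofReal, ← Complex.ofReal_mul]
    congr 1
    rw [gibbsDensity, gibbsDensity, Real.sqrt_div (Real.exp_pos _).le,
      Real.sqrt_div (Real.exp_pos _).le, div_mul_div_comm, ← Real.exp_half, ← Real.exp_half,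
      ← Real.exp_add]
    congr 2; ring
  rw [braket]
  simp only [hpt]
  rw [integral_complex_ofReal, Complex.norm_real, integral_div, Real.norm_of_nonneg]
  exact div_nonneg (integral_nonneg fun x => (Real.exp_pos _).le) (by positivity)

lemma exp_neg_one_le_overlap {a b c : ℝ} (ha : 0 < a) (hb : 0 < b) (hc : 0 < c)
    (h : (Real.log a + Real.log b) / 2 - Real.log c ≤ 1) :
    Real.exp (-1) ≤ c / (Real.sqrt a * Real.sqrt b) := by
  have hsa := Real.sqrt_pos.mpr ha
  have hsb := Real.sqrt_pos.mpr hb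
  rw [← Real.log_le_log_iff (Real.exp_pos _) (by positivity), Real.log_exp,
    Real.log_div hc.ne' (by positivity), Real.log_mul hsa.ne' hsb.ne', Real.log_sqrt ha.le,
    Real.log_sqrt hb.le]
  linarith

lemma IsPinched.overlap (hf : IsPinched A γ C f) {s t : ℝ} (hs : -γ < s) (ht : -γ < t)
    (hgap : (logPartition f s + logPartition f t) / 2 - logPartition f ((s + t) / 2) ≤ 1) :
    Real.exp (-1) ≤ ‖braket
      (coherentState (gibbsDensity fun x : Space d => f x + s * (‖x‖ ^ 2 / 2)))
      (coherentState (gibbsDensity fun x : Space d => f x + t * (‖x‖ ^ 2 / 2)))‖ := by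
  have h1 := hf.partitionFun_pos hs
  have h2 := hf.partitionFun_pos ht
  have h3 := hf.partitionFun_pos (β := (s + t) / 2) (by linarith)
  rw [braket_coherentState_gibbsDensity _ _ h1 h2]
  have h4 : (∫ x, Real.exp (-((f x + s * (‖x‖ ^ 2 / 2) + (f x + t * (‖x‖ ^ 2 / 2))) / 2))) =
      partitionFun f ((s + t) / 2) := by
    rw [partitionFun]; congr 1; ext x; congr 1; ring
  rw [h4]
  exact exp_neg_one_le_overlap h1 h2 h3 hgap

/-- At β = 4Ad the factor exp(-f) changes the Gaussian curvature by a relative amount of order 1/d.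
The additive 1/2 of the pinching costs 1/2 in the gap, and the ratio of the Gaussian determinants
costs at most another 1/2. -/
lemma IsPinched.initial_overlap (hf : IsPinched A γ C f) (hd : 0 < d) (hA : 0 < A) (hγ : 0 < γ) :
    Real.exp (-1) ≤ ‖braket
      (coherentState (gibbsDensity fun x : Space d => 4 * A * d * (‖x‖ ^ 2 / 2)))
      (coherentState (gibbsDensity fun x : Space d => f x + 4 * A * d * (‖x‖ ^ 2 / 2)))‖ := by
  have hd1 : (1 : ℝ) ≤ d := by exact_mod_cast hd
  set s := 4 * A * d with hs
  have hs0 : 0 < s := by positivity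
  have hsA : A < s := by rw [hs]; nlinarith
  have h1 : 0 < ∫ x : Space d, Real.exp (-(s * (‖x‖ ^ 2 / 2))) := by
    rw [integral_gaussian_space hs0]; positivity
  have h2 := hf.partitionFun_pos (β := s) (by linarith)
  have hsA2 : 0 < s + A / 2 := by positivity
  have hlow := integral_const_gaussian (d := d) hsA2 (-(f 0) / 2 - 1 / 4)
  have hlower : Real.exp (-(f 0) / 2 - 1 / 4) * (2 * Real.pi / (s + A / 2)) ^ (d / 2 : ℝ) ≤
      ∫ x, Real.exp (-((s * (‖x‖ ^ 2 / 2) + (f x + s * (‖x‖ ^ 2 / 2))) / 2)) := by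
    rw [← hlow]
    refine integral_mono (integrable_const_gaussian hsA2 _) ?_ fun x => Real.exp_le_exp.mpr ?_
    · have hc := hf.continuous
      refine (integrable_const_gaussian (d := d) (show 0 < s - A / 2 by linarith)
        (1 / 4 - f 0 / 2)).mono' (by fun_prop) (Filter.Eventually.of_forall fun x => ?_)
      rw [Real.norm_of_nonneg (Real.exp_pos _).le]
      apply Real.exp_le_exp.mpr
      have := hf.ge x
      nlinarith
    · have := hf.le x
      nlinarith
  have hc : 0 < ∫ x, Real.exp (-((s * (‖x‖ ^ 2 / 2) + (f x + s * (‖x‖ ^ 2 / 2))) / 2)) :=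
    lt_of_lt_of_le (by positivity) hlower
  rw [braket_coherentState_gibbsDensity _ _ h1 h2]
  refine exp_neg_one_le_overlap h1 h2 hc ?_
  have h3 := Real.log_le_log (by positivity) hlower
  rw [log_const_gaussian hsA2] at h3
  have h4 := hf.logPartition_le (β := s) (by linarith) hsA
  rw [logPartition, partitionFun] at h4
  rw [integral_gaussian_space hs0, Real.log_rpow (by positivity)]
  have hpi : (0 : ℝ) < 2 * Real.pi := by positivity
  rw [Real.log_div hpi.ne' hsA2.ne'] at h3
  rw [Real.log_div hpi.ne' (by linarith : s - A ≠ 0)] at h4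
  rw [Real.log_div hpi.ne' hs0.ne']
  -- The first-order terms in A/s do not cancel, so this is of order 1/d, which the prefactor d/4
  -- from the Gaussian integrals turns into a constant.
  have hkey : -(2 / (d : ℝ)) ≤ Real.log s + Real.log (s - A) - 2 * Real.log (s + A / 2) := by
    have hlog := Real.one_sub_inv_le_log_of_pos
      (show 0 < s * (s - A) / (s + A / 2) ^ 2 from div_pos (mul_pos hs0 (by linarith)) (by positivity))
    rw [Real.log_div (mul_pos hs0 (by linarith)).ne' (by positivity), Real.log_mul hs0.ne'
      (by linarith : s - A ≠ 0), Real.log_pow, inv_div] at hlog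
    refine le_trans ?_ (hlog.trans_eq (by push_cast; ring))
    have h5 : (s + A / 2) ^ 2 / (s * (s - A)) ≤ 1 + 2 / d := by
      rw [div_le_iff₀ (mul_pos hs0 (by linarith)), hs]
      have : (1 + 2 / (d : ℝ)) * (4 * A * d * (4 * A * d - A)) =
          A ^ 2 * ((d + 2) * (4 * (4 * d - 1))) := by field_simp
      rw [this]
      have : (4 * A * d + A / 2) ^ 2 = A ^ 2 * (4 * d + 1 / 2) ^ 2 := by ring
      rw [this]
      gcongr
      nlinarith
    linarith
  have hkey2 : -(1 / 2) ≤ (d : ℝ) / 4 *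
      (Real.log s + Real.log (s - A) - 2 * Real.log (s + A / 2)) := by
    have := mul_le_mul_of_nonneg_left hkey (show (0 : ℝ) ≤ (d : ℝ) / 4 by positivity)
    have h6 : (d : ℝ) / 4 * -(2 / d) = -(1 / 2) := by field_simp; norm_num
    linarith
  linarith

end AnnealingSchedule

namespace AnnealingSchedule

open MeasureTheory

variable {d : ℕ} {A γ C : ℝ} {f : Space d → ℝ}

/-! ### The log-Sobolev constant is bounded in terms of the curvature -/

lemma norm_sq_gradient_gaussian (β a : ℝ) (x : Space d) :
    ‖gradient (fun x : Space d => a * Real.exp (-(β * (‖x‖ ^ 2 / 2)))) x‖ ^ 2 =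
      (β * (a * Real.exp (-(β * (‖x‖ ^ 2 / 2))))) ^ 2 * ‖x‖ ^ 2 := by
  have h1 : HasFDerivAt (fun x : Space d => ‖x‖ ^ 2) (2 • innerSL ℝ x) x :=
    (hasStrictFDerivAt_norm_sq x).hasFDerivAt
  have h2 : HasFDerivAt (fun x : Space d => -(β * (‖x‖ ^ 2 / 2)))
      ((-(β / 2)) • (2 • innerSL ℝ x)) x := by
    refine (h1.const_mul (-(β / 2))).congr_of_eventuallyEq (Filter.Eventually.of_forall fun y => ?_)
    ring
  have h3 := (h2.exp).const_mul a
  rw [gradient, LinearIsometryEquiv.norm_map, h3.fderiv, norm_smul, norm_smul, norm_smul,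
    two_smul, ← two_smul ℝ, norm_smul, innerSL_apply_norm]
  simp only [Real.norm_eq_abs, mul_pow, sq_abs]
  ring

/-- The test function g is the density of the Gibbs measure at parameter β with respect to the
target. With E its mean of ‖x‖²/2, the entropy is F(0) - F(β) - βE and the inequality reads entropy
≤ β²E/c. For a fixed large multiple β of A the entropy is at least d while βE ≤ 4d, which forces c ≤
4β. -/
lemma IsPinched.lsi_le (hf : IsPinched A γ C f) (hd : 0 < d) (hA : 0 < A) (hγ : 0 < γ) {c : ℝ}
    (hc : 0 < c) (hlsi : SatisfiesLSI (gibbsDensity f) c) :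
    c ≤ 4 * (A * (1 + Real.exp 12)) := by
  have hd1 : (1 : ℝ) ≤ d := by exact_mod_cast hd
  have he : (13 : ℝ) ≤ Real.exp 12 := by linarith [Real.add_one_le_exp (12 : ℝ)]
  set β := A * (1 + Real.exp 12) with hβ
  have hβA : β - A = A * Real.exp 12 := by rw [hβ]; ring
  have hβ14 : 14 * A ≤ β := by rw [hβ]; nlinarith
  have hβ0 : -γ < β := by linarith
  have h00 : -γ < 0 := by linarith
  have hfc := hf.continuous
  set Z₀ := partitionFun f 0 with hZ₀
  set Zβ := partitionFun f β with hZβ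
  have hZ₀pos : 0 < Z₀ := hf.partitionFun_pos h00
  have hZβpos : 0 < Zβ := hf.partitionFun_pos hβ0
  have hZ₀eq : ∫ y, Real.exp (-f y) = Z₀ := by
    rw [hZ₀, partitionFun]; simp
  set a := Z₀ / Zβ with ha
  have hapos : 0 < a := div_pos hZ₀pos hZβpos
  set w : Space d → ℝ := fun x => Real.exp (-(f x + β * (‖x‖ ^ 2 / 2))) with hw
  have hwI : Integrable w := hf.integrable hβ0
  have hrI : Integrable fun x => ‖x‖ ^ 2 / 2 * w x := hf.integrable_sq hβ0
  have hwint : ∫ x, w x = Zβ := rfl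
  set S := ∫ x, ‖x‖ ^ 2 / 2 * w x with hS
  let g : Space d → ℝ := fun x => a * Real.exp (-(β * (‖x‖ ^ 2 / 2)))
  have hgpos : ∀ x, 0 < g x := fun x => mul_pos hapos (Real.exp_pos _)
  have hgν : ∀ x, g x * gibbsDensity f x = w x / Zβ := by
    intro x
    simp only [g, gibbsDensity, hZ₀eq, hw, ha]
    rw [neg_add, Real.exp_add]
    field_simp
  have hlogg : ∀ x, Real.log (g x) = Real.log a - β * (‖x‖ ^ 2 / 2) := by
    intro x
    simp only [g]
    rw [Real.log_mul hapos.ne' (Real.exp_pos _).ne', Real.log_exp]; ring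
  have hent : ∀ x, g x * Real.log (g x) * gibbsDensity f x =
      Real.log a / Zβ * w x - β / Zβ * (‖x‖ ^ 2 / 2 * w x) := by
    intro x
    rw [mul_right_comm, hgν, hlogg]; ring
  have hfis : ∀ x, ‖gradient g x‖ ^ 2 / g x * gibbsDensity f x =
      2 * β ^ 2 / Zβ * (‖x‖ ^ 2 / 2 * w x) := by
    intro x
    have h1 : ‖gradient g x‖ ^ 2 / g x = β ^ 2 * ‖x‖ ^ 2 * g x := by
      rw [show ‖gradient g x‖ ^ 2 = (β * g x) ^ 2 * ‖x‖ ^ 2 from norm_sq_gradient_gaussian β a x]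
      have := (hgpos x).ne'
      field_simp
    rw [h1, mul_assoc, hgν]; ring
  have hsmooth : ContDiff ℝ ((⊤ : ℕ∞) : WithTop ℕ∞) g := by
    refine contDiff_const.mul (Real.contDiff_exp.comp ?_)
    exact (contDiff_const.mul ((contDiff_norm_sq ℝ).div_const 2)).neg
  have key := hlsi g hsmooth hgpos (by simp only [hgν]; exact hwI.div_const _)
    (by simp only [hgν]; rw [integral_div, hwint, div_self hZβpos.ne'])
    (by simp only [hent]; exact (hwI.const_mul _).sub (hrI.const_mul _))
    (by simp only [hfis]; exact hrI.const_mul _)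
  simp only [hent, hfis] at key
  rw [integral_sub (hwI.const_mul _) (hrI.const_mul _), integral_const_mul, integral_const_mul,
    integral_const_mul, hwint, ← hS, div_mul_cancel₀ _ hZβpos.ne', ha,
    Real.log_div hZ₀pos.ne' hZβpos.ne'] at key
  set E := S / Zβ with hE
  have hderiv : deriv (logPartition f) β = -E := by
    rw [hf.deriv_eq hβ0, neg_div]
  have hpi : (0 : ℝ) < 2 * Real.pi := by positivity
  have htan := hf.tangent_le hβ0 (s := β / 2) (by linarith)
  rw [hderiv] at htan
  have hup := hf.logPartition_le (β := β / 2) (by linarith) (by linarith)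
  have hlow := hf.le_logPartition hβ0 (by linarith)
  have hlow0 := hf.le_logPartition h00 (by linarith)
  have hupβ := hf.logPartition_le hβ0 (by linarith)
  rw [Real.log_div hpi.ne' (by linarith : β / 2 - A ≠ 0)] at hup
  rw [Real.log_div hpi.ne' (by linarith : β + A ≠ 0)] at hlow
  rw [zero_add, Real.log_div hpi.ne' hA.ne'] at hlow0
  rw [hβA, Real.log_div hpi.ne' (by positivity), Real.log_mul hA.ne' (Real.exp_pos _).ne',
    Real.log_exp] at hupβ
  have hlog3 : Real.log (β + A) - Real.log (β / 2 - A) ≤ 2 := by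
    rw [← Real.log_div (by linarith) (by linarith)]
    refine (Real.log_le_sub_one_of_pos (div_pos (by linarith) (by linarith))).trans ?_
    have : (β + A) / (β / 2 - A) ≤ 3 := by
      rw [div_le_iff₀ (by linarith)]; linarith
    linarith
  -- E = -F'(β), and the tangent at β evaluated at β/2 gives βE/2 ≤ F(β/2) - F(β) ≤ 1 + d.
  have hβE : β * E ≤ 4 * d := by
    have := mul_le_mul_of_nonneg_left hlog3 (show (0 : ℝ) ≤ (d : ℝ) / 2 by positivity)
    nlinarith
  -- Since β - A = A exp 12, F(0) - F(β) ≥ 6d - 1; subtracting 4d leaves at least d.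
  have hkl : (d : ℝ) ≤ logPartition f 0 - logPartition f β - β * E := by nlinarith
  have hkey : logPartition f 0 - logPartition f β - β * E ≤ β * (β * E) / c := by
    have h1 : 1 / (2 * c) * (2 * β ^ 2 / Zβ * S) = β * (β * E) / c := by
      rw [hE]; field_simp
    have h2 : β / Zβ * S = β * E := by rw [hE]; ring
    rw [h1, h2] at key
    exact key
  have hfin : (d : ℝ) ≤ β * (4 * d) / c := by
    refine (hkl.trans hkey).trans ?_
    gcongr
  rw [le_div_iff₀ hc] at hfin
  nlinarith

/-! ### The schedule -/

-- B is fixed before d and f, so the length bound is uniform in both. Here W bounds F(0) - F(4Ad),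
-- which dominates the variation of βF' - F, and N is of order ℓ + √(ℓW).
set_option maxHeartbeats 1000000 in
lemma IsPinched.exists_schedule (hA : 0 < A) (hγ : 0 < γ) (hC : 0 ≤ C) :
    ∃ B : ℝ, ∀ (d : ℕ), 0 < d → ∀ f : Space d → ℝ, IsPinched A γ C f →
      ∃ (N : ℕ) (β : ℕ → ℝ), 0 < N ∧ (N : ℝ) + 2 ≤ B * (Real.sqrt d * (1 + Real.log d)) ∧
        β 0 = 4 * A * d ∧ (∀ i ≤ N, 0 < β i) ∧ (∀ i < N, β (i + 1) < β i) ∧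
        (∀ i < N, (logPartition f (β (i + 1)) + logPartition f (β i)) / 2 -
          logPartition f ((β (i + 1) + β i) / 2) ≤ 1) ∧
        (logPartition f (β N) + logPartition f 0) / 2 - logPartition f ((β N + 0) / 2) ≤ 1 := by
  set κ := C + 1 / 2 + |Real.log (2 * A / γ)| with hκ
  have hκ0 : 0 < κ := by positivity
  -- The first entry makes the last step, from c₀/d to 0, have gap at most 1; the second keeps c₀/d
  -- below the starting value 4Ad.
  set c₀ := min (γ / κ) A with hc₀
  have hc₀pos : 0 < c₀ := lt_min (by positivity) hA
  set C₂ := C + 1 / 2 + |Real.log (5 * A / γ)| + 1 with hC₂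
  have hC₂0 : 0 < C₂ := by positivity
  set C₃ := |Real.log (4 * A / c₀)| + 2 with hC₃
  have hC₃0 : 0 < C₃ := by positivity
  refine ⟨2 * C₃ + Real.sqrt (2 * C₃ * C₂) + 3, fun d hd f hf => ?_⟩
  have hd1 : (1 : ℝ) ≤ d := by exact_mod_cast hd
  have hd0 : (0 : ℝ) < d := by linarith
  have hlogd : 0 ≤ Real.log d := Real.log_nonneg hd1
  have hpi : (0 : ℝ) < 2 * Real.pi := by positivity
  have h00 : -γ < 0 := by linarith
  set s₀ := c₀ / d with hs₀
  set s₁ := 4 * A * d with hs₁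
  have hs₀pos : 0 < s₀ := by positivity
  have hs₁pos : 0 < s₁ := by positivity
  have h01 : s₀ < s₁ := by
    have h1 : s₀ ≤ c₀ := div_le_self hc₀pos.le hd1
    have h2 : c₀ ≤ A := min_le_right _ _
    rw [hs₁]; nlinarith
  have hsub : ∀ x ∈ Set.Icc s₀ s₁, -γ < x := fun x hx => by linarith [hx.1]
  set F := logPartition f with hF
  set W := C₂ * (d * (1 + Real.log d)) with hW
  have hWpos : 0 < W := by positivity
  have hup0 := hf.logPartition_le_growth h00
  have hlow0 := hf.le_logPartition h00 (by linarith)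
  have hlow1 := hf.le_logPartition (β := s₁) (by linarith) (by linarith)
  have hupγ := hf.logPartition_le_growth (β := -(γ / 2)) (by linarith)
  rw [zero_add, Real.log_div hpi.ne' hγ.ne'] at hup0
  rw [zero_add, Real.log_div hpi.ne' hA.ne'] at hlow0
  rw [Real.log_div hpi.ne' (by linarith : s₁ + A ≠ 0)] at hlow1
  rw [Real.log_div hpi.ne' (by linarith : -(γ / 2) + γ ≠ 0)] at hupγ
  have hdF : F 0 - F s₁ ≤ W := by
    have h1 : Real.log (s₁ + A) ≤ Real.log (5 * A / γ) + Real.log γ + Real.log d := by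
      rw [← Real.log_mul (by positivity) (by positivity), ← Real.log_mul (by positivity)
        (by positivity)]
      apply Real.log_le_log (by linarith)
      rw [div_mul_cancel₀ _ hγ.ne', hs₁]; nlinarith
    have h2 := le_abs_self (Real.log (5 * A / γ))
    have h3 := abs_nonneg (Real.log (5 * A / γ))
    have h4 : F 0 - F s₁ ≤ C + 1 / 2 + d / 2 * (|Real.log (5 * A / γ)| + Real.log d) := by
      have := mul_le_mul_of_nonneg_left (h1.trans (by linarith :
        Real.log (5 * A / γ) + Real.log γ + Real.log d ≤
          |Real.log (5 * A / γ)| + Real.log d + Real.log γ)) (show (0 : ℝ) ≤ (d : ℝ) / 2 by positivity)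
      linarith
    refine h4.trans ?_
    have e1 : C + 1 / 2 ≤ (C + 1 / 2) * d := le_mul_of_one_le_right (by linarith) hd1
    have e2 : 0 ≤ (d : ℝ) * Real.log d := by positivity
    have e3 : 0 ≤ (d : ℝ) * |Real.log (5 * A / γ)| := by positivity
    have e4 : 0 ≤ (C + 1 / 2 + |Real.log (5 * A / γ)|) * ((d : ℝ) * Real.log d) := by positivity
    have e5 : W = (C + 1 / 2) * d + d * |Real.log (5 * A / γ)| + d + d * Real.log d +
        (C + 1 / 2 + |Real.log (5 * A / γ)|) * ((d : ℝ) * Real.log d) := by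
      rw [hW, hC₂]; ring
    rw [e5]
    nlinarith
  have hdγ : F (-(γ / 2)) - F 0 ≤ d * κ := by
    have h1 : Real.log A - Real.log (-(γ / 2) + γ) = Real.log (2 * A / γ) := by
      rw [← Real.log_div hA.ne' (by linarith)]
      congr 1
      rw [show -(γ / 2) + γ = γ / 2 by ring]; field_simp
    have h2 := le_abs_self (Real.log (2 * A / γ))
    have h3 := abs_nonneg (Real.log (2 * A / γ))
    have h4 : F (-(γ / 2)) - F 0 ≤ C + 1 / 2 + d / 2 * |Real.log (2 * A / γ)| := by
      have := mul_le_mul_of_nonneg_left (h1.trans_le h2) (show (0 : ℝ) ≤ (d : ℝ) / 2 by positivity)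
      linarith
    refine h4.trans ?_
    rw [hκ]
    nlinarith
  -- The term s₁F'(s₁) is nonpositive, and F(s₀) - s₀F'(s₀) is the value at 0 of the tangent at s₀,
  -- hence at most F(0).
  have hΨ : (s₁ * deriv F s₁ - F s₁) - (s₀ * deriv F s₀ - F s₀) ≤ W := by
    have h1 := hf.deriv_nonpos (β := s₁) (by linarith)
    have h2 := hf.tangent_le (β := s₀) (s := 0) (by linarith) h00
    have h3 := mul_nonpos_of_nonneg_of_nonpos hs₁pos.le h1
    linarith
  set ℓ := Real.log (s₁ / s₀) with hℓ
  have hℓ0 : 0 < ℓ := Real.log_pos (by rw [lt_div_iff₀ hs₀pos]; linarith)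
  have hℓle : ℓ ≤ C₃ * (1 + Real.log d) := by
    have h1 : s₁ / s₀ = 4 * A / c₀ * (d * d) := by rw [hs₁, hs₀]; field_simp
    rw [hℓ, h1, Real.log_mul (by positivity) (by positivity), Real.log_mul hd0.ne' hd0.ne', hC₃]
    have h2 := le_abs_self (Real.log (4 * A / c₀))
    have h3 := abs_nonneg (Real.log (4 * A / c₀))
    nlinarith
  set N := ⌈2 * ℓ + Real.sqrt (2 * ℓ * W)⌉₊ with hN
  have hNge : 2 * ℓ + Real.sqrt (2 * ℓ * W) ≤ N := Nat.le_ceil _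
  have hsq0 := Real.sqrt_nonneg (2 * ℓ * W)
  have hNlt := Nat.ceil_lt_add_one (show 0 ≤ 2 * ℓ + Real.sqrt (2 * ℓ * W) by positivity)
  have hN2 : 2 * ℓ * W ≤ (N : ℝ) ^ 2 := by
    rw [← Real.sqrt_le_left (by positivity)]; linarith
  have hNpos : 0 < N := by
    have : (0 : ℝ) < N := by linarith
    exact_mod_cast this
  obtain ⟨β, hβ0, hβN, hβmem, hβanti, hβgap⟩ := exists_subdivision hs₀pos h01
    (fun x hx y hy => hf.tangent_le (hsub x hx) (hsub y hy))
    (hf.analyticOnNhd.continuousOn.mono hsub) (hf.continuousOn_deriv.mono hsub) hWpos hΨ N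
    (by linarith) hN2
  refine ⟨N, β, hNpos, ?_, hβ0, fun i hi => hs₀pos.trans_le (hβmem i hi).1, hβanti, hβgap, ?_⟩
  · have hsd : 1 ≤ Real.sqrt d := Real.one_le_sqrt.mpr hd1
    have hR : 1 ≤ Real.sqrt d * (1 + Real.log d) := by nlinarith
    have h1 : ℓ ≤ C₃ * (Real.sqrt d * (1 + Real.log d)) := by
      refine hℓle.trans ?_
      gcongr
      nlinarith
    have h2 : Real.sqrt (2 * ℓ * W) ≤ Real.sqrt (2 * C₃ * C₂) *
        (Real.sqrt d * (1 + Real.log d)) := by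
      rw [← Real.sqrt_sq (show (0 : ℝ) ≤ 1 + Real.log d by linarith), ← Real.sqrt_mul hd0.le,
        ← Real.sqrt_mul (by positivity)]
      apply Real.sqrt_le_sqrt
      calc 2 * ℓ * W ≤ 2 * (C₃ * (1 + Real.log d)) * W := by gcongr
        _ = _ := by rw [hW]; ring
    calc (N : ℝ) + 2 ≤ 2 * ℓ + Real.sqrt (2 * ℓ * W) + 3 := by linarith
      _ ≤ 2 * (C₃ * (Real.sqrt d * (1 + Real.log d))) + Real.sqrt (2 * C₃ * C₂) *
        (Real.sqrt d * (1 + Real.log d)) + 3 * (Real.sqrt d * (1 + Real.log d)) := by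
          gcongr; linarith
      _ = _ := by ring
  · rw [hβN, add_zero]
    -- F is finite to the left of 0 by the quadratic growth of f; the tangent at 0 evaluated at -γ/2
    -- therefore bounds -F'(0) by 2dκ/γ.
    have h1 := hf.tangent_le (β := 0) (s := -(γ / 2)) h00 (by linarith)
    have h2 := hf.tangent_le (β := 0) (s := s₀ / 2) h00 (by linarith)
    have h3 := hf.tangent_le (β := s₀) (s := 0) (by linarith) h00
    have h4 := hf.deriv_nonpos (β := s₀) (by linarith)
    have h5 := mul_nonpos_of_nonneg_of_nonpos hs₀pos.le h4
    have h6 : -deriv F 0 * (γ / 2) ≤ d * κ := by linarith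
    have h7 : s₀ * (d * κ) ≤ γ := by
      have h8 : c₀ * κ ≤ γ := by
        have := min_le_left (γ / κ) A
        rw [← hc₀, le_div_iff₀ hκ0] at this
        exact this
      calc s₀ * (d * κ) = c₀ * κ := by rw [hs₀]; field_simp
        _ ≤ γ := h8
    have h9 : -deriv F 0 * (s₀ / 2) ≤ 1 := by
      have h10 := mul_le_mul_of_nonneg_left h6 hs₀pos.le
      have h11 : γ * (-deriv F 0 * (s₀ / 2)) ≤ γ * 1 := by linarith
      exact le_of_mul_le_mul_left h11 hγ
    linarith

lemma sq_norm_div_eq {β : ℝ} (hβ : 0 < β) (x : Space d) :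
    ‖x‖ ^ 2 / (2 * (1 / Real.sqrt β) ^ 2) = β * (‖x‖ ^ 2 / 2) := by
  rw [div_pow, Real.sq_sqrt hβ.le]; field_simp

end AnnealingSchedule

/-! ### Assembly -/

open GaussianPreparation AnnealingSchedule

theorem mainTheorem5 :
    -- universal constants: overlap, and the constants of the cost of preparing the Gaussian state
    ∃ (δ K : ℝ) (k l : ℕ), 0 < δ ∧
    ∀ (L m b : ℝ), 0 < L → 0 < m → 0 ≤ b →
    -- constant that may depend on the smoothness and dissipativity parameters only
    ∃ C : ℝ, ∀ (d N : ℕ), 0 < d → 0 < N →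
    ∀ fs : Fin N → Space d → ℝ, IsSmoothFamily L fs → IsDissipative m b (finiteAverage fs) →
    ∃ (M : ℕ) (σ : ℕ → ℝ), 2 ≤ M ∧
      (∀ i, 1 ≤ i → i < M → 0 < σ i) ∧
      (∀ i, 1 ≤ i → i + 1 < M → σ i < σ (i + 1)) ∧
      -- the initial state is efficiently preparable
      (∀ ε : ℝ, 0 < ε → ε < 1 →
        PreparableAtCost (annealingState (finiteAverage fs) σ 0) ε
          (K * (d * (1 + Real.log (1 / ε))) ^ k)) ∧
      -- consecutive states have constant overlap
      (∀ i, i + 1 < M →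
        δ ≤ ‖braket (annealingState (finiteAverage fs) σ i)
              (annealingState (finiteAverage fs) σ (i + 1))‖) ∧
      -- the final state has constant overlap with the target
      δ ≤ ‖braket (annealingState (finiteAverage fs) σ (M - 1))
            (coherentState (gibbsDensity (finiteAverage fs)))‖ ∧
      -- the length of the schedule
      (∀ c : ℝ, 0 < c → SatisfiesLSI (gibbsDensity (finiteAverage fs)) c →
        (M : ℝ) ≤ C * (c⁻¹ * Real.sqrt d * (1 + Real.log d + |Real.log c|) ^ l)) := by
  refine ⟨Real.exp (-1), 10 ^ 9, 6, 1, Real.exp_pos _, fun L m b hL hm hb => ?_⟩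
  have hA := curvature_pos (b := b) hL
  have hγ : 0 < m / 2 := by positivity
  obtain ⟨B, hB⟩ := IsPinched.exists_schedule hA hγ (offset_nonneg hL hm hb)
  set A := curvature L b
  refine ⟨B * (4 * (A * (1 + Real.exp 12))), fun d N hd hN fs hs hdis => ?_⟩
  have hf := isPinched_finiteAverage hN hL hm hb hs hdis
  set f := finiteAverage fs
  obtain ⟨n, β, hn, hnB, hβ0, hβpos, hβanti, hβgap, hβlast⟩ := hB d hd f hf
  have h00 : -(m / 2) < 0 := by linarith
  -- Widths are indexed from 1 and the parameters from 0. The n + 1 parameters and the initial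
  -- Gaussian give M = n + 2 states; the value at index 0, where the subtraction truncates, plays no
  -- role.
  let σ : ℕ → ℝ := fun i => 1 / Real.sqrt (β (i - 1))
  have hstate : ∀ i ≤ n, annealingState f σ (i + 1) =
      coherentState (gibbsDensity fun x => f x + β i * (‖x‖ ^ 2 / 2)) := by
    intro i hi
    simp only [annealingState, Nat.add_eq_zero_iff, one_ne_zero, and_false, if_false, σ,
      Nat.add_sub_cancel, sq_norm_div_eq (hβpos i hi)]
  have hstate0 : annealingState f σ 0 =
      coherentState (gibbsDensity fun x => β 0 * (‖x‖ ^ 2 / 2)) := by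
    simp only [annealingState, if_true, σ, Nat.sub_self, sq_norm_div_eq (hβpos 0 (Nat.zero_le _))]
  have hσpos : ∀ i ≤ n, 0 < σ (i + 1) := fun i hi =>
    one_div_pos.mpr (Real.sqrt_pos.mpr (hβpos i hi))
  refine ⟨n + 2, σ, by omega, fun i hi1 hi2 => ?_, fun i hi1 hi2 => ?_, fun ε hε hε1 => ?_,
    fun i hi => ?_, ?_, fun c hc hlsi => ?_⟩
  · obtain ⟨j, rfl⟩ := Nat.exists_eq_add_of_le' hi1
    exact hσpos j (by omega)
  · obtain ⟨j, rfl⟩ := Nat.exists_eq_add_of_le' hi1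
    have h1 := hβpos (j + 1) (by omega)
    exact one_div_lt_one_div_of_lt (Real.sqrt_pos.mpr h1)
      (Real.sqrt_lt_sqrt h1.le (hβanti j (by omega)))
  · simp only [annealingState, if_true]
    exact preparable_gaussian hd (hσpos 0 (Nat.zero_le _)) hε hε1
  · rcases i with _ | i
    · rw [hstate0, hstate 0 (Nat.zero_le _), hβ0]
      exact hf.initial_overlap hd hA hγ
    · have h1 := hβpos i (by omega)
      have h2 := hβpos (i + 1) (by omega)
      rw [hstate i (by omega), hstate (i + 1) (by omega)]
      refine hf.overlap (by linarith) (by linarith) ?_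
      have := hβgap i (by omega)
      rwa [add_comm (β (i + 1)), add_comm (logPartition f (β (i + 1)))] at this
  · have h1 := hf.overlap (s := β n) (t := 0) (by linarith [hβpos n le_rfl]) h00 hβlast
    simp only [zero_mul, add_zero] at h1
    rw [show n + 2 - 1 = n + 1 by omega, hstate n le_rfl]
    exact h1
  · have hd1 : (1 : ℝ) ≤ d := by exact_mod_cast hd
    have hlogd : 0 ≤ Real.log d := Real.log_nonneg hd1
    have hc1 := hf.lsi_le hd hA hγ hc hlsi
    have hn0 : (0 : ℝ) ≤ n := n.cast_nonneg
    have hBpos : 0 ≤ B * (Real.sqrt d * (1 + Real.log d)) := by linarith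
    -- This is where 1/c enters: the length bound does not involve c and is multiplied by a quantity
    -- that is at least 1.
    have hratio : 1 ≤ 4 * (A * (1 + Real.exp 12)) * c⁻¹ := by
      rw [← div_eq_mul_inv, one_le_div hc]; exact hc1
    have hB0 : 0 ≤ B := by
      have : 0 < Real.sqrt d * (1 + Real.log d) := by positivity
      exact nonneg_of_mul_nonneg_left hBpos this
    have hab := abs_nonneg (Real.log c)
    push_cast
    rw [pow_one]
    calc (n : ℝ) + 2 ≤ B * (Real.sqrt d * (1 + Real.log d)) := hnB
      _ ≤ B * (Real.sqrt d * (1 + Real.log d)) * (4 * (A * (1 + Real.exp 12)) * c⁻¹) :=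
          le_mul_of_one_le_right hBpos hratio
      _ ≤ B * (Real.sqrt d * (1 + Real.log d + |Real.log c|)) *
            (4 * (A * (1 + Real.exp 12)) * c⁻¹) := by
          have h1 : 1 + Real.log d ≤ 1 + Real.log d + |Real.log c| := by linarith
          exact mul_le_mul_of_nonneg_right (mul_le_mul_of_nonneg_left
            (mul_le_mul_of_nonneg_left h1 (Real.sqrt_nonneg _)) hB0) (zero_le_one.trans hratio)
      _ = _ := by ring
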